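/- **Setting.** Let $d\ge 1$, let $\mathcal S$ be the space of real Schwartz functions on $\mathbb R^d$, and let $\mathcal S'$ be its dual (tempered distributions) with the weak topology and its Borel $\sigma$-algebra. For a continuous function $\psi:\mathbb R\to\mathbb C$, the noise with Lévy characteristic $\psi$ is the random element $F$ of $\mathcal S'$ whose law has characteristic functional $\mathbb E[e^{iF(f)}]=\exp\int_{\mathbb R^d}\psi(f(x))\,dx$, $f\in\mathcal S$. Let $r$ be a probability measure on $[-c,c]$ with $r\{0\}=0$ and $\int s\,dr(s)=0$, and put $\sigma^2=\int s^2\,dr(s)$. For $z\ge 1$ let $F^z$ be the Poisson noise of activity $z$ with scaled charges $s/\sqrt z$, i.e. $\psi_z(t)=z\int (e^{ist/\sqrt z}-1)\,dr(s)$, and let $F^\sigma$ be the Gaussian noise, $\psi(t)=-\sigma^2t^2/2$. Let $G\in\mathcal S'$ be such that $f\mapsto f*G$ maps $\mathcal S$ continuously into $\mathcal S$ (so that convolution with $G$ acts continuously on $\mathcal S'$; e.g. the Green's function of a symmetric, Euclidean invariant, continuously invertible operator on $\mathcal S'$). Let $\chi\in C_0^\infty(\mathbb R^d)$ be symmetric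 and nonnegative with $\int\chi\,dx=1$; for $\epsilon>0$ let $\chi^\epsilon(x)=\chi(x/\epsilon)/\epsilon^d$ and $G^\epsilon=\chi^\epsilon*G\in\mathcal S$. Let $X_\epsilon^{z}=G^\epsilon*F^{z}$ and $X_\epsilon^{\sigma}=G^\epsilon*F^{\sigma}$; these fields have smooth paths. Let $\Lambda\subset\mathbb R^d$ be compact and $\beta>0$. For an energy density $v:\mathbb R\to\mathbb R$ let $$V_{\Lambda,\epsilon}^{z/\sigma}=\int_\Lambda v(X_\epsilon^{z/\sigma}(x))\,dx,\qquad P^{\bar X^{z/\sigma}_{\epsilon,\Lambda}}=\frac{e^{-\beta V_{\Lambda,\epsilon}^{z/\sigma}}}{\Xi_{\Lambda,\epsilon}^{z/\sigma}}\,P^{X_\epsilon^{z/\sigma}},\qquad \Xi_{\Lambda,\epsilon}^{z/\sigma}=\mathbb E\big[e^{-\beta V_{\Lambda,\epsilon}^{z/\sigma}}\big],$$ and let $\bar X^{z/\sigma}_{\epsilon,\Lambda}$ be the random elements of $\mathcal S'$ with these laws. Convergence in law means weak convergence of the laws on $\mathcal S'$. **Theorem 7.1.** Let $v$ be measurable and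 bounded. Then $P^{\bar X^{z}_{\epsilon,\Lambda}}$ ($z\ge 1$) and $P^{\bar X^{\sigma}_{\epsilon,\Lambda}}$ are probability measures, and $\bar X^{z}_{\epsilon,\Lambda}\to\bar X^{\sigma}_{\epsilon,\Lambda}$ in law as $z\to\infty$. **Corollary 7.1.** Let $\nu$ be a finite complex measure on $[-b,b]$ with $\nu(A)=\overline{\nu(-A)}$ for all measurable $A$, and let $x\in\mathbb R^d$. There is $\delta>0$ such that for all sufficiently large $z$ one has $\mathbb E[\cos(\alpha X_\epsilon^{z}(x))]\ge\delta$ and $\mathbb E[\cos(\alpha X_\epsilon^{\sigma}(x))]\ge\delta$ for all $\alpha\in[-b,b]$. Hence the normal ordered energy densities $$:v(t):_\epsilon^{z/\sigma}\;=\int_{[-b,b]}\frac{\cos(\alpha t)}{\mathbb E[\cos(\alpha X_\epsilon^{z/\sigma}(x))]}\,d\nu(\alpha)$$ are well defined for these $z$ and for $\sigma$. If $v$ is replaced by $:v:_\epsilon^{z}$ in the definition of $\bar X^z_{\epsilon,\Lambda}$ and by $:v:_\epsilon^{\sigma}$ in that of $\bar X^\sigma_{\epsilon,\Lambda}$, then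 the laws of $\bar X^{z}_{\epsilon,\Lambda}$ for all sufficiently large $z$ and of $\bar X^{\sigma}_{\epsilon,\Lambda}$ are probability measures, and $\bar X^{z}_{\epsilon,\Lambda}\to\bar X^{\sigma}_{\epsilon,\Lambda}$ in law as $z\to\infty$. -/

import Mathlib

open MeasureTheory Filter Topology Set SchwartzMap
open scoped BoundedContinuousFunction

noncomputable section

namespace CPN

/-- Euclidean space-time `ℝ^d`. -/
abbrev Space (d : ℕ) : Type := EuclideanSpace ℝ (Fin d)

/-- The space `𝓢` of real valued rapidly decreasing test functions on `ℝ^d`. -/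
abbrev TestFun (d : ℕ) : Type := 𝓢(Space d, ℝ)

/-- The space `𝓢'` of real tempered distributions, with the weak topology (the topology of
pointwise convergence on test functions). -/
abbrev Distr (d : ℕ) : Type := TestFun d →Lₚₜ[ℝ] ℝ

/-- The Borel sigma-algebra of the weak topology on `𝓢'`. -/
instance instMeasurableSpaceDistr (d : ℕ) : MeasurableSpace (Distr d) := borel _

instance instBorelSpaceDistr (d : ℕ) : BorelSpace (Distr d) := ⟨rfl⟩

/-! ### Convolution of test functions -/

section Convolution

variable {d : ℕ}

theorem integrable_smul_translate {F : Type} [NormedAddCommGroup F] [NormedSpace ℝ F]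
    (g : TestFun d) (f : 𝓢(Space d, F)) (x : Space d) :
    Integrable (fun y => g y • f (x - y)) := by
  refine Integrable.mono' ((g.integrable (μ := volume)).norm.mul_const
    (SchwartzMap.seminorm ℝ 0 0 f)) ?_ (Eventually.of_forall fun y => ?_)
  · exact (g.continuous.smul (f.continuous.comp (by fun_prop))).aestronglyMeasurable
  · rw [norm_smul]
    exact mul_le_mul_of_nonneg_left (norm_le_seminorm ℝ f _) (norm_nonneg _)

theorem hasFDerivAt_conv {F : Type} [NormedAddCommGroup F] [NormedSpace ℝ F]
    (g : TestFun d) (f : 𝓢(Space d, F)) (x : Space d) :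
    HasFDerivAt (fun x => ∫ y, g y • f (x - y))
      (∫ y, g y • fderivCLM ℝ (Space d) F f (x - y)) x := by
  refine hasFDerivAt_integral_of_dominated_of_fderiv_le
    (F := fun x y => g y • f (x - y))
    (F' := fun x y => g y • fderivCLM ℝ (Space d) F f (x - y))
    (bound := fun y => ‖g y‖ * SchwartzMap.seminorm ℝ 0 0 (fderivCLM ℝ (Space d) F f))
    (s := univ) univ_mem ?_ (integrable_smul_translate g f x) ?_ ?_ ?_ ?_
  · exact Eventually.of_forall fun x => (integrable_smul_translate g f x).aestronglyMeasurable
  · exact (integrable_smul_translate g _ x).aestronglyMeasurable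
  · refine Eventually.of_forall fun y x _ => ?_
    rw [norm_smul]
    exact mul_le_mul_of_nonneg_left (norm_le_seminorm ℝ _ _) (norm_nonneg _)
  · exact (g.integrable (μ := volume)).norm.mul_const _
  · refine Eventually.of_forall fun y x _ => ?_
    have h := (f.hasFDerivAt (x - y)).comp x ((hasFDerivAt_id x).sub_const y)
    exact h.const_smul (g y)

theorem fderiv_conv {F : Type} [NormedAddCommGroup F] [NormedSpace ℝ F]
    (g : TestFun d) (f : 𝓢(Space d, F)) :
    fderiv ℝ (fun x => ∫ y, g y • f (x - y)) =
      fun x => ∫ y, g y • fderivCLM ℝ (Space d) F f (x - y) :=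
  funext fun x => (hasFDerivAt_conv g f x).fderiv

theorem contDiff_nat_conv (g : TestFun d) (n : ℕ) :
    ∀ (F : Type) [NormedAddCommGroup F] [NormedSpace ℝ F] (f : 𝓢(Space d, F)),
      ContDiff ℝ n (fun x => ∫ y, g y • f (x - y)) := by
  induction n with
  | zero =>
    intro F _ _ f
    exact contDiff_zero.2 (continuous_iff_continuousAt.2 fun x =>
      (hasFDerivAt_conv g f x).continuousAt)
  | succ n ih =>
    intro F _ _ f
    have h : ((n + 1 : ℕ) : WithTop ℕ∞) = (n : WithTop ℕ∞) + 1 := by push_cast; rfl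
    rw [h, contDiff_succ_iff_fderiv]
    refine ⟨fun x => (hasFDerivAt_conv g f x).differentiableAt, by simp, ?_⟩
    rw [fderiv_conv]
    exact ih _ _

theorem conv_bound (g : TestFun d) (k n : ℕ) :
    ∀ (F : Type) [NormedAddCommGroup F] [NormedSpace ℝ F] (f : 𝓢(Space d, F)) (x : Space d),
      ‖x‖ ^ k * ‖iteratedFDeriv ℝ n (fun x => ∫ y, g y • f (x - y)) x‖ ≤
        2 ^ k * ((∫ y, ‖y‖ ^ k * ‖g y‖) * SchwartzMap.seminorm ℝ 0 n f +
          (∫ y, ‖g y‖) * SchwartzMap.seminorm ℝ k n f) := by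
  induction n with
  | zero =>
    intro F _ _ f x
    rw [norm_iteratedFDeriv_zero]
    have i1 : Integrable (fun y => ‖y‖ ^ k * ‖g y‖) := g.integrable_pow_mul volume k
    have i2 : Integrable (fun y => ‖g y‖) := (g.integrable (μ := volume)).norm
    calc ‖x‖ ^ k * ‖∫ y, g y • f (x - y)‖
        ≤ ‖x‖ ^ k * ∫ y, ‖g y • f (x - y)‖ :=
          mul_le_mul_of_nonneg_left (norm_integral_le_integral_norm _) (by positivity)
      _ = ∫ y, ‖x‖ ^ k * ‖g y • f (x - y)‖ := (integral_const_mul _ _).symm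
      _ ≤ ∫ y, 2 ^ k * ((‖y‖ ^ k * ‖g y‖) * SchwartzMap.seminorm ℝ 0 0 f +
            ‖g y‖ * SchwartzMap.seminorm ℝ k 0 f) := by
          refine integral_mono ((integrable_smul_translate g f x).norm.const_mul _)
            (((i1.mul_const _).add (i2.mul_const _)).const_mul _) fun y => ?_
          have h1 : ‖x‖ ^ k ≤ 2 ^ k * (‖y‖ ^ k + ‖x - y‖ ^ k) := by
            have hx : ‖x‖ ≤ ‖y‖ + ‖x - y‖ := by
              calc ‖x‖ = ‖y + (x - y)‖ := by congr 1; abel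
                _ ≤ _ := norm_add_le _ _
            have hm : ‖y‖ + ‖x - y‖ ≤ 2 * max ‖y‖ ‖x - y‖ := by
              have := le_max_left ‖y‖ ‖x - y‖
              have := le_max_right ‖y‖ ‖x - y‖
              linarith
            calc ‖x‖ ^ k ≤ (2 * max ‖y‖ ‖x - y‖) ^ k :=
                  pow_le_pow_left₀ (norm_nonneg _) (hx.trans hm) k
              _ = 2 ^ k * (max ‖y‖ ‖x - y‖) ^ k := mul_pow _ _ _
              _ ≤ _ := by
                  refine mul_le_mul_of_nonneg_left ?_ (by positivity)
                  rcases max_choice ‖y‖ ‖x - y‖ with h | h <;> rw [h]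
                  · exact le_add_of_nonneg_right (by positivity)
                  · exact le_add_of_nonneg_left (by positivity)
          have h2 : ‖f (x - y)‖ ≤ SchwartzMap.seminorm ℝ 0 0 f := norm_le_seminorm ℝ f _
          have h3 : ‖x - y‖ ^ k * ‖f (x - y)‖ ≤ SchwartzMap.seminorm ℝ k 0 f :=
            norm_pow_mul_le_seminorm ℝ f k _
          show ‖x‖ ^ k * ‖g y • f (x - y)‖ ≤ _
          rw [norm_smul]
          calc ‖x‖ ^ k * (‖g y‖ * ‖f (x - y)‖)
              ≤ (2 ^ k * (‖y‖ ^ k + ‖x - y‖ ^ k)) * (‖g y‖ * ‖f (x - y)‖) :=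
                mul_le_mul_of_nonneg_right h1 (by positivity)
            _ = 2 ^ k * ((‖y‖ ^ k * ‖g y‖) * ‖f (x - y)‖ +
                  ‖g y‖ * (‖x - y‖ ^ k * ‖f (x - y)‖)) := by ring
            _ ≤ _ := by gcongr
      _ = _ := by
          rw [integral_const_mul, integral_add (i1.mul_const _) (i2.mul_const _),
            integral_mul_const, integral_mul_const]
  | succ n ih =>
    intro F _ _ f x
    rw [← norm_iteratedFDeriv_fderiv, fderiv_conv]
    have hs : ∀ j, SchwartzMap.seminorm ℝ j n (fderivCLM ℝ (Space d) F f) ≤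
        SchwartzMap.seminorm ℝ j (n + 1) f := fun j =>
      seminorm_le_bound ℝ j n _ (apply_nonneg _ _) fun x => by
        have h := f.le_seminorm ℝ j (n + 1) x
        rw [← norm_iteratedFDeriv_fderiv] at h
        exact h
    refine (ih _ (fderivCLM ℝ (Space d) F f) x).trans ?_
    have p1 : 0 ≤ ∫ y, ‖y‖ ^ k * ‖g y‖ := integral_nonneg fun y => by positivity
    have p2 : 0 ≤ ∫ y, ‖g y‖ := integral_nonneg fun y => by positivity
    have q0 := hs 0
    have qk := hs k
    gcongr

/-- Convolution `f ↦ g * f`, `(g * f)(x) = ∫ g(y) f(x - y) dy`, with a test function `g`, as a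
continuous linear map of `𝓢` into itself. -/
def conv (g : TestFun d) : TestFun d →L[ℝ] TestFun d :=
  mkCLM (fun f x => ∫ y, g y • f (x - y))
    (fun f h x => by
      simp only [add_apply, smul_add]
      exact integral_add (integrable_smul_translate g f x) (integrable_smul_translate g h x))
    (fun a f x => by
      simp only [smul_apply, smul_comm _ a]
      exact integral_smul _ _)
    (fun f => contDiff_infty.2 fun n => contDiff_nat_conv g n ℝ f)
    (fun n => by
      refine ⟨{(0, n.2), (n.1, n.2)},
        2 ^ n.1 * ((∫ y, ‖y‖ ^ n.1 * ‖g y‖) + (∫ y, ‖g y‖)), ?_, fun f x => ?_⟩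
      · have p1 : 0 ≤ ∫ y, ‖y‖ ^ n.1 * ‖g y‖ := integral_nonneg fun y => by positivity
        have p2 : 0 ≤ ∫ y, ‖g y‖ := integral_nonneg fun y => by positivity
        positivity
      · have p1 : 0 ≤ ∫ y, ‖y‖ ^ n.1 * ‖g y‖ := integral_nonneg fun y => by positivity
        have p2 : 0 ≤ ∫ y, ‖g y‖ := integral_nonneg fun y => by positivity
        refine (conv_bound g n.1 n.2 ℝ f x).trans ?_
        have hle : ∀ m ∈ ({(0, n.2), (n.1, n.2)} : Finset (ℕ × ℕ)),
            schwartzSeminormFamily ℝ (Space d) ℝ m f ≤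
            (({(0, n.2), (n.1, n.2)} : Finset (ℕ × ℕ)).sup
              (schwartzSeminormFamily ℝ (Space d) ℝ)) f := fun m hm =>
          (Finset.le_sup (f := schwartzSeminormFamily ℝ (Space d) ℝ) hm :) f
        have q0 : SchwartzMap.seminorm ℝ 0 n.2 f ≤ _ := hle (0, n.2) (by simp)
        have qk : SchwartzMap.seminorm ℝ n.1 n.2 f ≤ _ := hle (n.1, n.2) (by simp)
        rw [mul_assoc, add_mul]
        gcongr)

theorem conv_apply (g f : TestFun d) (x : Space d) :
    conv g f x = ∫ y, g y * f (x - y) := rfl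

/-- Reflection `f ↦ f(-·)` on test functions. -/
def refl (d : ℕ) : TestFun d →L[ℝ] TestFun d :=
  compCLMOfContinuousLinearEquiv ℝ (ContinuousLinearEquiv.neg ℝ)

theorem refl_apply (f : TestFun d) (y : Space d) : refl d f y = f (-y) := rfl

/-- The test function `y ↦ f (x - y)`. -/
def reflTranslate (x : Space d) (f : TestFun d) : TestFun d :=
  compSubConstCLM ℝ x (refl d f)

theorem reflTranslate_apply (x : Space d) (f : TestFun d) (y : Space d) :
    reflTranslate x f y = f (x - y) := by
  simp [reflTranslate, refl_apply]

/-- The convolution `g * ω` of a test function `g` and a tempered distribution `ω`, as a (smooth)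
function: `(g * ω)(x) = ⟨ω, g(x - ·)⟩`. -/
def convFun (g : TestFun d) (ω : Distr d) (x : Space d) : ℝ := ω (reflTranslate x g)

/-- The convolution `g * ω` as a tempered distribution: `⟨g * ω, f⟩ = ⟨ω, g(-·) * f⟩`. -/
def convDistr (g : TestFun d) : Distr d →L[ℝ] Distr d :=
  PointwiseConvergenceCLM.precomp ℝ (conv (refl d g))

theorem convDistr_apply (g : TestFun d) (ω : Distr d) (f : TestFun d) :
    convDistr g ω f = ω (conv (refl d g) f) := rfl

/-- Convolution with the tempered distribution `G` maps test functions to test functions,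
continuously. By duality, this makes `ω ↦ G * ω` a continuous map of `𝓢'` into itself. -/
def IsConvolutor (G : Distr d) : Prop :=
  ∃ T : TestFun d →L[ℝ] TestFun d, ∀ f x, T f x = convFun f G x

/-- The convolution `f * G` of a test function and a convolutor, as a test function. -/
def IsConvolutor.conv {G : Distr d} (hG : IsConvolutor G) (f : TestFun d) : TestFun d :=
  hG.choose f

theorem IsConvolutor.conv_apply {G : Distr d} (hG : IsConvolutor G) (f : TestFun d)
    (x : Space d) : hG.conv f x = convFun f G x := hG.choose_spec f x

end Convolution

/-! ### Ultra-violet cut-off -/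

open scoped ContDiff in
/-- An ultra-violet cut-off function: `χ ∈ C_0^∞(ℝ^d)` symmetric, nonnegative, with `∫ χ = 1`. -/
structure Cutoff (d : ℕ) where
  toFun : Space d → ℝ
  smooth : ContDiff ℝ ∞ toFun
  hasCompactSupport : HasCompactSupport toFun
  symm : ∀ x, toFun (-x) = toFun x
  nonneg : ∀ x, 0 ≤ toFun x
  integral_eq_one : ∫ x, toFun x = 1

/-- The rescaled cut-off function `χ^ε(x) = χ(x/ε)/ε^d`. -/
def Cutoff.scaled {d : ℕ} (χ : Cutoff d) (ε : ℝ) (hε : 0 < ε) : TestFun d :=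
  HasCompactSupport.toSchwartzMap (f := fun x => χ.toFun (ε⁻¹ • x) / ε ^ d)
    (by
      have h := χ.hasCompactSupport.comp_smul (inv_ne_zero hε.ne')
      have h2 : HasCompactSupport ((fun x => χ.toFun (ε⁻¹ • x)) * fun _ => (ε ^ d)⁻¹) := h.mul_right
      exact h2)
    ((χ.smooth.comp (contDiff_id.const_smul ε⁻¹)).div_const _)

theorem Cutoff.scaled_apply {d : ℕ} (χ : Cutoff d) (ε : ℝ) (hε : 0 < ε) (x : Space d) :
    χ.scaled ε hε x = χ.toFun (ε⁻¹ • x) / ε ^ d := rfl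

/-- The ultra-violet regularized kernel `G^ε = χ^ε * G`. -/
def regKernel {d : ℕ} {G : Distr d} (hG : IsConvolutor G) (χ : Cutoff d) (ε : ℝ) (hε : 0 < ε) :
    TestFun d :=
  hG.conv (χ.scaled ε hε)

/-! ### Noise fields -/

/-- The law `r_z` of the scaled charge `s/√z`, when `s` has law `r`. -/
def scaledCharges (r : Measure ℝ) (z : ℝ) : Measure ℝ := r.map (fun s => s / √z)

/-- The pure Poisson Lévy characteristic `t ↦ z ∫ (e^{ist} - 1) dr(s)` with activity `z` and
Lévy measure `r`. -/
def poissonChar (z : ℝ) (r : Measure ℝ) (t : ℝ) : ℂ :=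
  z * ∫ s, (Complex.exp (Complex.I * (s * t : ℝ)) - 1) ∂r

/-- The pure Gaussian Lévy characteristic `t ↦ - σ² t² / 2`. -/
def gaussianChar (σsq : ℝ) (t : ℝ) : ℂ := ((-(σsq / 2 * t ^ 2) : ℝ) : ℂ)

/-- `P` is the law on `𝓢'` of the (generalized white) noise with Lévy characteristic `ψ`: the
probability measure with characteristic functional `C(f) = exp (∫ ψ(f(x)) dx)`. -/
structure IsNoiseLaw {d : ℕ} (ψ : ℝ → ℂ) (P : Measure (Distr d)) : Prop where
  isProbabilityMeasure : IsProbabilityMeasure P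
  charFunctional : ∀ f : TestFun d,
    ∫ ω, Complex.exp (Complex.I * (ω f : ℝ)) ∂P = Complex.exp (∫ x, ψ (f x))

/-! ### Interacting fields -/

/-- The potential `V_Λ = ⟨v(X), 1_Λ⟩ = ∫_Λ v(X(x)) dx` of a path `X`, with energy density `v`
and infra-red cut-off `Λ`. -/
def potential {d : ℕ} (v : ℝ → ℝ) (Λ : Set (Space d)) (X : Space d → ℝ) : ℝ :=
  ∫ x in Λ, v (X x)

/-- The law on `𝓢'` of the interacting field. Under the noise law `P`, the free field is
`X = g * ω`; the interacting field is the same field under the probability measure with density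
`e^{-β V_Λ(X)} / Ξ`, `Ξ = E[e^{-β V_Λ(X)}]`, relative to `P`. -/
def interactingLaw {d : ℕ} (P : Measure (Distr d)) (g : TestFun d) (v : ℝ → ℝ) (β : ℝ)
    (Λ : Set (Space d)) : Measure (Distr d) :=
  (P.tilted fun ω => -β * potential v Λ (convFun g ω)).map (convDistr g)

/-- The expectation `E[cos(α X(x))]` of the free field `X = g * ω` under the noise law `P`. -/
def cosMean {d : ℕ} (P : Measure (Distr d)) (g : TestFun d) (x : Space d) (α : ℝ) : ℝ :=
  ∫ ω, Real.cos (α * convFun g ω x) ∂P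

/-- The normal ordered trigonometric energy density
`:v(t): = ∫ :cos(α t): dν(α)`, `:cos(α t): = cos(α t) / E[cos(α X(x))]`. -/
def normalOrdered {d : ℕ} (P : Measure (Distr d)) (g : TestFun d) (x : Space d)
    (ν : ComplexMeasure ℝ) (t : ℝ) : ℝ :=
  (∫ᵛ α, Real.cos (α * t) / cosMean P g x α ∂•ν).re

/-- Convergence in law, as `z → ∞`, of random elements of `𝓢'` with laws `μ z` to one with law
`μ'`: weak convergence of these laws, for the weak topology on `𝓢'`. The laws `μ z` need to be
probability measures only for large `z`. -/
def ConvergesInLaw {d : ℕ} (μ : ℝ → Measure (Distr d)) (μ' : Measure (Distr d)) : Prop :=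
  (∀ᶠ z in atTop, IsProbabilityMeasure (μ z)) ∧ IsProbabilityMeasure μ' ∧
    ∀ φ : Distr d →ᵇ ℝ, Tendsto (fun z => ∫ ω, φ ω ∂(μ z)) atTop (𝓝 (∫ ω, φ ω ∂μ'))

end CPN

end

/-!
# Convergence of interacting Poisson fields to interacting Gaussian fields

Write `X = g * ω` for the free field, `V(X) = ∫_Λ v(X(x)) dx` for its potential, and let the noise
`ω` have law `P_z` (Poisson) or `P_σ` (Gaussian). The law of the interacting field integrates a
bounded continuous `φ` to `E[φ(X) e^{-βV(X)}] / E[e^{-βV(X)}]`. The denominator is the numerator for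
`φ = 1`, and it is positive, so it suffices that the numerators converge.

Since the charges are centred, the Lévy characteristics `ψ_z` satisfy `|ψ_z(t)| ≤ C t²` uniformly in
`z ≥ 1` and converge pointwise to `-σ²t²/2`. By dominated convergence the characteristic functionals
converge, and the Lévy continuity theorem in finite dimension gives convergence of expectations of
bounded *cylinder functionals*, that is, of continuous functions of finitely many values `ω f`
(`tendsto_integral_of_isCylinder`). It remains to approximate `φ(X)` and `V(X)` in mean by cylinder
functionals, uniformly in the noise.

* *The functional `φ(X)`* (`exists_isCylinder_approx`). The bound on `ψ_z` bounds the second moments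
  of the noise by those of a white noise (`lintegral_sq_noise_le`). Hence `∫ |X(x)| (1+|x|)^{-d-1} dx`
  is bounded in mean, and it controls `|⟨X, f⟩|` by a fixed Schwartz seminorm of `f`. By
  Banach–Alaoglu the laws of `X` on `𝓢'` are uniformly tight, and `φ` is approximated by cylinder
  functionals on a compact set by Stone–Weierstrass. That `⟨X, f⟩ = ∫ f(x) X(x) dx` is proved by
  writing a distribution as a functional of finitely many weighted derivatives.
* *The potential, for uniformly continuous `v`*
  (`exists_isCylinder_potential_of_uniformContinuous`): Riemann sums, since `E[(X(x) - X(y))²]` is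
  bounded by a multiple of `|x - y|`.
* *The potential, for measurable `v`* (`exists_isCylinder_potential_of_density`): replace `v` by a
  uniformly continuous function off a set of small Lebesgue measure. This needs that the laws of
  `X(x)` do not charge small sets, uniformly in large `z`. In the Gaussian case they have bounded
  density. In the Poisson case there can be atoms, but the law is the sum of a part with density
  bounded uniformly in `z` and of a part of mass `e^{-zm}` with `m > 0` (`exists_density_bound`).

For the last point, split off from the jumps `s g(y)` of `X(x)` those selected with probability
`W(s, y) = κ min(s², 1) (∂_v g(y))⁴`. Two integrations by parts show that the characteristic function
`L` of the image of `W` under `s g(y)` decays quadratically (`exists_oscillatory_bound`): the power of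
`∂_v g` cancels the denominators that arise, whatever the critical points of `g`. The characteristic
function of `X(x)` is therefore `e^{z(L(t/√z) - m)}`, with `m = L(0)`, times a limit of characteristic
functions. The first factor tends to `e^{-zm}` at infinity, and after subtraction of this constant
its `L¹` norm is bounded uniformly in `z ≥ 1` (`exists_integral_exp_char_le`), which gives the density
bound by Fourier inversion against test functions (`measure_le_of_charFun_eq`).

The case of energy densities depending on `z` follows if they converge uniformly. For the normal
ordered densities, the means `E[cos(αX(x))]` are uniformly Lipschitz in `α` and converge pointwise,
hence uniformly on `[-b, b]`, to a Gaussian function of `α` that is bounded below there.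
-/

noncomputable section

namespace CPN

variable {d : ℕ}

/-! ### Translations of test functions and smeared paths -/

theorem iteratedFDeriv_reflTranslate (g : TestFun d) (n : ℕ) (x u : Space d) :
    iteratedFDeriv ℝ n (reflTranslate x g) u = iteratedFDeriv ℝ n (refl d g) (u - x) := by
  have : (reflTranslate x g : Space d → ℝ) = fun u => refl d g (u - x) := by
    ext u; simp [reflTranslate]
  rw [this, iteratedFDeriv_comp_sub]

theorem pow_norm_le_two_pow_mul (k : ℕ) (u x : Space d) :
    ‖u‖ ^ k ≤ 2 ^ k * (‖u - x‖ ^ k + ‖x‖ ^ k) := by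
  have hx : ‖u‖ ≤ 2 * max ‖u - x‖ ‖x‖ := by
    have h1 : ‖u‖ ≤ ‖u - x‖ + ‖x‖ := by simpa using norm_add_le (u - x) x
    have := le_max_left ‖u - x‖ ‖x‖
    have := le_max_right ‖u - x‖ ‖x‖
    linarith
  calc ‖u‖ ^ k ≤ (2 * max ‖u - x‖ ‖x‖) ^ k := pow_le_pow_left₀ (norm_nonneg _) hx k
    _ = 2 ^ k * (max ‖u - x‖ ‖x‖) ^ k := mul_pow _ _ _
    _ ≤ _ := by
      refine mul_le_mul_of_nonneg_left ?_ (by positivity)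
      rcases max_choice ‖u - x‖ ‖x‖ with h | h <;> rw [h]
      · exact le_add_of_nonneg_right (by positivity)
      · exact le_add_of_nonneg_left (by positivity)

theorem pow_mul_norm_iteratedFDeriv_sub_le (h : TestFun d) (k n : ℕ) (x u : Space d) :
    ‖u‖ ^ k * ‖iteratedFDeriv ℝ n h (u - x)‖ ≤
      2 ^ k * (SchwartzMap.seminorm ℝ k n h + ‖x‖ ^ k * SchwartzMap.seminorm ℝ 0 n h) := by
  have h1 := h.le_seminorm ℝ k n (u - x)
  have h2 := h.norm_iteratedFDeriv_le_seminorm ℝ n (u - x)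
  calc ‖u‖ ^ k * ‖iteratedFDeriv ℝ n h (u - x)‖
      ≤ (2 ^ k * (‖u - x‖ ^ k + ‖x‖ ^ k)) * ‖iteratedFDeriv ℝ n h (u - x)‖ := by
        gcongr; exact pow_norm_le_two_pow_mul k u x
    _ = 2 ^ k * (‖u - x‖ ^ k * ‖iteratedFDeriv ℝ n h (u - x)‖
          + ‖x‖ ^ k * ‖iteratedFDeriv ℝ n h (u - x)‖) := by ring
    _ ≤ _ := by gcongr

theorem seminorm_reflTranslate_le (g : TestFun d) (k n : ℕ) (x : Space d) :
    SchwartzMap.seminorm ℝ k n (reflTranslate x g) ≤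
      2 ^ k * (SchwartzMap.seminorm ℝ k n (refl d g) +
        ‖x‖ ^ k * SchwartzMap.seminorm ℝ 0 n (refl d g)) := by
  refine seminorm_le_bound ℝ k n _ (by positivity) fun u => ?_
  rw [iteratedFDeriv_reflTranslate]
  exact pow_mul_norm_iteratedFDeriv_sub_le _ k n x u

/-- Translation is Lipschitz for each Schwartz seminorm, locally uniformly, by the mean value
inequality. -/
theorem seminorm_reflTranslate_sub_le (g : TestFun d) (k n : ℕ) {R : ℝ} {x y : Space d}
    (hx : ‖x‖ ≤ R) (hy : ‖y‖ ≤ R) :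
    SchwartzMap.seminorm ℝ k n (reflTranslate x g - reflTranslate y g) ≤
      2 ^ k * (SchwartzMap.seminorm ℝ k (n + 1) (refl d g) +
        R ^ k * SchwartzMap.seminorm ℝ 0 (n + 1) (refl d g)) * ‖x - y‖ := by
  have hR : 0 ≤ R := (norm_nonneg x).trans hx
  refine seminorm_le_bound ℝ k n _ (by positivity) fun u => ?_
  have e : iteratedFDeriv ℝ n (reflTranslate x g - reflTranslate y g : TestFun d) u =
      iteratedFDeriv ℝ n (refl d g) (u - x) - iteratedFDeriv ℝ n (refl d g) (u - y) := by
    rw [← iteratedFDeriv_reflTranslate, ← iteratedFDeriv_reflTranslate]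
    have := iteratedFDeriv_sub_apply (i := n) (𝕜 := ℝ)
      ((reflTranslate x g).smooth n).contDiffAt ((reflTranslate y g).smooth n).contDiffAt (x := u)
    simpa using this
  set h := refl d g
  set C := 2 ^ k * (SchwartzMap.seminorm ℝ k (n + 1) h + R ^ k * SchwartzMap.seminorm ℝ 0 (n + 1) h)
  have hdiff : Differentiable ℝ (iteratedFDeriv ℝ n h) :=
    (h.smooth (n + 1)).differentiable_iteratedFDeriv (by exact_mod_cast Nat.lt_succ_self n)
  have key := (convex_closedBall (0 : Space d) R).norm_image_sub_le_of_norm_fderiv_le (𝕜 := ℝ)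
    (f := fun ξ => ‖u‖ ^ k • iteratedFDeriv ℝ n h (u - ξ)) (C := C) (x := y) (y := x)
    (fun ξ _ => (DifferentiableAt.comp ξ (g := iteratedFDeriv ℝ n h) (f := fun ξ => u - ξ) (hdiff _)
      ((differentiableAt_id).const_sub u)).const_smul (‖u‖ ^ k))
    (fun ξ hξ => ?_) (by simpa using hy) (by simpa using hx)
  · rw [e, ← norm_norm u, ← norm_pow, ← norm_smul, smul_sub]
    exact key
  · have hd : HasFDerivAt (fun ξ => ‖u‖ ^ k • iteratedFDeriv ℝ n h (u - ξ))
        (‖u‖ ^ k • (fderiv ℝ (iteratedFDeriv ℝ n h) (u - ξ)).comp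
          (-(ContinuousLinearMap.id ℝ (Space d)))) ξ :=
      (HasFDerivAt.comp ξ (g := iteratedFDeriv ℝ n h) (f := fun ξ => u - ξ)
        (hdiff _).hasFDerivAt ((hasFDerivAt_id ξ).const_sub u)).const_smul (‖u‖ ^ k)
    rw [hd.fderiv, norm_smul, ContinuousLinearMap.comp_neg, norm_neg,
      ContinuousLinearMap.comp_id, norm_fderiv_iteratedFDeriv, norm_pow, norm_norm]
    refine (pow_mul_norm_iteratedFDeriv_sub_le h k (n + 1) ξ u).trans ?_
    have : ‖ξ‖ ≤ R := by simpa using hξ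
    simp only [C]
    gcongr

/-- Translation acts continuously on test functions. -/
theorem continuous_reflTranslate (g : TestFun d) :
    Continuous fun x : Space d => reflTranslate x g := by
  rw [continuous_iff_continuousAt]
  intro y
  rw [ContinuousAt, (schwartz_withSeminorms ℝ (Space d) ℝ).tendsto_nhds]
  rintro ⟨k, n⟩ ε hε
  set C := 2 ^ k * (SchwartzMap.seminorm ℝ k (n + 1) (refl d g) +
    (‖y‖ + 1) ^ k * SchwartzMap.seminorm ℝ 0 (n + 1) (refl d g))
  have hlim : Tendsto (fun x : Space d => C * ‖x - y‖) (𝓝 y) (𝓝 0) := by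
    have : Continuous fun x : Space d => C * ‖x - y‖ := by fun_prop
    simpa using this.tendsto y
  filter_upwards [hlim.eventually_lt_const hε, Metric.ball_mem_nhds y one_pos] with x hx hxy
  refine lt_of_le_of_lt (seminorm_reflTranslate_sub_le g k n (R := ‖y‖ + 1) ?_ (by simp)) hx
  have h1 : ‖x - y‖ < 1 := by simpa [dist_eq_norm] using hxy
  have h2 : ‖x‖ ≤ ‖y‖ + ‖x - y‖ := by simpa using norm_add_le y (x - y)
  linarith

theorem continuous_convFun (g : TestFun d) (ω : Distr d) : Continuous (convFun g ω) :=
  (map_continuous ω).comp (continuous_reflTranslate g)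

theorem integral_linearIsometryEquiv_comp {X E F : Type*} [MeasurableSpace X] {μ : Measure X}
    [NormedAddCommGroup E] [NormedSpace ℝ E] [NormedAddCommGroup F] [NormedSpace ℝ F]
    (L : E ≃ₗᵢ[ℝ] F) (φ : X → E) : ∫ x, L (φ x) ∂μ = L (∫ x, φ x ∂μ) :=
  L.toContinuousLinearEquiv.integral_comp_comm φ

/-- Derivatives of a convolution fall on one factor. The target space varies in the induction. -/
theorem iteratedFDeriv_conv (g : TestFun d) (n : ℕ) :
    ∀ (F : Type) [NormedAddCommGroup F] [NormedSpace ℝ F] [CompleteSpace F] (f : 𝓢(Space d, F))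
      (x : Space d), iteratedFDeriv ℝ n (fun x => ∫ y, g y • f (x - y)) x =
        ∫ y, g y • iteratedFDeriv ℝ n f (x - y) := by
  induction n with
  | zero =>
    intro F _ _ _ f x
    rw [iteratedFDeriv_zero_eq_comp, Function.comp_apply, iteratedFDeriv_zero_eq_comp]
    simp only [Function.comp_apply]
    refine (integral_linearIsometryEquiv_comp (continuousMultilinearCurryFin0 ℝ (Space d) F).symm
      (fun y => g y • f (x - y))).symm.trans ?_
    simp
  | succ n ih =>
    intro F _ _ _ f x
    simp only [iteratedFDeriv_succ_eq_comp_right, Function.comp_apply]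
    rw [fderiv_conv, ih _ (fderivCLM ℝ (Space d) F f) x]
    refine (integral_linearIsometryEquiv_comp
      (continuousMultilinearCurryRightEquiv' ℝ n (Space d) F).symm
      (fun y => g y • iteratedFDeriv ℝ n (fderivCLM ℝ (Space d) F f) (x - y))).symm.trans ?_
    simp only [map_smul]
    rfl

theorem iteratedFDeriv_conv_refl (g f : TestFun d) (n : ℕ) (y : Space d) :
    iteratedFDeriv ℝ n (conv (refl d g) f) y =
      ∫ x, f x • iteratedFDeriv ℝ n (reflTranslate x g) y := by
  have h : (conv (refl d g) f : Space d → ℝ) = fun y => ∫ x, f x • refl d g (y - x) := by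
    ext y
    rw [conv_apply, ← integral_sub_left_eq_self _ _ y]
    simp only [sub_sub_cancel, smul_eq_mul, mul_comm]
  rw [h, iteratedFDeriv_conv f n ℝ (refl d g) y]
  simp only [iteratedFDeriv_reflTranslate]

/-- The normed space of values of `n`-th derivatives of test functions. It is a type synonym, so that
the metric found by instance search is the one of the norm. -/
def DerivSpace (d n : ℕ) : Type := Space d [×n]→L[ℝ] ℝ

instance (d n : ℕ) : NormedAddCommGroup (DerivSpace d n) :=
  inferInstanceAs (NormedAddCommGroup (Space d [×n]→L[ℝ] ℝ))

instance (d n : ℕ) : NormedSpace ℝ (DerivSpace d n) :=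
  inferInstanceAs (NormedSpace ℝ (Space d [×n]→L[ℝ] ℝ))

instance (d n : ℕ) : CompleteSpace (DerivSpace d n) :=
  inferInstanceAs (CompleteSpace (Space d [×n]→L[ℝ] ℝ))

/-- The `n`-th derivative of a test function. -/
def iterDeriv (n : ℕ) (h : TestFun d) (y : Space d) : DerivSpace d n := iteratedFDeriv ℝ n h y

theorem continuous_iterDeriv (n : ℕ) (h : TestFun d) : Continuous (iterDeriv n h) :=
  (h.smooth n).continuous_iteratedFDeriv (m := n) le_rfl

theorem iterDeriv_add (n : ℕ) (f h : TestFun d) (y : Space d) :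
    iterDeriv n (f + h) y = iterDeriv n f y + iterDeriv n h y :=
  iteratedFDeriv_add_apply (i := n) (𝕜 := ℝ) (x := y)
        (f.smooth n).contDiffAt (h.smooth n).contDiffAt

theorem iterDeriv_smul (n : ℕ) (a : ℝ) (f : TestFun d) (y : Space d) :
    iterDeriv n (a • f) y = a • iterDeriv n f y :=
  iteratedFDeriv_const_smul_apply (i := n) (𝕜 := ℝ) (x := y) (a := a) (f.smooth n).contDiffAt

theorem iterDeriv_conv_refl (g f : TestFun d) (n : ℕ) (y : Space d) :
    iterDeriv n (conv (refl d g) f) y = ∫ x, f x • iterDeriv n (reflTranslate x g) y :=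
  iteratedFDeriv_conv_refl g f n y

/-- The weighted derivative `y ↦ ‖y‖^k D^n h(y)` of a test function `h`, as a bounded continuous
function; its supremum norm is a Schwartz seminorm of `h`. -/
def weightedDeriv (k n : ℕ) :
    TestFun d →L[ℝ] (Space d →ᵇ DerivSpace d n) :=
  mkCLMtoNormedSpace
    (fun h => BoundedContinuousFunction.ofNormedAddCommGroup
      (fun y => ‖y‖ ^ k • iterDeriv n h y)
      (by
        have := continuous_iterDeriv n h
        fun_prop)
      (SchwartzMap.seminorm ℝ k n h)
      (fun y => by
        rw [norm_smul, norm_pow, norm_norm]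
        exact h.le_seminorm ℝ k n y))
    (fun f h => by
      ext1 y
      simp [smul_add, iterDeriv_add])
    (fun a f => by
      ext1 y
      simp [smul_comm a, iterDeriv_smul])
    ⟨{(k, n)}, 1, zero_le_one, fun f => by
      rw [Finset.sup_singleton, one_mul]
      exact BoundedContinuousFunction.norm_ofNormedAddCommGroup_le _ (apply_nonneg _ _) _⟩

theorem weightedDeriv_apply (k n : ℕ) (h : TestFun d) (y : Space d) :
    weightedDeriv k n h y = ‖y‖ ^ k • iterDeriv n h y := rfl

theorem seminorm_le_norm_weightedDeriv (k n : ℕ) (h : TestFun d) :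
    SchwartzMap.seminorm ℝ k n h ≤ ‖weightedDeriv k n h‖ := by
  refine seminorm_le_bound ℝ k n _ (norm_nonneg _) fun y => ?_
  have := (weightedDeriv k n h).norm_coe_le_norm y
  rwa [weightedDeriv_apply, norm_smul, norm_pow, norm_norm] at this

theorem norm_weightedDeriv_le (k n : ℕ) (h : TestFun d) :
    ‖weightedDeriv k n h‖ ≤ SchwartzMap.seminorm ℝ k n h :=
  BoundedContinuousFunction.norm_ofNormedAddCommGroup_le _ (apply_nonneg _ _) fun y => by
    rw [norm_smul, norm_pow, norm_norm]
    exact h.le_seminorm ℝ k n y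

theorem integrable_smul_weightedDeriv_reflTranslate (g f : TestFun d) (k n : ℕ) :
    Integrable fun x : Space d => f x • weightedDeriv k n (reflTranslate x g) := by
  set A := SchwartzMap.seminorm ℝ k n (refl d g)
  set B := SchwartzMap.seminorm ℝ 0 n (refl d g)
  have hint : Integrable fun x : Space d => 2 ^ k * A * ‖f x‖ + 2 ^ k * B * (‖x‖ ^ k * ‖f x‖) :=
    ((f.integrable (μ := volume)).norm.const_mul _).add ((f.integrable_pow_mul volume k).const_mul _)
  refine hint.mono' ?_ (Eventually.of_forall fun x => ?_)
  · exact (f.continuous.smul ((weightedDeriv k n).continuous.comp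
      (continuous_reflTranslate g))).aestronglyMeasurable
  · rw [norm_smul]
    calc ‖f x‖ * ‖weightedDeriv k n (reflTranslate x g)‖
        ≤ ‖f x‖ * (2 ^ k * (A + ‖x‖ ^ k * B)) := by
          gcongr
          exact (norm_weightedDeriv_le _ _ _).trans (seminorm_reflTranslate_le g k n x)
      _ = _ := by ring

/-- The convolution `g(-·) * f` as a Bochner integral of translates of `g`, in the norm of weighted
derivatives. -/
theorem weightedDeriv_conv_refl (g f : TestFun d) (k n : ℕ) :
    weightedDeriv k n (conv (refl d g) f) =
      ∫ x, f x • weightedDeriv k n (reflTranslate x g) := by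
  ext1 y
  have h := (BoundedContinuousFunction.evalCLM ℝ y).integral_comp_comm
    (integrable_smul_weightedDeriv_reflTranslate g f k n)
  simp only [BoundedContinuousFunction.evalCLM_apply, BoundedContinuousFunction.coe_smul,
    weightedDeriv_apply] at h
  rw [weightedDeriv_apply, iterDeriv_conv_refl, ← h]
  simp only [smul_comm _ (‖y‖ ^ k)]
  rw [integral_smul]

/-- A tempered distribution is a continuous functional of finitely many weighted derivatives, by
the Hahn–Banach theorem. -/
theorem exists_eq_weightedDeriv (ω : Distr d) :
    ∃ (s : Finset (ℕ × ℕ))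
      (L : (Π m : s, (Space d →ᵇ DerivSpace d m.1.2)) →L[ℝ] ℝ),
      ∀ h : TestFun d, ω h = L fun m => weightedDeriv m.1.1 m.1.2 h := by
  obtain ⟨s, C, -, hC⟩ := Seminorm.bound_of_continuous (schwartz_withSeminorms ℝ (Space d) ℝ)
    ((normSeminorm ℝ ℝ).comp (ω : TestFun d →ₗ[ℝ] ℝ)) (continuous_norm.comp (map_continuous ω))
  let ι : TestFun d →ₗ[ℝ] (Π m : s, (Space d →ᵇ DerivSpace d m.1.2)) :=
    LinearMap.pi fun m => (weightedDeriv (d := d) m.1.1 m.1.2).toLinearMap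
  have hι : ∀ h, ‖ω h‖ ≤ C * ‖ι h‖ := fun h => by
    refine (hC h).trans ?_
    simp only [smul_apply, NNReal.smul_def, smul_eq_mul]
    gcongr
    refine Seminorm.finset_sup_apply_le (norm_nonneg _) fun m hm => ?_
    exact (seminorm_le_norm_weightedDeriv m.1 m.2 h).trans (norm_le_pi_norm (ι h) ⟨m, hm⟩)
  let ℓ : LinearMap.range ι →ₗ[ℝ] ℝ :=
    ((LinearMap.ker ι).liftQ (ω : TestFun d →ₗ[ℝ] ℝ) (fun h hh => by
      have := hι h
      rw [LinearMap.mem_ker.1 hh, norm_zero, mul_zero] at this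
      exact norm_le_zero_iff.1 this)).comp ι.quotKerEquivRange.symm.toLinearMap
  have hℓ : ∀ h, ℓ ⟨ι h, LinearMap.mem_range_self ι h⟩ = ω h := fun h => by
    simp only [ℓ, LinearMap.comp_apply, LinearEquiv.coe_coe,
      LinearMap.quotKerEquivRange_symm_apply_image]
    exact Submodule.liftQ_apply _ _ _
  obtain ⟨L, hL, -⟩ := exists_extension_norm_eq (LinearMap.range ι)
    (ℓ.mkContinuous C (by
      rintro ⟨_, h, rfl⟩
      rw [hℓ]
      exact hι h))
  refine ⟨s, L, fun h => ?_⟩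
  rw [← hℓ h]
  exact (hL ⟨ι h, LinearMap.mem_range_self ι h⟩).symm

/-- Smearing the smooth path `g * ω` with a test function agrees with the distribution `g * ω`. -/
theorem convDistr_apply_eq_integral (g f : TestFun d) (ω : Distr d) :
    convDistr g ω f = ∫ x, f x * convFun g ω x := by
  obtain ⟨s, L, hL⟩ := exists_eq_weightedDeriv ω
  have hint : Integrable fun (x : Space d) (m : s) =>
      f x • weightedDeriv m.1.1 m.1.2 (reflTranslate x g) := Integrable.of_eval fun m : s =>
    integrable_smul_weightedDeriv_reflTranslate g f m.1.1 m.1.2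
  have h := L.integral_comp_comm hint
  rw [convDistr_apply, hL]
  have e : (fun m : s => weightedDeriv m.1.1 m.1.2 (conv (refl d g) f)) =
      ∫ x, fun m : s => f x • weightedDeriv m.1.1 m.1.2 (reflTranslate x g) := by
    ext1 m
    rw [weightedDeriv_conv_refl, eval_integral fun m => integrable_smul_weightedDeriv_reflTranslate
      g f m.1.1 m.1.2]
  rw [e, ← h]
  refine integral_congr_ae (Eventually.of_forall fun x => ?_)
  simp only [convFun, hL]
  rw [← smul_eq_mul, ← map_smul]
  rfl

/-! ### Cylinder functionals and tightness of smeared noise -/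

theorem continuous_eval_distr (f : TestFun d) : Continuous fun ω : Distr d => ω f :=
  continuous_eval_const f

/-- A cylinder functional: a continuous function of the values of a distribution at finitely many
test functions. -/
def IsCylinder (F : Distr d → ℝ) : Prop :=
  ∃ (ι : Type) (_ : Fintype ι) (f : ι → TestFun d) (H : (ι → ℝ) → ℝ),
    Continuous H ∧ ∀ ω, F ω = H fun i => ω (f i)

theorem IsCylinder.continuous {F : Distr d → ℝ} (hF : IsCylinder F) : Continuous F := by
  obtain ⟨ι, _, f, H, hH, h⟩ := hF
  rw [funext h]
  exact hH.comp (continuous_pi fun i => continuous_eval_distr (f i))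

theorem isCylinder_eval (f : TestFun d) : IsCylinder fun ω => ω f :=
  ⟨Unit, inferInstance, fun _ => f, fun a => a (), by fun_prop, fun _ => rfl⟩

theorem isCylinder_const (a : ℝ) : IsCylinder fun _ : Distr d => a :=
  ⟨Empty, inferInstance, fun i => i.elim, fun _ => a, by fun_prop, fun _ => rfl⟩

theorem IsCylinder.comp {F : Distr d → ℝ} (hF : IsCylinder F) {H : ℝ → ℝ} (hH : Continuous H) :
    IsCylinder fun ω => H (F ω) := by
  obtain ⟨ι, _, f, K, hK, h⟩ := hF
  exact ⟨ι, inferInstance, f, H ∘ K, hH.comp hK, fun ω => by simp [h]⟩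

theorem IsCylinder.comp₂ {F G : Distr d → ℝ} (hF : IsCylinder F) (hG : IsCylinder G)
    {H : ℝ → ℝ → ℝ} (hH : Continuous fun p : ℝ × ℝ => H p.1 p.2) :
    IsCylinder fun ω => H (F ω) (G ω) := by
  obtain ⟨ι, _, f, K, hK, h⟩ := hF
  obtain ⟨κ, _, f', K', hK', h'⟩ := hG
  refine ⟨ι ⊕ κ, inferInstance, Sum.elim f f', fun a => H (K fun i => a (.inl i))
    (K' fun i => a (.inr i)), ?_, fun ω => by simp [h, h']⟩
  exact hH.comp ((hK.comp (by fun_prop)).prodMk (hK'.comp (by fun_prop)))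

theorem IsCylinder.convDistr {F : Distr d → ℝ} (hF : IsCylinder F) (g : TestFun d) :
    IsCylinder fun ω => F (convDistr g ω) := by
  obtain ⟨ι, _, f, H, hH, h⟩ := hF
  exact ⟨ι, inferInstance, fun i => conv (refl d g) (f i), H, hH, fun ω => by
    simp [h, convDistr_apply]⟩

/-- The cylinder functionals form a subalgebra of the continuous functions on `𝓢'`. -/
def cylinderSubalgebra (d : ℕ) : Subalgebra ℝ C(Distr d, ℝ) where
  carrier := {F | IsCylinder F}
  mul_mem' hF hG := IsCylinder.comp₂ hF hG (H := fun a b => a * b) (by fun_prop)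
  add_mem' hF hG := IsCylinder.comp₂ hF hG (H := fun a b => a + b) (by fun_prop)
  algebraMap_mem' a := isCylinder_const a

theorem separatesPoints_cylinderSubalgebra : (cylinderSubalgebra d).SeparatesPoints := by
  intro ω ω' hne
  obtain ⟨f, hf⟩ := DFunLike.ne_iff.1 hne
  exact ⟨_, ⟨⟨fun ω => ω f, continuous_eval_distr f⟩, isCylinder_eval f, rfl⟩, hf⟩

/-- Banach–Alaoglu for tempered distributions: functionals dominated by a fixed continuous function
vanishing at the origin form a compact set for the weak topology. -/
theorem isCompact_setOf_abs_le {p : TestFun d → ℝ} (hp : Continuous p) (hp0 : p 0 = 0) :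
    IsCompact {ζ : Distr d | ∀ f, |ζ f| ≤ p f} := by
  rw [(PointwiseConvergenceCLM.isEmbedding_coeFn (RingHom.id ℝ) (TestFun d) ℝ).isCompact_iff]
  have hK : IsCompact (univ.pi fun f : TestFun d => Icc (-p f) (p f)) :=
    isCompact_univ_pi fun f => isCompact_Icc
  have hC : IsClosed {φ : TestFun d → ℝ | (∀ f h, φ (f + h) = φ f + φ h) ∧
      ∀ (a : ℝ) f, φ (a • f) = a * φ f} := by
    simp only [ofPred_and, ofPred_forall]
    refine (isClosed_iInter fun f => isClosed_iInter fun h => isClosed_eq ?_ ?_).inter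
      (isClosed_iInter fun a => isClosed_iInter fun f => isClosed_eq ?_ ?_) <;> fun_prop
  convert! hK.inter_right hC
  ext φ
  simp only [mem_image, mem_ofPred_eq, mem_inter_iff, mem_univ_pi, mem_Icc, ← abs_le]
  constructor
  · rintro ⟨ζ, hζ, rfl⟩
    exact ⟨hζ, fun f h => map_add ζ f h, fun a f => map_smul ζ a f⟩
  · rintro ⟨hb, ha, hs⟩
    let L : TestFun d →ₗ[ℝ] ℝ := { toFun := φ, map_add' := ha, map_smul' := hs }
    have hL : Continuous L := by
      refine continuous_of_continuousAt_zero L ?_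
      rw [ContinuousAt, map_zero]
      refine squeeze_zero_norm (fun f => hb f) ?_
      rw [← hp0]
      exact hp.tendsto 0
    exact ⟨(⟨L, hL⟩ : TestFun d →L[ℝ] ℝ), hb, rfl⟩

/-- The integrable weight `(1 + ‖x‖)^{-(d+1)}`. -/
def decayWeight (x : Space d) : ℝ := ((1 + ‖x‖) ^ (d + 1))⁻¹

theorem decayWeight_pos (x : Space d) : 0 < decayWeight x := by
  unfold decayWeight; positivity

theorem continuous_decayWeight : Continuous (decayWeight (d := d)) := by
  unfold decayWeight
  exact (by fun_prop : Continuous fun x : Space d => (1 + ‖x‖) ^ (d + 1)).inv₀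
    fun x => by positivity

theorem integrable_decayWeight : Integrable (decayWeight (d := d)) := by
  have h := integrable_one_add_norm (E := Space d) (μ := volume) (r := (d + 1 : ℕ)) (by simp)
  refine h.congr (Eventually.of_forall fun x => ?_)
  simp only [decayWeight]
  rw [Real.rpow_neg (by positivity), Real.rpow_natCast]

/-- A Schwartz seminorm dominating the supremum of `|f(x)| (1 + ‖x‖)^{d+1}`. -/
def weightSeminorm (d : ℕ) (f : TestFun d) : ℝ :=
  2 ^ (d + 1) * ∑ m ∈ Finset.Iic (d + 1, 0), schwartzSeminormFamily ℝ (Space d) ℝ m f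

theorem weightSeminorm_nonneg (f : TestFun d) : 0 ≤ weightSeminorm d f := by
  unfold weightSeminorm
  exact mul_nonneg (by positivity) (Finset.sum_nonneg fun m _ => apply_nonneg _ _)

theorem continuous_weightSeminorm : Continuous (weightSeminorm d) :=
  continuous_const.mul (continuous_finsetSum _
    fun m _ => (schwartz_withSeminorms ℝ (Space d) ℝ).continuous_seminorm m)

theorem abs_le_weightSeminorm_mul (f : TestFun d) (x : Space d) :
    |f x| ≤ weightSeminorm d f * decayWeight x := by
  have h := one_add_le_sup_seminorm_apply (𝕜 := ℝ) (m := (d + 1, 0)) le_rfl le_rfl f x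
  rw [norm_iteratedFDeriv_zero] at h
  rw [decayWeight, ← div_eq_mul_inv, le_div_iff₀ (by positivity), mul_comm]
  refine h.trans (mul_le_mul_of_nonneg_left ?_ (by positivity))
  have := Seminorm.finset_sup_le_sum (schwartzSeminormFamily ℝ (Space d) ℝ)
    (Finset.Iic (d + 1, 0)) f
  exact le_of_le_of_eq this (by simp)

/-- A weighted `L¹` bound on the path `g * ω` controls the distribution `g * ω` by a fixed Schwartz
seminorm. -/
theorem abs_convDistr_le (g f : TestFun d) (ω : Distr d) {M : ℝ} (hM : 0 ≤ M)
    (h : ∫⁻ x, ‖convFun g ω x‖ₑ * ENNReal.ofReal (decayWeight x) ≤ ENNReal.ofReal M) :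
    |convDistr g ω f| ≤ M * weightSeminorm d f := by
  rw [convDistr_apply_eq_integral, ← Real.norm_eq_abs,
    ← ENNReal.ofReal_le_ofReal_iff (mul_nonneg hM (weightSeminorm_nonneg f)), ofReal_norm]
  calc ‖∫ x, f x * convFun g ω x‖ₑ ≤ ∫⁻ x, ‖f x * convFun g ω x‖ₑ :=
        enorm_integral_le_lintegral_enorm _
    _ ≤ ∫⁻ x, ENNReal.ofReal (weightSeminorm d f) *
          (‖convFun g ω x‖ₑ * ENNReal.ofReal (decayWeight x)) := by
        refine lintegral_mono fun x => ?_
        rw [enorm_mul, mul_comm ‖convFun g ω x‖ₑ, ← mul_assoc,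
          ← ENNReal.ofReal_mul (weightSeminorm_nonneg f)]
        gcongr
        rw [← ofReal_norm]
        exact ENNReal.ofReal_le_ofReal (abs_le_weightSeminorm_mul f x)
    _ = ENNReal.ofReal (weightSeminorm d f) * ∫⁻ x,
          (‖convFun g ω x‖ₑ * ENNReal.ofReal (decayWeight x)) :=
        lintegral_const_mul' _ _ ENNReal.ofReal_ne_top
    _ ≤ ENNReal.ofReal (weightSeminorm d f) * ENNReal.ofReal M := by gcongr
    _ = _ := by rw [mul_comm, ENNReal.ofReal_mul hM]

/-- Joint measurability: paths are continuous, and point evaluations are measurable. -/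
theorem measurable_uncurry_convFun (g : TestFun d) :
    Measurable fun p : Distr d × Space d => convFun g p.1 p.2 := by
  have h := measurable_uncurry_of_continuous_of_measurable (ι := Space d) (α := Distr d)
    (u := fun x ω => convFun g ω x) (fun ω => continuous_convFun g ω)
    (fun x => (continuous_eval_distr _).measurable)
  exact h.comp measurable_swap

/-- If the path values `(g * ω)(x)` have first absolute moments bounded uniformly in `x`, then the
laws of the distributions `g * ω` are uniformly tight. -/
theorem exists_isCompact_convDistr (g : TestFun d) {C : ℝ} (hC : 0 ≤ C) {η : ℝ} (hη : 0 < η) :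
    ∃ K : Set (Distr d), IsCompact K ∧ ∀ P : Measure (Distr d), IsProbabilityMeasure P →
      (∀ x, ∫⁻ ω, ‖convFun g ω x‖ₑ ∂P ≤ ENNReal.ofReal C) →
      P {ω | convDistr g ω ∉ K} ≤ ENNReal.ofReal η := by
  set I := ∫ x : Space d, decayWeight x
  have hI : 0 ≤ I := integral_nonneg fun x => (decayWeight_pos x).le
  set M := (C * I + 1) / η
  have hM : 0 < M := by positivity
  refine ⟨{ζ | ∀ f, |ζ f| ≤ M * weightSeminorm d f}, isCompact_setOf_abs_le
    (continuous_const.mul continuous_weightSeminorm) (by simp [weightSeminorm]), fun P _ hP => ?_⟩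
  set L : Distr d → ENNReal := fun ω =>
    ∫⁻ x, ‖convFun g ω x‖ₑ * ENNReal.ofReal (decayWeight x)
  have hmeas : Measurable fun p : Distr d × Space d =>
      ‖convFun g p.1 p.2‖ₑ * ENNReal.ofReal (decayWeight p.2) :=
    (measurable_uncurry_convFun g).enorm.mul
      (continuous_decayWeight.measurable.comp measurable_snd).ennreal_ofReal
  have hL : ∫⁻ ω, L ω ∂P ≤ ENNReal.ofReal (C * I) := by
    rw [lintegral_lintegral_swap hmeas.aemeasurable]
    calc ∫⁻ x, ∫⁻ ω, ‖convFun g ω x‖ₑ * ENNReal.ofReal (decayWeight x) ∂P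
        = ∫⁻ x, (∫⁻ ω, ‖convFun g ω x‖ₑ ∂P) * ENNReal.ofReal (decayWeight x) :=
          lintegral_congr fun x => lintegral_mul_const' _ _ ENNReal.ofReal_ne_top
      _ ≤ ∫⁻ x, ENNReal.ofReal C * ENNReal.ofReal (decayWeight x) := by
          refine lintegral_mono fun x => ?_
          gcongr
          exact hP x
      _ = ENNReal.ofReal (C * I) := by
          rw [lintegral_const_mul' _ _ ENNReal.ofReal_ne_top, ENNReal.ofReal_mul hC,
            ofReal_integral_eq_lintegral_ofReal integrable_decayWeight
              (Eventually.of_forall fun x => (decayWeight_pos x).le)]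
  have hsub : {ω | convDistr g ω ∉ {ζ : Distr d | ∀ f, |ζ f| ≤ M * weightSeminorm d f}} ⊆
      {ω | ENNReal.ofReal M ≤ L ω} := by
    intro ω hω
    by_contra hlt
    exact hω fun f => abs_convDistr_le g f ω hM.le (not_le.1 hlt).le
  refine (measure_mono hsub).trans ?_
  have hLm : Measurable L := hmeas.lintegral_prod_right' (ν := volume)
  have hmk := mul_meas_ge_le_lintegral (μ := P) hLm (ENNReal.ofReal M)
  have hle : ENNReal.ofReal M * P {ω | ENNReal.ofReal M ≤ L ω} ≤
      ENNReal.ofReal M * ENNReal.ofReal η := by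
    refine (hmk.trans hL).trans ?_
    rw [← ENNReal.ofReal_mul hM.le]
    refine ENNReal.ofReal_le_ofReal ?_
    rw [div_mul_cancel₀ _ hη.ne']
    linarith
  exact (ENNReal.mul_le_mul_iff_right (by simpa using hM) ENNReal.ofReal_ne_top).1 hle

/-- Truncation of a real number to `[-a, a]`. -/
def clamp (a t : ℝ) : ℝ := max (-a) (min a t)

theorem continuous_clamp (a : ℝ) : Continuous (clamp a) := by
  unfold clamp; fun_prop

theorem abs_clamp_le {a : ℝ} (ha : 0 ≤ a) (t : ℝ) : |clamp a t| ≤ a := by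
  rw [abs_le]
  exact ⟨le_max_left _ _, max_le (by linarith) (min_le_left _ _)⟩

theorem abs_clamp_sub_le {a : ℝ} (t s : ℝ) : |clamp a t - clamp a s| ≤ |t - s| := by
  unfold clamp
  refine (abs_max_sub_max_le_max _ _ _ _).trans ?_
  rw [sub_self, abs_zero, max_eq_right (abs_nonneg _)]
  refine (abs_min_sub_min_le_max _ _ _ _).trans ?_
  rw [sub_self, abs_zero, max_eq_right (abs_nonneg _)]

theorem clamp_eq {a t : ℝ} (ht : |t| ≤ a) : clamp a t = t := by
  rw [abs_le] at ht
  rw [clamp, min_eq_right ht.2, max_eq_right ht.1]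

/-- A bounded continuous functional of `g * ω` is approximated in mean by a cylinder functional,
uniformly over the laws of `ω` with bounded first moments of `(g * ω)(x)`: by tightness and the
Stone–Weierstrass theorem on a compact set. -/
theorem exists_isCylinder_approx (g : TestFun d) {C : ℝ} (hC : 0 ≤ C) (φ : Distr d →ᵇ ℝ)
    {η : ℝ} (hη : 0 < η) :
    ∃ F : Distr d → ℝ, IsCylinder F ∧ (∀ ω, |F ω| ≤ ‖φ‖) ∧
      ∀ P : Measure (Distr d), IsProbabilityMeasure P →
      (∀ x, ∫⁻ ω, ‖convFun g ω x‖ₑ ∂P ≤ ENNReal.ofReal C) →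
      ∫ ω, |φ (convDistr g ω) - F ω| ∂P ≤ η := by
  have hθ : 0 < η / (4 * (‖φ‖ + 1)) := by positivity
  obtain ⟨K, hK, hP⟩ := exists_isCompact_convDistr g hC hθ
  obtain ⟨p, hp, hpK⟩ :=
    ContinuousMap.exists_mem_subalgebra_near_continuous_of_isCompact_of_separatesPoints
      separatesPoints_cylinderSubalgebra φ.toContinuousMap hK (half_pos hη)
  -- truncation keeps the approximation bounded off the compact set `K`
  have hcyl : IsCylinder fun ω => clamp ‖φ‖ (p (convDistr g ω)) :=
    (IsCylinder.convDistr hp g).comp (continuous_clamp _)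
  have hcont : Continuous fun ω => φ (convDistr g ω) :=
    φ.continuous.comp (convDistr g).continuous
  refine ⟨_, hcyl, fun ω => abs_clamp_le (norm_nonneg _) _, fun P _ hPC => ?_⟩
  have hφ : ∀ ζ, |φ ζ| ≤ ‖φ‖ := fun ζ => φ.norm_coe_le_norm ζ
  have hKm : MeasurableSet {ω | convDistr g ω ∉ K} :=
    ((convDistr g).continuous.measurable hK.isClosed.measurableSet).compl
  have hbound : ∀ ω, |φ (convDistr g ω) - clamp ‖φ‖ (p (convDistr g ω))| ≤
      η / 2 + {ω | convDistr g ω ∉ K}.indicator (fun _ => 2 * ‖φ‖) ω := by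
    intro ω
    by_cases hω : convDistr g ω ∈ K
    · rw [indicator_of_notMem (by simpa using hω), add_zero, abs_sub_comm]
      have h := abs_clamp_sub_le (a := ‖φ‖) (p (convDistr g ω)) (φ (convDistr g ω))
      rw [clamp_eq (hφ (convDistr g ω))] at h
      exact h.trans (hpK _ hω).le
    · rw [indicator_of_mem (by simpa using hω)]
      have h1 := abs_sub (φ (convDistr g ω)) (clamp ‖φ‖ (p (convDistr g ω)))
      have h2 := hφ (convDistr g ω)
      have h3 := abs_clamp_le (norm_nonneg φ) (p (convDistr g ω))
      linarith
  have hi2 : Integrable ({ω | convDistr g ω ∉ K}.indicator fun _ => 2 * ‖φ‖) P :=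
    (integrable_const _).indicator hKm
  calc ∫ ω, |φ (convDistr g ω) - clamp ‖φ‖ (p (convDistr g ω))| ∂P
      ≤ ∫ ω, (η / 2 + {ω | convDistr g ω ∉ K}.indicator (fun _ => 2 * ‖φ‖) ω) ∂P := by
        refine integral_mono_of_nonneg (Eventually.of_forall fun ω => abs_nonneg _)
          ((integrable_const _).add hi2) (Eventually.of_forall hbound)
    _ = η / 2 + P.real {ω | convDistr g ω ∉ K} * (2 * ‖φ‖) := by
        rw [integral_add (integrable_const _) hi2, integral_indicator_const _ hKm]
        simp
    _ ≤ η / 2 + η / (4 * (‖φ‖ + 1)) * (2 * ‖φ‖) := by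
        gcongr
        exact ENNReal.toReal_le_of_le_ofReal hθ.le (hP P inferInstance hPC)
    _ ≤ η := by
        have : η / (4 * (‖φ‖ + 1)) * (2 * ‖φ‖) ≤ η / 2 := by
          rw [div_mul_eq_mul_div, div_le_div_iff₀ (by positivity) two_pos]
          nlinarith [norm_nonneg φ]
        linarith

/-! ### Lévy characteristics of scaled Poisson noise -/

theorem norm_exp_I_mul_sub_one_sub_le (x : ℝ) :
    ‖Complex.exp (Complex.I * x) - 1 - Complex.I * x‖ ≤ 2 * x ^ 2 := by
  rcases le_total |x| 1 with h | h
  · have hx : ‖Complex.I * (x : ℂ)‖ ≤ 1 := by simpa using h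
    have := Complex.norm_exp_sub_one_sub_id_le hx
    rw [norm_mul, Complex.norm_I, one_mul, Complex.norm_real, Real.norm_eq_abs, sq_abs] at this
    nlinarith [sq_nonneg x]
  · have h1 := Real.norm_exp_I_mul_ofReal_sub_one_le (x := x)
    have h2 := norm_sub_le (Complex.exp (Complex.I * x) - 1) (Complex.I * x)
    rw [norm_mul, Complex.norm_I, one_mul, Complex.norm_real] at h2
    rw [Real.norm_eq_abs] at h1 h2
    nlinarith [sq_abs x]

theorem tendsto_mul_exp_I_div_sqrt (y : ℝ) :
    Tendsto (fun z : ℝ => (z : ℂ) * (Complex.exp (Complex.I * (y / √z : ℝ)) - 1 -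
      Complex.I * (y / √z : ℝ))) atTop (𝓝 ((-(y ^ 2 / 2) : ℝ) : ℂ)) := by
  have hs : Tendsto (fun z : ℝ => √z) atTop atTop := Real.tendsto_sqrt_atTop
  have hlim : Tendsto (fun z : ℝ => |y| ^ 3 * (√z)⁻¹ * Real.exp |y|) atTop (𝓝 0) := by
    have := (hs.inv_tendsto_atTop.const_mul (|y| ^ 3)).mul_const (Real.exp |y|)
    simpa using this
  rw [tendsto_iff_norm_sub_tendsto_zero]
  refine squeeze_zero' (Eventually.of_forall fun _ => norm_nonneg _) ?_ hlim
  filter_upwards [eventually_ge_atTop 1] with z hz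
  have hz0 : 0 < z := by linarith
  have hsz : 1 ≤ √z := by simpa using Real.sqrt_le_sqrt hz
  have hsq : √z ^ 2 = z := Real.sq_sqrt hz0.le
  set w : ℂ := Complex.I * (y / √z : ℝ) with hw
  have hwn : ‖w‖ = |y| / √z := by
    rw [hw, norm_mul, Complex.norm_I, one_mul, Complex.norm_real, Real.norm_eq_abs, abs_div,
      abs_of_pos (by linarith : 0 < √z)]
  have h := Complex.norm_exp_sub_sum_le_norm_mul_exp w 3
  have hw2 : (z : ℂ) * w ^ 2 = ((-(y ^ 2) : ℝ) : ℂ) := by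
    have hzc : (z : ℂ) ≠ 0 := by exact_mod_cast hz0.ne'
    rw [hw, mul_pow, Complex.I_sq, ← Complex.ofReal_pow, div_pow, hsq]
    push_cast
    field_simp
  clear_value w
  have e : (z : ℂ) * (Complex.exp w - 1 - w) - ((-(y ^ 2 / 2) : ℝ) : ℂ) =
      z * (Complex.exp w - ∑ m ∈ Finset.range 3, w ^ m / (m.factorial : ℂ)) := by
    simp only [Finset.sum_range_succ, Finset.sum_range_zero, Nat.factorial]
    push_cast at hw2 ⊢
    linear_combination (1 / 2 : ℂ) * hw2
  rw [e, norm_mul, Complex.norm_real, Real.norm_eq_abs, abs_of_pos hz0]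
  calc z * ‖Complex.exp w - ∑ m ∈ Finset.range 3, w ^ m / (m.factorial : ℂ)‖
      ≤ z * (‖w‖ ^ 3 * Real.exp ‖w‖) := by gcongr
    _ = |y| ^ 3 * (√z)⁻¹ * Real.exp (|y| / √z) := by
        rw [hwn, div_pow]
        nth_rw 1 [← hsq]
        field_simp
    _ ≤ _ := by
        gcongr
        exact div_le_self (abs_nonneg y) hsz

section Charges

variable {c : ℝ} {r : Measure ℝ}

theorem ae_abs_le_of_compl_Icc (hr : r (Icc (-c) c)ᶜ = 0) : ∀ᵐ s ∂r, |s| ≤ c := by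
  filter_upwards [mem_ae_iff.2 hr] with s hs using abs_le.2 hs

theorem poissonChar_scaledCharges (z t : ℝ) :
    poissonChar z (scaledCharges r z) t =
      z * ∫ s, (Complex.exp (Complex.I * (s * (t / √z) : ℝ)) - 1) ∂r := by
  rw [poissonChar, scaledCharges, integral_map (by fun_prop) (by fun_prop)]
  congr 2
  ext s
  congr 4
  ring

variable [IsProbabilityMeasure r]

theorem integrable_pow_charge (hr : r (Icc (-c) c)ᶜ = 0) (n : ℕ) :
    Integrable (fun s => s ^ n) r := by
  refine Integrable.of_bound (by fun_prop) (c ^ n) ?_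
  filter_upwards [ae_abs_le_of_compl_Icc hr] with s hs
  rw [norm_pow, Real.norm_eq_abs]
  gcongr

theorem integrable_exp_charge (r : Measure ℝ) [IsProbabilityMeasure r] (a : ℝ) :
    Integrable (fun s : ℝ => Complex.exp (Complex.I * (s * a : ℝ)) - 1) r := by
  refine Integrable.of_bound (by fun_prop) 2 (Eventually.of_forall fun s => ?_)
  refine (norm_sub_le _ _).trans ?_
  rw [mul_comm Complex.I, Complex.norm_exp_ofReal_mul_I]
  norm_num

/-- For centred charges the linear term of the exponential can be subtracted, which leaves an
integrand that is quadratic in `t`, uniformly in `z`. -/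
theorem poissonChar_scaledCharges_eq (hr : r (Icc (-c) c)ᶜ = 0) (hr_mean : ∫ s, s ∂r = 0)
    (z t : ℝ) :
    poissonChar z (scaledCharges r z) t = ∫ s, (z : ℂ) *
      (Complex.exp (Complex.I * (s * t / √z : ℝ)) - 1 - Complex.I * (s * t / √z : ℝ)) ∂r := by
  rw [poissonChar_scaledCharges, integral_const_mul]
  congr 1
  have h1 : Integrable (fun s : ℝ => Complex.I * (s * t / √z : ℝ)) r := by
    have := ((integrable_pow_charge hr 1).mul_const (t / √z)).ofReal (𝕜 := ℂ)
    refine (this.const_mul Complex.I).congr (Eventually.of_forall fun s => ?_)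
    simp [mul_div_assoc]
  have h2 : ∫ s, Complex.I * ((s * t / √z : ℝ) : ℂ) ∂r = 0 := by
    rw [integral_const_mul, integral_complex_ofReal]
    simp only [mul_div_assoc]
    rw [integral_mul_const, hr_mean]
    simp
  have h3 := integral_sub (integrable_exp_charge r (t / √z)) h1
  rw [h2, sub_zero] at h3
  rw [← h3]
  simp only [mul_div_assoc]

theorem norm_poissonChar_le (hr : r (Icc (-c) c)ᶜ = 0) (hr_mean : ∫ s, s ∂r = 0) {z : ℝ}
    (hz : 1 ≤ z) (t : ℝ) :
    ‖poissonChar z (scaledCharges r z) t‖ ≤ 2 * (∫ s, s ^ 2 ∂r) * t ^ 2 := by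
  have hz0 : 0 < z := by linarith
  rw [poissonChar_scaledCharges_eq hr hr_mean]
  have hint : Integrable (fun s : ℝ => 2 * s ^ 2 * t ^ 2) r :=
    ((integrable_pow_charge hr 2).const_mul 2).mul_const _
  refine (norm_integral_le_of_norm_le hint (Eventually.of_forall fun s => ?_)).trans_eq ?_
  · rw [norm_mul, Complex.norm_real, Real.norm_eq_abs, abs_of_pos hz0]
    calc z * _ ≤ z * (2 * (s * t / √z) ^ 2) := by
          gcongr; exact norm_exp_I_mul_sub_one_sub_le _
      _ = 2 * s ^ 2 * t ^ 2 := by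
          rw [div_pow, Real.sq_sqrt hz0.le]; field_simp
  · rw [integral_mul_const, integral_const_mul]

theorem norm_gaussianChar_le (r : Measure ℝ) (t : ℝ) :
    ‖gaussianChar (∫ s, s ^ 2 ∂r) t‖ ≤ 2 * (∫ s, s ^ 2 ∂r) * t ^ 2 := by
  have h : 0 ≤ ∫ s, s ^ 2 ∂r := integral_nonneg fun s => sq_nonneg s
  rw [gaussianChar, Complex.norm_real, norm_neg, Real.norm_eq_abs, abs_of_nonneg (by positivity)]
  nlinarith [mul_nonneg h (sq_nonneg t)]

theorem tendsto_poissonChar (hr : r (Icc (-c) c)ᶜ = 0) (hr_mean : ∫ s, s ∂r = 0) (t : ℝ) :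
    Tendsto (fun z => poissonChar z (scaledCharges r z) t) atTop
      (𝓝 (gaussianChar (∫ s, s ^ 2 ∂r) t)) := by
  have e : gaussianChar (∫ s, s ^ 2 ∂r) t = ∫ s, ((-((s * t) ^ 2 / 2) : ℝ) : ℂ) ∂r := by
    rw [integral_complex_ofReal, gaussianChar, integral_neg, integral_div]
    simp only [mul_pow]
    rw [integral_mul_const]
    congr 2
    ring
  rw [e]
  simp only [poissonChar_scaledCharges_eq hr hr_mean]
  refine tendsto_integral_filter_of_dominated_convergence (fun s => 2 * s ^ 2 * t ^ 2) ?_ ?_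
    (((integrable_pow_charge hr 2).const_mul 2).mul_const _) ?_
  · exact Eventually.of_forall fun z => by fun_prop
  · filter_upwards [eventually_ge_atTop 1] with z hz
    refine Eventually.of_forall fun s => ?_
    have hz0 : 0 < z := by linarith
    rw [norm_mul, Complex.norm_real, Real.norm_eq_abs, abs_of_pos hz0]
    calc z * _ ≤ z * (2 * (s * t / √z) ^ 2) := by
          gcongr; exact norm_exp_I_mul_sub_one_sub_le _
      _ = 2 * s ^ 2 * t ^ 2 := by
          rw [div_pow, Real.sq_sqrt hz0.le]; field_simp
  · exact Eventually.of_forall fun s => tendsto_mul_exp_I_div_sqrt (s * t)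

theorem continuous_poissonChar (z : ℝ) : Continuous (poissonChar z (scaledCharges r z)) := by
  simp only [funext fun t => poissonChar_scaledCharges (r := r) z t]
  refine continuous_const.mul (continuous_of_dominated (bound := fun _ => 2) ?_ ?_ ?_ ?_)
  · exact fun t => by fun_prop
  · refine fun t => Eventually.of_forall fun s => (norm_sub_le _ _).trans ?_
    rw [mul_comm Complex.I, Complex.norm_exp_ofReal_mul_I]
    norm_num
  · exact integrable_const _
  · exact Eventually.of_forall fun s => by fun_prop

end Charges

/-! ### Moments and convergence of noise -/

theorem integrable_sq_testFun (f : TestFun d) : Integrable fun x => f x ^ 2 :=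
  (f.memLp 2 volume).integrable_sq

/-- The one-dimensional marginals of a noise law, by applying the characteristic functional to
multiples of a test function. -/
theorem integral_noise_exp_smul {ψ : ℝ → ℂ} {P : Measure (Distr d)} (hP : IsNoiseLaw ψ P)
    (f : TestFun d) (t : ℝ) :
    ∫ ω, Complex.exp (Complex.I * (t * ω f : ℝ)) ∂P = Complex.exp (∫ x, ψ (t * f x)) := by
  have := hP.charFunctional (t • f)
  simpa using this

theorem norm_integral_char_le {ψ : ℝ → ℂ} {K : ℝ} (hψ : ∀ t, ‖ψ t‖ ≤ K * t ^ 2) (f : TestFun d) :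
    ‖∫ x, ψ (f x)‖ ≤ K * ∫ x, f x ^ 2 := by
  rw [← integral_const_mul]
  exact norm_integral_le_of_norm_le ((integrable_sq_testFun f).const_mul K)
    (Eventually.of_forall fun x => hψ _)

theorem integrable_exp_I_mul {Ω : Type*} [MeasurableSpace Ω] {P : Measure Ω} [IsFiniteMeasure P]
    {Y : Ω → ℝ} (hY : Measurable Y) :
    Integrable (fun ω => Complex.exp (Complex.I * (Y ω : ℝ))) P := by
  refine Integrable.of_bound (by fun_prop) 1 (Eventually.of_forall fun ω => ?_)
  rw [mul_comm Complex.I, Complex.norm_exp_ofReal_mul_I]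

/-- A quadratic bound on the characteristic function at the origin bounds the second moment. -/
theorem lintegral_sq_le_of_norm_one_sub_char_le {Ω : Type*} [MeasurableSpace Ω] {P : Measure Ω}
    [IsProbabilityMeasure P] {Y : Ω → ℝ} (hY : Measurable Y) {A : ℝ}
    (h : ∀ t : ℝ, ‖1 - ∫ ω, Complex.exp (Complex.I * (t * Y ω : ℝ)) ∂P‖ ≤ A * t ^ 2) :
    ∫⁻ ω, ENNReal.ofReal (Y ω ^ 2) ∂P ≤ ENNReal.ofReal (2 * A) := by
  -- Fatou's lemma for `2 (1 - cos (tY)) / t² → Y²` along a sequence `t → 0`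
  set t : ℕ → ℝ := fun n => 1 / ((n : ℝ) + 1)
  have ht : Tendsto t atTop (𝓝 0) := tendsto_one_div_add_atTop_nhds_zero_nat
  have htpos : ∀ n, 0 < t n := fun n => by simp only [t]; positivity
  set u : ℕ → Ω → ENNReal := fun n ω =>
    ENNReal.ofReal (2 * (1 - Real.cos (t n * Y ω)) / t n ^ 2)
  have hu : ∀ n, ∫⁻ ω, u n ω ∂P ≤ ENNReal.ofReal (2 * A) := by
    intro n
    have hint := integrable_exp_I_mul (P := P) (Y := fun ω => t n * Y ω) (by fun_prop)
    have hre : ∫ ω, (1 - Real.cos (t n * Y ω)) ∂P =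
        (1 - ∫ ω, Complex.exp (Complex.I * (t n * Y ω : ℝ)) ∂P).re := by
      have h1 : ∀ ω, Real.cos (t n * Y ω) =
          (Complex.exp (Complex.I * (t n * Y ω : ℝ))).re := fun ω => by
        rw [mul_comm Complex.I, Complex.exp_ofReal_mul_I_re]
      have h2 := integral_re hint
      simp only [RCLike.re_to_complex] at h2
      have hint' : Integrable
          (fun ω => (Complex.exp (Complex.I * (t n * Y ω : ℝ))).re) P := hint.re
      simp only [h1]
      rw [integral_sub (integrable_const _) hint', h2]
      simp
    have hci : Integrable (fun ω => 2 * (1 - Real.cos (t n * Y ω)) / t n ^ 2) P := by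
      refine (Integrable.const_mul ?_ 2).div_const _
      refine Integrable.of_bound (by fun_prop) 2 (Eventually.of_forall fun ω => ?_)
      rw [Real.norm_eq_abs, abs_le]
      constructor <;> linarith [Real.neg_one_le_cos (t n * Y ω), Real.cos_le_one (t n * Y ω)]
    rw [← ofReal_integral_eq_lintegral_ofReal hci (Eventually.of_forall fun ω => by
      have := Real.cos_le_one (t n * Y ω)
      exact div_nonneg (by simp; linarith) (sq_nonneg _))]
    refine ENNReal.ofReal_le_ofReal ?_
    rw [integral_div, integral_const_mul, hre, div_le_iff₀ (pow_pos (htpos n) 2)]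
    linarith [(Complex.re_le_norm _).trans (h (t n))]
  have hlim : ∀ ω, Tendsto (fun n => u n ω) atTop (𝓝 (ENNReal.ofReal (Y ω ^ 2))) := by
    intro ω
    refine ENNReal.tendsto_ofReal ?_
    have hsinc : ∀ n, 2 * (1 - Real.cos (t n * Y ω)) / t n ^ 2 =
        Y ω ^ 2 * Real.sinc (t n * Y ω / 2) ^ 2 := by
      intro n
      have hc : 1 - Real.cos (t n * Y ω) = 2 * Real.sin (t n * Y ω / 2) ^ 2 := by
        have := Real.cos_sq (t n * Y ω / 2)
        rw [mul_div_cancel₀ _ two_ne_zero] at this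
        nlinarith [Real.sin_sq_add_cos_sq (t n * Y ω / 2)]
      have hs : Real.sin (t n * Y ω / 2) = Real.sinc (t n * Y ω / 2) * (t n * Y ω / 2) := by
        by_cases h0 : t n * Y ω / 2 = 0
        · rw [h0]; simp
        · rw [Real.sinc_of_ne_zero h0, div_mul_cancel₀ _ h0]
      rw [hc, hs]
      have := (htpos n).ne'
      field_simp
    simp only [hsinc]
    have hc : Tendsto (fun n => Real.sinc (t n * Y ω / 2)) atTop (𝓝 1) := by
      have h0 : Tendsto (fun n => t n * Y ω / 2) atTop (𝓝 0) := by
        simpa using (ht.mul_const (Y ω)).div_const 2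
      simpa [Function.comp_def] using (Real.continuous_sinc.tendsto 0).comp h0
    simpa using (hc.pow 2).const_mul (Y ω ^ 2)
  calc ∫⁻ ω, ENNReal.ofReal (Y ω ^ 2) ∂P = ∫⁻ ω, liminf (fun n => u n ω) atTop ∂P :=
        lintegral_congr fun ω => (hlim ω).liminf_eq.symm
    _ ≤ liminf (fun n => ∫⁻ ω, u n ω ∂P) atTop :=
        lintegral_liminf_le fun n => by simp only [u]; fun_prop
    _ ≤ ENNReal.ofReal (2 * A) := liminf_le_of_frequently_le' (Frequently.of_forall hu)

/-- The second moments of a noise whose Lévy characteristic is bounded quadratically are dominated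
by those of a white noise. -/
theorem lintegral_sq_noise_le {ψ : ℝ → ℂ} {P : Measure (Distr d)} (hP : IsNoiseLaw ψ P) {K : ℝ}
    (hψ : ∀ t, ‖ψ t‖ ≤ K * t ^ 2) (f : TestFun d) :
    ∫⁻ ω, ENNReal.ofReal ((ω f) ^ 2) ∂P ≤ ENNReal.ofReal (4 * K * ∫ x, f x ^ 2) := by
  have := hP.isProbabilityMeasure
  have h := lintegral_sq_le_of_norm_one_sub_char_le (P := P) (Y := fun ω => ω f)
    (continuous_eval_distr f).measurable (A := 2 * (K * ∫ x, f x ^ 2)) fun t => ?_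
  · refine h.trans_eq ?_
    congr 1; ring
  · set w := ∫ x, ψ (t * f x)
    have hw : ‖w‖ ≤ K * (∫ x, f x ^ 2) * t ^ 2 := by
      have := norm_integral_char_le hψ (t • f)
      simp only [smul_apply, smul_eq_mul, mul_pow] at this
      rw [integral_const_mul] at this
      linarith
    have hE := integral_noise_exp_smul hP f t
    have hbd : ‖∫ ω, Complex.exp (Complex.I * (t * ω f : ℝ)) ∂P‖ ≤ 1 := by
      refine (norm_integral_le_of_norm_le_const (C := 1) (Eventually.of_forall fun ω => ?_)).trans
        (by simp)
      rw [mul_comm Complex.I, Complex.norm_exp_ofReal_mul_I]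
    -- for `‖w‖ ≥ 1` the trivial bound `‖1 - e^w‖ ≤ 2` suffices
    rcases le_total ‖w‖ 1 with h1 | h1
    · rw [hE, norm_sub_rev]
      linarith [Complex.norm_exp_sub_one_le h1]
    · have := norm_sub_le 1 (∫ ω, Complex.exp (Complex.I * (t * ω f : ℝ)) ∂P)
      rw [norm_one] at this
      linarith

theorem tendsto_integral_char {ι : Type*} {l : Filter ι} [l.IsCountablyGenerated] {ψ : ι → ℝ → ℂ}
    {ψ' : ℝ → ℂ} {K : ℝ} (hc : ∀ᶠ i in l, Continuous (ψ i))
    (hψ : ∀ᶠ i in l, ∀ t, ‖ψ i t‖ ≤ K * t ^ 2)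
    (hlim : ∀ t, Tendsto (fun i => ψ i t) l (𝓝 (ψ' t))) (f : TestFun d) :
    Tendsto (fun i => ∫ x, ψ i (f x)) l (𝓝 (∫ x, ψ' (f x))) := by
  refine tendsto_integral_filter_of_dominated_convergence (fun x => K * f x ^ 2) ?_ ?_
    ((integrable_sq_testFun f).const_mul K) ?_
  · filter_upwards [hc] with i hi
    exact (hi.comp f.continuous).aestronglyMeasurable
  · filter_upwards [hψ] with i hi
    exact Eventually.of_forall fun x => hi _
  · exact Eventually.of_forall fun x => hlim _

/-- Convergence of characteristic functionals implies convergence of the expectations of bounded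
cylinder functionals, by the Lévy continuity theorem in finite dimension. -/
theorem tendsto_integral_of_isCylinder {P : ℕ → Measure (Distr d)} {P' : Measure (Distr d)}
    (hP : ∀ n, IsProbabilityMeasure (P n)) (hP' : IsProbabilityMeasure P')
    (hlim : ∀ f : TestFun d, Tendsto (fun n => ∫ ω, Complex.exp (Complex.I * (ω f : ℝ)) ∂(P n))
      atTop (𝓝 (∫ ω, Complex.exp (Complex.I * (ω f : ℝ)) ∂P')))
    {F : Distr d → ℝ} (hF : IsCylinder F) {a : ℝ} (ha : 0 ≤ a) (hFa : ∀ ω, |F ω| ≤ a) :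
    Tendsto (fun n => ∫ ω, F ω ∂(P n)) atTop (𝓝 (∫ ω, F ω ∂P')) := by
  obtain ⟨ι, _, f, H, hH, hFH⟩ := hF
  let T : Distr d → EuclideanSpace ℝ ι := fun ω => WithLp.toLp 2 fun i => ω (f i)
  have hT : Continuous T := (PiLp.continuous_toLp 2 _).comp
    (continuous_pi fun i => continuous_eval_distr (f i))
  have hTm : Measurable T := hT.measurable
  let Q (μ : Measure (Distr d)) (hμ : IsProbabilityMeasure μ) :
      ProbabilityMeasure (EuclideanSpace ℝ ι) :=
    ⟨μ.map T, Measure.isProbabilityMeasure_map hTm.aemeasurable⟩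
  have hchar : ∀ (μ : Measure (Distr d)) (hμ : IsProbabilityMeasure μ) (t : EuclideanSpace ℝ ι),
      charFun (Q μ hμ : Measure (EuclideanSpace ℝ ι)) t =
        ∫ ω, Complex.exp (Complex.I * (ω (∑ i, t i • f i) : ℝ)) ∂μ := by
    intro μ hμ t
    change charFun (μ.map T) t = _
    rw [charFun_apply, integral_map hTm.aemeasurable (by fun_prop)]
    refine integral_congr_ae (Eventually.of_forall fun ω => ?_)
    simp only [T, map_sum, map_smul, smul_eq_mul, PiLp.inner_apply, RCLike.inner_apply,
      conj_trivial, mul_comm]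
  have hconv : Tendsto (fun n => Q (P n) (hP n)) atTop (𝓝 (Q P' hP')) := by
    rw [ProbabilityMeasure.tendsto_iff_tendsto_charFun]
    intro t
    simp only [hchar]
    exact hlim _
  rw [ProbabilityMeasure.tendsto_iff_forall_integral_tendsto] at hconv
  -- `H` is bounded only on the range of `T`, so it is truncated to a bounded function
  let B : EuclideanSpace ℝ ι →ᵇ ℝ := BoundedContinuousFunction.ofNormedAddCommGroup
    (fun v => clamp a (H v.ofLp)) ((continuous_clamp a).comp (hH.comp (PiLp.continuous_ofLp 2 _))) a
    fun v => abs_clamp_le ha _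
  have key := hconv B
  have hint : ∀ (μ : Measure (Distr d)) (hμ : IsProbabilityMeasure μ),
      ∫ v, B v ∂(Q μ hμ : Measure (EuclideanSpace ℝ ι)) = ∫ ω, F ω ∂μ := by
    intro μ hμ
    change ∫ v, B v ∂(μ.map T) = _
    rw [integral_map hTm.aemeasurable B.continuous.aestronglyMeasurable]
    refine integral_congr_ae (Eventually.of_forall fun ω => ?_)
    change clamp a (H fun i => ω (f i)) = F ω
    rw [← hFH, clamp_eq (hFa ω)]
  simpa only [hint] using key

/-! ### Characteristic functions and absolute continuity -/

open scoped FourierTransform in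
/-- Parseval's identity for a finite measure and a Schwartz function. -/
theorem integral_schwartz_eq_integral_fourier_mul_charFun (μ : Measure ℝ) [IsFiniteMeasure μ]
    (w : 𝓢(ℝ, ℂ)) :
    ∫ x, w x ∂μ = ∫ ξ, (𝓕 w) ξ * charFun μ (2 * Real.pi * ξ) := by
  have hw : ∀ x, w x = ∫ ξ, Complex.exp ((2 * Real.pi * ξ : ℝ) * x * Complex.I) * (𝓕 w) ξ := by
    intro x
    have h : w x = (𝓕⁻ (𝓕 w)) x := by rw [FourierTransform.fourierInv_fourier_eq]
    rw [h, SchwartzMap.fourierInv_coe, Real.fourierInv_eq']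
    refine integral_congr_ae (Eventually.of_forall fun ξ => ?_)
    simp only [smul_eq_mul, RCLike.inner_apply, conj_trivial]
    congr 2
    push_cast
    ring
  have hint : Integrable (Function.uncurry fun (x ξ : ℝ) =>
      Complex.exp ((2 * Real.pi * ξ : ℝ) * x * Complex.I) * (𝓕 w) ξ) (μ.prod volume) := by
    have h1 : Integrable (fun p : ℝ × ℝ => (𝓕 w) p.2) (μ.prod volume) :=
      (𝓕 w).integrable.comp_snd μ
    refine h1.bdd_mul (c := 1) (by fun_prop) (Eventually.of_forall fun p => ?_)
    rw [← Complex.ofReal_mul, Complex.norm_exp_ofReal_mul_I]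
  calc ∫ x, w x ∂μ
      = ∫ x : ℝ, (∫ ξ : ℝ, Complex.exp ((2 * Real.pi * ξ : ℝ) * x * Complex.I) * (𝓕 w) ξ) ∂μ :=
        integral_congr_ae (Eventually.of_forall hw)
    _ = ∫ ξ : ℝ, ∫ x : ℝ, Complex.exp ((2 * Real.pi * ξ : ℝ) * x * Complex.I) * (𝓕 w) ξ ∂μ :=
        integral_integral_swap hint
    _ = _ := by
        refine integral_congr_ae (Eventually.of_forall fun ξ => ?_)
        simp only
        rw [integral_mul_const, charFun_apply_real, mul_comm]

open scoped ContDiff in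
/-- A smooth function between the indicators of a compact set and of an open neighbourhood. -/
theorem exists_schwartz_between {K U : Set ℝ} (hK : IsCompact K) (hU : IsOpen U) (hKU : K ⊆ U) :
    ∃ w : 𝓢(ℝ, ℂ), ∃ f : ℝ → ℝ, (∀ x, w x = f x) ∧ (∀ x, f x ∈ Icc 0 1) ∧
      (∀ x ∈ K, f x = 1) ∧ ∀ x ∉ U, f x = 0 := by
  obtain ⟨R, hR⟩ := hK.isBounded.subset_ball (0 : ℝ)
  set V := U ∩ Metric.ball (0 : ℝ) R
  have hV : IsOpen V := hU.inter Metric.isOpen_ball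
  have hKV : K ⊆ V := subset_inter hKU hR
  obtain ⟨f, hf0, hf1, hf⟩ := exists_contMDiffMap_zero_one_of_isClosed (n := ⊤)
    (modelWithCornersSelf ℝ ℝ) hV.isClosed_compl hK.isClosed
    (disjoint_compl_left_iff_subset.2 hKV)
  have hfs : ContDiff ℝ ∞ f := contMDiff_iff_contDiff.1 f.contMDiff
  have hsupp : HasCompactSupport f := by
    refine HasCompactSupport.intro (isCompact_closedBall (0 : ℝ) R) fun x hx => hf0 ?_
    exact fun hxV => hx (Metric.ball_subset_closedBall hxV.2)
  refine ⟨HasCompactSupport.toSchwartzMap (f := fun x => (f x : ℂ))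
    (hsupp.comp_left (g := Complex.ofReal) (by simp)) (Complex.ofRealCLM.contDiff.comp hfs),
    f, fun x => rfl, hf, fun x hx => hf1 hx, fun x hx => hf0 fun hxV => hx hxV.1⟩

open scoped FourierTransform in
/-- If the characteristic function of `μ` factors as `(h + a) R` with `h` integrable, `a ≥ 0`
constant, and `R` a limit of characteristic functions of probability measures, then `μ` is the sum
of a part with bounded density and of a part of mass at most `a`. -/
theorem measure_le_of_charFun_eq {μ : Measure ℝ} [IsProbabilityMeasure μ] {h R : ℝ → ℂ} {a B : ℝ}
    (ha : 0 ≤ a) {p : ℕ → Measure ℝ} (hp : ∀ k, IsProbabilityMeasure (p k))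
    (hR : ∀ t, Tendsto (fun k => charFun (p k) t) atTop (𝓝 (R t)))
    (hh : Integrable h) (hB : ∫ t, ‖h t‖ ≤ B) (hμ : ∀ t, charFun μ t = (h t + a) * R t)
    {A : Set ℝ} (hA : MeasurableSet A) :
    μ A ≤ ENNReal.ofReal B * volume A + ENNReal.ofReal a := by
  have hB0 : 0 ≤ B := (integral_nonneg fun t => norm_nonneg _).trans hB
  have hRm : Measurable R := measurable_of_tendsto_metrizable
    (fun k => measurable_charFun) (tendsto_pi_nhds.2 hR)
  have hR1 : ∀ t, ‖R t‖ ≤ 1 := fun t =>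
    le_of_tendsto (hR t).norm (Eventually.of_forall fun k => norm_charFun_le_one t)
  have hpi : (1 : ℝ) ≤ 2 * Real.pi := by linarith [Real.pi_gt_three]
  have hpi0 : 2 * Real.pi ≠ 0 := by positivity
  -- the smoothed form of the estimate
  have main : ∀ w : 𝓢(ℝ, ℂ), (∀ x, ‖w x‖ ≤ 1) →
      ‖∫ x, w x ∂μ‖ ≤ B * (∫ x, ‖w x‖) + a := by
    intro w hw
    set W := 𝓕 w
    have hWint : Integrable (fun ξ => W ξ) := W.integrable
    have hRc : Measurable fun ξ => R (2 * Real.pi * ξ) := hRm.comp (by fun_prop)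
    have i1 : Integrable fun ξ => W ξ * R (2 * Real.pi * ξ) :=
      hWint.mul_bdd (c := 1) hRc.aestronglyMeasurable (Eventually.of_forall fun ξ => hR1 _)
    have hW : ∀ ξ, ‖W ξ‖ ≤ ∫ x, ‖w x‖ := fun ξ => by
      have := norm_fourier_apply_le_toLp_one w ξ
      rwa [norm_toLp_one] at this
    have hhc : Integrable fun ξ => h (2 * Real.pi * ξ) := hh.comp_mul_left' hpi0
    have i0 : Integrable fun ξ => h (2 * Real.pi * ξ) * R (2 * Real.pi * ξ) :=
      hhc.mul_bdd (c := 1) hRc.aestronglyMeasurable (Eventually.of_forall fun ξ => hR1 _)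
    have i2 : Integrable fun ξ => W ξ * (h (2 * Real.pi * ξ) * R (2 * Real.pi * ξ)) :=
      i0.bdd_mul (c := ∫ x, ‖w x‖) W.continuous.aestronglyMeasurable
        (Eventually.of_forall hW)
    have b1 : ‖∫ ξ, W ξ * R (2 * Real.pi * ξ)‖ ≤ 1 := by
      have hl : Tendsto (fun k => ∫ ξ, W ξ * charFun (p k) (2 * Real.pi * ξ)) atTop
          (𝓝 (∫ ξ, W ξ * R (2 * Real.pi * ξ))) := by
        refine tendsto_integral_of_dominated_convergence (fun ξ => ‖W ξ‖) ?_ hWint.norm ?_ ?_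
        · exact fun k => W.continuous.aestronglyMeasurable.mul
            (measurable_charFun.comp (by fun_prop)).aestronglyMeasurable
        · refine fun k => Eventually.of_forall fun ξ => ?_
          rw [norm_mul]
          exact mul_le_of_le_one_right (norm_nonneg _) (norm_charFun_le_one _)
        · exact Eventually.of_forall fun ξ => (hR _).const_mul _
      refine le_of_tendsto hl.norm (Eventually.of_forall fun k => ?_)
      rw [← integral_schwartz_eq_integral_fourier_mul_charFun]
      refine (norm_integral_le_of_norm_le_const (Eventually.of_forall hw)).trans ?_
      simp
    have b2 : ‖∫ ξ, W ξ * (h (2 * Real.pi * ξ) * R (2 * Real.pi * ξ))‖ ≤ B * ∫ x, ‖w x‖ := by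
      calc _ ≤ ∫ ξ, (∫ x, ‖w x‖) * ‖h (2 * Real.pi * ξ)‖ := by
            refine norm_integral_le_of_norm_le (hhc.norm.const_mul _)
              (Eventually.of_forall fun ξ => ?_)
            rw [norm_mul, norm_mul]
            gcongr
            · exact hW ξ
            · exact mul_le_of_le_one_right (norm_nonneg _) (hR1 _)
        _ = (∫ x, ‖w x‖) * ((2 * Real.pi)⁻¹ * ∫ t, ‖h t‖) := by
            rw [integral_const_mul, Measure.integral_comp_mul_left (fun t => ‖h t‖), smul_eq_mul,
              abs_of_pos (by positivity)]
        _ ≤ (∫ x, ‖w x‖) * (1 * B) := by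
            gcongr
            exact inv_le_one_of_one_le₀ hpi
        _ = _ := by ring
    have e : ∫ x, w x ∂μ = (∫ ξ, W ξ * (h (2 * Real.pi * ξ) * R (2 * Real.pi * ξ))) +
        a * ∫ ξ, W ξ * R (2 * Real.pi * ξ) := by
      rw [integral_schwartz_eq_integral_fourier_mul_charFun, ← integral_const_mul,
        ← integral_add i2 (i1.const_mul _)]
      refine integral_congr_ae (Eventually.of_forall fun ξ => ?_)
      simp only [hμ]
      ring
    rw [e]
    refine (norm_add_le _ _).trans (add_le_add b2 ?_)
    rw [norm_mul, Complex.norm_real, Real.norm_eq_abs, abs_of_nonneg ha]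
    exact mul_le_of_le_one_right ha b1
  -- the estimate for compact sets inside open sets, and then by regularity of the two measures
  have hKU : ∀ K U : Set ℝ, IsCompact K → IsOpen U → K ⊆ U → volume U ≠ ⊤ →
      μ K ≤ ENNReal.ofReal B * volume U + ENNReal.ofReal a := by
    intro K U hK hU hsub hUfin
    obtain ⟨w, f, hwf, hf, hf1, hf0⟩ := exists_schwartz_between hK hU hsub
    have hfc : Continuous f := by
      have : f = fun x => (w x).re := by ext x; simp [hwf]
      rw [this]
      exact Complex.continuous_re.comp w.continuous
    have hwn : ∀ x, ‖w x‖ = f x := fun x => by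
      rw [hwf, Complex.norm_real, Real.norm_eq_abs, abs_of_nonneg (hf x).1]
    have h1 := main w fun x => by rw [hwn]; exact (hf x).2
    have hfU : ∫ x, ‖w x‖ ≤ volume.real U := by
      simp only [hwn]
      rw [← integral_indicator_one hU.measurableSet]
      refine integral_mono_of_nonneg (Eventually.of_forall fun x => (hf x).1)
        ((integrable_indicator_iff hU.measurableSet).2
          (integrableOn_const hUfin)) (Eventually.of_forall fun x => ?_)
      by_cases hx : x ∈ U
      · simpa [hx] using (hf x).2
      · simp [hx, hf0 x hx]
    have hμK : μ.real K ≤ ‖∫ x, w x ∂μ‖ := by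
      simp only [hwf]
      rw [integral_complex_ofReal, Complex.norm_real, ← integral_indicator_one hK.measurableSet,
        Real.norm_eq_abs]
      refine le_trans ?_ (le_abs_self _)
      refine integral_mono_of_nonneg (Eventually.of_forall fun x => ?_)
        (Integrable.of_bound hfc.aestronglyMeasurable 1 (Eventually.of_forall fun x => ?_))
        (Eventually.of_forall fun x => ?_)
      · exact indicator_nonneg (fun _ _ => zero_le_one) x
      · rw [Real.norm_eq_abs, abs_of_nonneg (hf x).1]; exact (hf x).2
      · by_cases hx : x ∈ K
        · simp [hx, hf1 x hx]
        · simpa [hx] using (hf x).1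
    have h2 : μ.real K ≤ B * volume.real U + a := by
      refine hμK.trans (h1.trans ?_)
      gcongr
    rw [← ENNReal.ofReal_toReal hUfin, ← ENNReal.ofReal_mul hB0, ← ENNReal.ofReal_add
      (mul_nonneg hB0 ENNReal.toReal_nonneg) ha, ← ofReal_measureReal]
    exact ENNReal.ofReal_le_ofReal h2
  rw [hA.measure_eq_iSup_isCompact]
  refine iSup₂_le fun K hKA => iSup_le fun hK => ?_
  refine le_trans ?_ (add_le_add_left (mul_le_mul_right (measure_mono hKA) _) _)
  have hfin : volume K < ⊤ := hK.measure_lt_top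
  refine ENNReal.le_of_forall_pos_le_add fun δ hδ _ => ?_
  have hδ' : (0 : ℝ) < δ / (B + 1) := by positivity
  obtain ⟨U, hKU', hU, hUv⟩ := K.exists_isOpen_lt_add hfin.ne
    (ENNReal.ofReal_pos.2 hδ').ne'
  refine (hKU K U hK hU hKU' (hUv.trans (by finiteness)).ne).trans ?_
  calc ENNReal.ofReal B * volume U + ENNReal.ofReal a
      ≤ ENNReal.ofReal B * (volume K + ENNReal.ofReal (δ / (B + 1))) + ENNReal.ofReal a := by
        gcongr
    _ = ENNReal.ofReal B * volume K + ENNReal.ofReal a +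
          ENNReal.ofReal (B * (δ / (B + 1))) := by
        rw [mul_add, ENNReal.ofReal_mul hB0]; ring
    _ ≤ _ := by
        gcongr
        rw [← ENNReal.ofReal_coe_nnreal]
        refine ENNReal.ofReal_le_ofReal ?_
        rw [mul_div_assoc', div_le_iff₀ (by positivity)]
        nlinarith [δ.2]

theorem exists_charFun_eq_pow (b : Measure ℝ) [IsProbabilityMeasure b] (n : ℕ) :
    ∃ p : Measure ℝ, IsProbabilityMeasure p ∧ ∀ t, charFun p t = charFun b t ^ n := by
  induction n with
  | zero => exact ⟨Measure.dirac 0, inferInstance, fun t => by simp⟩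
  | succ n ih =>
    obtain ⟨p, _, hp⟩ := ih
    exact ⟨p.conv b, inferInstance, fun t => by rw [charFun_conv, hp, pow_succ]⟩

/-- A sub-probability measure `θ` and a random variable `Y` give a probability law with
characteristic function `1 + ∫ (e^{itY} - 1) dθ`. -/
theorem exists_charFun_eq_one_add {Ω : Type*} [MeasurableSpace Ω] {θ : Measure Ω}
    (hθ : θ univ ≤ 1) {Y : Ω → ℝ} (hY : Measurable Y) :
    ∃ b : Measure ℝ, IsProbabilityMeasure b ∧
      ∀ t, charFun b t = 1 + ∫ x, (Complex.exp (Complex.I * (t * Y x : ℝ)) - 1) ∂θ := by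
  have : IsFiniteMeasure θ := ⟨hθ.trans_lt ENNReal.one_lt_top⟩
  refine ⟨θ.map Y + (1 - θ univ) • Measure.dirac 0, ⟨?_⟩, fun t => ?_⟩
  · rw [Measure.add_apply, Measure.map_apply hY MeasurableSet.univ, Measure.smul_apply]
    simp [add_tsub_cancel_of_le hθ]
  · have hfin : (1 - θ univ) ≠ ⊤ := (tsub_le_self.trans_lt ENNReal.one_lt_top).ne
    have i0 : Integrable (fun x : ℝ => Complex.exp (t * x * Complex.I)) (Measure.map Y θ) := by
      refine Integrable.of_bound (by fun_prop) 1 (Eventually.of_forall fun x => ?_)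
      rw [← Complex.ofReal_mul, Complex.norm_exp_ofReal_mul_I]
    have i1 : Integrable (fun x : ℝ => Complex.exp (t * x * Complex.I))
        ((1 - θ univ) • Measure.dirac (0 : ℝ)) :=
      (integrable_dirac (by simp)).smul_measure hfin
    rw [charFun_apply_real, integral_add_measure i0 i1, integral_smul_measure, integral_dirac,
      integral_map hY.aemeasurable (by fun_prop), integral_sub
        (integrable_exp_I_mul (Y := fun x => t * Y x) (by fun_prop)) (integrable_const _),
      integral_const, ENNReal.toReal_sub_of_le hθ ENNReal.one_ne_top]
    simp only [Measure.real, Complex.ofReal_zero, mul_zero, zero_mul, Complex.exp_zero,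
      Complex.real_smul, ENNReal.toReal_one]
    push_cast
    have : ∀ x, Complex.exp (t * Y x * Complex.I) = Complex.exp (Complex.I * (t * Y x)) :=
      fun x => by rw [mul_comm]
    simp only [this]
    ring

/-- An exponential `exp (∫ (e^{itY} - 1) w dθ)`, with a nonnegative weight `w` of possibly infinite
mass, is a limit of characteristic functions of probability measures. -/
theorem exists_tendsto_charFun_exp {Ω : Type*} [MeasurableSpace Ω] {θ : Measure Ω} [SigmaFinite θ]
    {Y : Ω → ℝ} (hY : Measurable Y) {w : Ω → ℝ} (hw : Measurable w) (hw0 : ∀ x, 0 ≤ w x)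
    (hint : ∀ t : ℝ, Integrable
      (fun x => (w x : ℂ) * (Complex.exp (Complex.I * (t * Y x : ℝ)) - 1)) θ) :
    ∃ p : ℕ → Measure ℝ, (∀ k, IsProbabilityMeasure (p k)) ∧ ∀ t, Tendsto
      (fun k => charFun (p k) t) atTop
      (𝓝 (Complex.exp (∫ x, (w x : ℂ) * (Complex.exp (Complex.I * (t * Y x : ℝ)) - 1) ∂θ))) := by
  -- `w / k` is truncated by a function `q` of integral at most one, and the law with characteristic
  -- function `1 + ∫ (e^{itY} - 1) δ_k dθ` is convolved `k` times
  obtain ⟨q, hq0, hqm, hq1⟩ := exists_pos_lintegral_lt_of_sigmaFinite θ one_ne_zero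
  let δ (k : ℕ) (x : Ω) : NNReal := min (Real.toNNReal (w x / k)) (q x)
  have hδm : ∀ k, Measurable (δ k) := fun k => ((hw.div_const _).real_toNNReal).min hqm
  have hmass : ∀ k, (θ.withDensity fun x => (δ k x : ENNReal)) univ ≤ 1 := fun k => by
    rw [withDensity_apply _ MeasurableSet.univ, Measure.restrict_univ]
    exact (lintegral_mono fun x => ENNReal.coe_le_coe.2 (min_le_right _ _)).trans hq1.le
  choose b hb hbchar using fun k => exists_charFun_eq_one_add (hmass k) hY
  choose p hp hpchar using fun k => exists_charFun_eq_pow (b k) k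
  refine ⟨p, hp, fun t => ?_⟩
  simp only [hpchar, hbchar]
  refine Complex.tendsto_one_add_pow_exp_of_tendsto ?_
  have e : ∀ k : ℕ, (k : ℂ) * ∫ x, (Complex.exp (Complex.I * (t * Y x : ℝ)) - 1)
      ∂(θ.withDensity fun x => (δ k x : ENNReal)) =
      ∫ x, (((k * δ k x : ℝ)) : ℂ) * (Complex.exp (Complex.I * (t * Y x : ℝ)) - 1) ∂θ := by
    intro k
    rw [integral_withDensity_eq_integral_smul (hδm k), ← integral_const_mul]
    refine integral_congr_ae (Eventually.of_forall fun x => ?_)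
    simp only [NNReal.smul_def, Complex.real_smul]
    push_cast
    ring
  simp only [e]
  have hle : ∀ (k : ℕ) x, (k * δ k x : ℝ) ≤ w x := by
    intro k x
    rcases Nat.eq_zero_or_pos k with rfl | hk
    · simpa using hw0 x
    · have hk' : (0 : ℝ) < k := by exact_mod_cast hk
      have h1 : (δ k x : ℝ) ≤ w x / k := by
        have : (δ k x : ℝ) ≤ (Real.toNNReal (w x / k) : ℝ) := by
          exact_mod_cast min_le_left (Real.toNNReal (w x / k)) (q x)
        rwa [Real.coe_toNNReal _ (div_nonneg (hw0 x) hk'.le)] at this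
      calc (k : ℝ) * δ k x ≤ k * (w x / k) := by gcongr
        _ = w x := mul_div_cancel₀ _ hk'.ne'
  refine tendsto_integral_of_dominated_convergence
    (fun x => ‖(w x : ℂ) * (Complex.exp (Complex.I * (t * Y x : ℝ)) - 1)‖) ?_ (hint t).norm ?_ ?_
  · intro k
    have := hδm k
    exact Measurable.aestronglyMeasurable (by fun_prop)
  · refine fun k => Eventually.of_forall fun x => ?_
    rw [norm_mul, norm_mul, Complex.norm_real, Complex.norm_real, Real.norm_eq_abs,
      Real.norm_eq_abs, abs_of_nonneg (hw0 x), abs_of_nonneg (by positivity)]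
    gcongr
    exact hle k x
  · refine Eventually.of_forall fun x => ?_
    refine Tendsto.mul_const _ ?_
    refine tendsto_const_nhds.congr' ?_
    have hlim : Tendsto (fun k : ℕ => w x / k) atTop (𝓝 0) := tendsto_const_div_atTop_nhds_zero_nat _
    have hq : (0 : ℝ) < q x := by exact_mod_cast hq0 x
    filter_upwards [hlim.eventually_lt_const hq, eventually_gt_atTop 0] with k hk hk0
    have hk' : (0 : ℝ) < k := by exact_mod_cast hk0
    have : δ k x = Real.toNNReal (w x / k) := by
      refine min_eq_left ?_
      rw [Real.toNNReal_le_iff_le_coe]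
      exact hk.le
    rw [this, Real.coe_toNNReal _ (div_nonneg (hw0 x) hk'.le), mul_div_cancel₀ _ hk'.ne']

/-! ### Oscillatory integrals -/

theorem integrable_mul_testFun {f : Space d → ℝ} (hf : Integrable f) (h : TestFun d) :
    Integrable fun y => f y * h y :=
  hf.mul_bdd (c := SchwartzMap.seminorm ℝ 0 0 h) h.continuous.aestronglyMeasurable
    (Eventually.of_forall fun y => norm_le_seminorm ℝ h y)

theorem integrable_ofReal_mul_exp {f : Space d → ℝ} (hf : Integrable f) (g : TestFun d) (τ : ℝ) :
    Integrable fun y => (f y : ℂ) * Complex.exp (Complex.I * (τ * g y : ℝ)) := by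
  refine hf.ofReal.mul_bdd (c := 1) ?_ (Eventually.of_forall fun y => ?_)
  · have := g.continuous
    exact Continuous.aestronglyMeasurable (by fun_prop)
  · rw [mul_comm Complex.I, Complex.norm_exp_ofReal_mul_I]

/-- Integration by parts against the phase `e^{iτg}`, in the direction `v`. -/
theorem integral_mul_deriv_mul_exp (g h₁ : TestFun d) (v : Space d)
    (hg : ∀ y, fderiv ℝ g y v = h₁ y) {a b : Space d → ℝ} (ha : Differentiable ℝ a)
    (hab : ∀ y, fderiv ℝ a y v = b y) (hai : Integrable a) (hbi : Integrable b) (τ : ℝ) :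
    (Complex.I * τ) * ∫ y, ((a y * h₁ y : ℝ) : ℂ) * Complex.exp (Complex.I * (τ * g y : ℝ)) =
      -∫ y, (b y : ℂ) * Complex.exp (Complex.I * (τ * g y : ℝ)) := by
  have hE : ∀ y, HasFDerivAt (fun y => Complex.exp (Complex.I * (τ * g y : ℝ)))
      (Complex.exp (Complex.I * (τ * g y : ℝ)) • (Complex.I • (Complex.ofRealCLM.comp
        (τ • fderiv ℝ g y)))) y := fun y => by
    have h1 : HasFDerivAt (fun y => τ * g y) (τ • fderiv ℝ g y) y :=
      g.differentiableAt.hasFDerivAt.const_mul τ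
    have h2 : HasFDerivAt (fun y => ((τ * g y : ℝ) : ℂ)) (Complex.ofRealCLM.comp
      (τ • fderiv ℝ g y)) y := Complex.ofRealCLM.hasFDerivAt.comp y h1
    exact (h2.const_mul Complex.I).cexp
  have hA : ∀ y, HasFDerivAt (fun y => (a y : ℂ)) (Complex.ofRealCLM.comp (fderiv ℝ a y)) y :=
    fun y => Complex.ofRealCLM.hasFDerivAt.comp y (ha y).hasFDerivAt
  have hEv : ∀ y, fderiv ℝ (fun y => Complex.exp (Complex.I * (τ * g y : ℝ))) y v =
      (Complex.I * τ) * (h₁ y * Complex.exp (Complex.I * (τ * g y : ℝ))) := fun y => by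
    rw [(hE y).fderiv]
    simp [hg]
    ring
  have hAv : ∀ y, fderiv ℝ (fun y => (a y : ℂ)) y v = b y := fun y => by
    rw [(hA y).fderiv]
    simp [hab]
  have key := integral_mul_fderiv_eq_neg_fderiv_mul_of_integrable (μ := volume) (𝕜 := ℂ)
    (f := fun y => (a y : ℂ)) (g := fun y => Complex.exp (Complex.I * (τ * g y : ℝ))) (v := v)
    (by simp only [hAv]; exact integrable_ofReal_mul_exp hbi g τ)
    (by
      simp only [hEv]
      refine ((integrable_ofReal_mul_exp (integrable_mul_testFun hai h₁) g τ).const_mul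
        (Complex.I * τ)).congr (Eventually.of_forall fun y => ?_)
      push_cast
      ring)
    (integrable_ofReal_mul_exp hai g τ)
    (fun y _ => (hA y).differentiableAt) (fun y _ => (hE y).differentiableAt)
  simp only [hAv, hEv] at key
  rw [← key, ← integral_const_mul]
  refine integral_congr_ae (Eventually.of_forall fun y => ?_)
  push_cast
  ring

open scoped LineDeriv in
/-- Weighted by the fourth power of a directional derivative of the phase, the oscillatory integral
decays quadratically: no lower bound on that derivative is needed. -/
theorem exists_oscillatory_bound (g : TestFun d) (v : Space d) :
    ∃ C, 0 ≤ C ∧ ∀ τ : ℝ, τ ^ 2 * ‖∫ y, (((fderiv ℝ g y v) ^ 4 : ℝ) : ℂ) *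
      Complex.exp (Complex.I * (τ * g y : ℝ))‖ ≤ C := by
  set h₁ : TestFun d := ∂_{v} g
  set h₂ : TestFun d := ∂_{v} h₁
  set h₃ : TestFun d := ∂_{v} h₂
  have e1 : ∀ y, fderiv ℝ g y v = h₁ y := fun y => (lineDerivOp_apply_eq_fderiv v g y).symm
  have e2 : ∀ y, fderiv ℝ h₁ y v = h₂ y := fun y => (lineDerivOp_apply_eq_fderiv v h₁ y).symm
  have e3 : ∀ y, fderiv ℝ h₂ y v = h₃ y := fun y => (lineDerivOp_apply_eq_fderiv v h₂ y).symm
  have i12 : Integrable fun y => h₁ y * h₂ y := integrable_mul_testFun h₁.integrable h₂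
  have i112 : Integrable fun y => 3 * (h₁ y * h₂ y) * h₁ y :=
    integrable_mul_testFun (i12.const_mul 3) h₁
  have i111 : Integrable fun y => h₁ y * h₁ y * h₁ y :=
    integrable_mul_testFun (integrable_mul_testFun h₁.integrable h₁) h₁
  have ib : Integrable fun y => 3 * (h₂ y * h₂ y + h₁ y * h₃ y) :=
    ((integrable_mul_testFun h₂.integrable h₂).add
      (integrable_mul_testFun h₁.integrable h₃)).const_mul 3
  refine ⟨∫ y, ‖3 * (h₂ y * h₂ y + h₁ y * h₃ y)‖, integral_nonneg fun y => norm_nonneg _,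
    fun τ => ?_⟩
  have d1 : ∀ y, HasFDerivAt h₁ (fderiv ℝ h₁ y) y := fun y => h₁.differentiableAt.hasFDerivAt
  have d2 : ∀ y, HasFDerivAt h₂ (fderiv ℝ h₂ y) y := fun y => h₂.differentiableAt.hasFDerivAt
  have dA : ∀ y, HasFDerivAt (fun y => h₁ y * h₁ y * h₁ y) _ y := fun y =>
    ((d1 y).mul (d1 y)).mul (d1 y)
  have dB : ∀ y, HasFDerivAt (fun y => 3 * (h₁ y * h₂ y)) _ y := fun y =>
    ((d1 y).mul (d2 y)).const_mul 3
  have k1 := integral_mul_deriv_mul_exp g h₁ v e1 (a := fun y => h₁ y * h₁ y * h₁ y)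
    (b := fun y => 3 * (h₁ y * h₂ y) * h₁ y) (fun y => (dA y).differentiableAt)
    (fun y => by
      rw [(dA y).fderiv]
      simp [e2]
      ring) i111 i112 τ
  have k2 := integral_mul_deriv_mul_exp g h₁ v e1 (a := fun y => 3 * (h₁ y * h₂ y))
    (b := fun y => 3 * (h₂ y * h₂ y + h₁ y * h₃ y)) (fun y => (dB y).differentiableAt)
    (fun y => by
      rw [(dB y).fderiv]
      simp [e2, e3]
      ring) (i12.const_mul 3) ib τ
  have e4 : ∀ y, (fderiv ℝ g y v) ^ 4 = h₁ y * h₁ y * h₁ y * h₁ y := fun y => by rw [e1]; ring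
  simp only [e4]
  set J := ∫ y, ((h₁ y * h₁ y * h₁ y * h₁ y : ℝ) : ℂ) * Complex.exp (Complex.I * (τ * g y : ℝ))
  have k3 : (τ ^ 2 : ℂ) * J = -∫ y, ((3 * (h₂ y * h₂ y + h₁ y * h₃ y) : ℝ) : ℂ) *
      Complex.exp (Complex.I * (τ * g y : ℝ)) := by
    rw [← k2]
    have hI := Complex.I_sq
    linear_combination ((τ : ℂ) ^ 2 * J) * hI + (-(Complex.I * τ)) * k1
  have k4 := congrArg norm k3
  rw [norm_mul, norm_pow, Complex.norm_real, Real.norm_eq_abs, sq_abs, norm_neg] at k4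
  rw [k4]
  refine norm_integral_le_of_norm_le ib.norm (Eventually.of_forall fun y => ?_)
  rw [norm_mul, Complex.norm_real, mul_comm Complex.I, Complex.norm_exp_ofReal_mul_I, mul_one]

/-! ### Integrability of exponentials of characteristic functions -/

section Gap

variable {Ω : Type*} [MeasurableSpace Ω] {θ : Measure Ω} {W Y : Ω → ℝ}

theorem integrable_weight_mul_exp (hW : Integrable W θ) (hY : Measurable Y) (u : ℝ) :
    Integrable (fun x => (W x : ℂ) * Complex.exp (Complex.I * (u * Y x : ℝ))) θ := by
  refine hW.ofReal.mul_bdd (c := 1) (by fun_prop) (Eventually.of_forall fun y => ?_)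
  rw [mul_comm Complex.I, Complex.norm_exp_ofReal_mul_I]

theorem continuous_weighted_char (hW : Integrable W θ) (hY : Measurable Y) :
    Continuous fun u : ℝ => ∫ x, (W x : ℂ) * Complex.exp (Complex.I * (u * Y x : ℝ)) ∂θ := by
  refine continuous_of_dominated (bound := fun x => ‖W x‖)
    (fun u => (integrable_weight_mul_exp hW hY u).aestronglyMeasurable) ?_ hW.norm ?_
  · refine fun u => Eventually.of_forall fun x => ?_
    rw [norm_mul, mul_comm Complex.I, Complex.norm_exp_ofReal_mul_I, mul_one, Complex.norm_real]
  · exact Eventually.of_forall fun x => by fun_prop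

theorem integral_sub_re_char (hW : Integrable W θ) (hY : Measurable Y) (u : ℝ) :
    ∫ x, W x ∂θ - (∫ x, (W x : ℂ) * Complex.exp (Complex.I * (u * Y x : ℝ)) ∂θ).re =
      ∫ x, W x * (1 - Real.cos (u * Y x)) ∂θ := by
  have h := integral_re (integrable_weight_mul_exp hW hY u)
  have hi : Integrable (fun x => ((W x : ℂ) * Complex.exp (Complex.I * (u * Y x : ℝ))).re) θ :=
    (integrable_weight_mul_exp hW hY u).re
  simp only [RCLike.re_to_complex] at h
  rw [← h, ← integral_sub hW hi]
  refine integral_congr_ae (Eventually.of_forall fun x => ?_)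
  simp only
  rw [Complex.re_ofReal_mul, mul_comm Complex.I, Complex.exp_ofReal_mul_I_re]
  ring

/-- The gap `D(u) = ∫ W (1 - cos (uY))` satisfies `D(2u) ≤ 4 D(u)`. -/
theorem gap_two_mul_le (hW : Integrable W θ) (hY : Measurable Y) (hW0 : ∀ x, 0 ≤ W x) (u : ℝ) :
    ∫ x, W x * (1 - Real.cos (2 * u * Y x)) ∂θ ≤ 4 * ∫ x, W x * (1 - Real.cos (u * Y x)) ∂θ := by
  have hi : ∀ u : ℝ, Integrable (fun x => W x * (1 - Real.cos (u * Y x))) θ := fun u =>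
    hW.mul_bdd (c := 2) (by fun_prop) (Eventually.of_forall fun x => by
      rw [Real.norm_eq_abs, abs_le]
      constructor <;> linarith [Real.neg_one_le_cos (u * Y x), Real.cos_le_one (u * Y x)])
  rw [← integral_const_mul]
  refine integral_mono (hi _) ((hi u).const_mul 4) fun x => ?_
  have h1 : Real.cos (2 * u * Y x) = 2 * Real.cos (u * Y x) ^ 2 - 1 := by
    rw [← Real.cos_two_mul]; ring_nf
  have h2 := Real.cos_le_one (u * Y x)
  have h3 : 1 - Real.cos (2 * u * Y x) ≤ 4 * (1 - Real.cos (u * Y x)) := by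
    rw [h1]; nlinarith [sq_nonneg (1 - Real.cos (u * Y x))]
  calc W x * (1 - Real.cos (2 * u * Y x)) ≤ W x * (4 * (1 - Real.cos (u * Y x))) :=
        mul_le_mul_of_nonneg_left h3 (hW0 x)
    _ = _ := by ring

/-- A function with `D(2u) ≤ 4 D(u)` that is bounded below far away grows quadratically at the
origin. -/
theorem quadratic_lower_bound_of_doubling {D : ℝ → ℝ} (hD0 : ∀ u, 0 ≤ D u)
    (hD : ∀ u, D (2 * u) ≤ 4 * D u) {m R : ℝ} (hR : 0 < R) (hm : 0 ≤ m)
    (hfar : ∀ u, R ≤ |u| → m ≤ D u) (u : ℝ) (hu : |u| ≤ R) : m / (4 * R ^ 2) * u ^ 2 ≤ D u := by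
  have step : ∀ n : ℕ, ∀ u : ℝ, R ≤ 2 ^ n * |u| → |u| ≤ R → m / (4 * R ^ 2) * u ^ 2 ≤ D u := by
    have hquad : ∀ u : ℝ, |u| ≤ R → m / (4 * R ^ 2) * u ^ 2 ≤ m / 4 := fun u hu => by
      have : u ^ 2 ≤ R ^ 2 := sq_le_sq' (by linarith [abs_le.1 hu]) (abs_le.1 hu).2
      calc m / (4 * R ^ 2) * u ^ 2 ≤ m / (4 * R ^ 2) * R ^ 2 := by gcongr
        _ = m / 4 := by field_simp
    intro n
    induction n with
    | zero =>
      intro u h1 h2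
      have := hfar u (by simpa using h1)
      linarith [hquad u h2]
    | succ n ih =>
      intro u h1 h2
      have habs : |2 * u| = 2 * |u| := by rw [abs_mul, abs_two]
      have h4 := hD u
      rcases le_total (2 * |u|) R with h | h
      · have := ih (2 * u) (by rw [habs, ← mul_assoc, ← pow_succ]; exact h1) (by rwa [habs])
        have e : m / (4 * R ^ 2) * (2 * u) ^ 2 = 4 * (m / (4 * R ^ 2) * u ^ 2) := by ring
        linarith
      · have := hfar (2 * u) (by rwa [habs])
        linarith [hquad u h2]
  by_cases h0 : u = 0
  · simpa [h0] using hD0 0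
  · have hpos : 0 < |u| := abs_pos.2 h0
    obtain ⟨n, hn⟩ := pow_unbounded_of_one_lt (R / |u|) one_lt_two
    exact step n u ((div_lt_iff₀ hpos).1 hn).le hu

theorem sq_mul_exp_neg_le {a : ℝ} (ha : 0 < a) {z : ℝ} (hz : 0 ≤ z) :
    z ^ 2 * Real.exp (-(a * z)) ≤ 2 / a ^ 2 := by
  have h := Real.quadratic_le_exp_of_nonneg (mul_nonneg ha.le hz)
  have h2 : (a * z) ^ 2 / 2 ≤ Real.exp (a * z) := by nlinarith [mul_nonneg ha.le hz]
  rw [Real.exp_neg, ← div_eq_mul_inv, div_le_div_iff₀ (Real.exp_pos _) (by positivity)]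
  nlinarith

/-- If the characteristic function `L` of a finite measure of mass `m` decays quadratically, then
`e^{z (L(t/√z) - m)}`, stripped of its limit `e^{-zm}` at infinity, has `L¹` norm bounded uniformly
in `z ≥ 1`. -/
theorem exists_integral_exp_char_le (hW : Integrable W θ) (hY : Measurable Y)
    (hW0 : ∀ x, 0 ≤ W x) {C : ℝ} (hC : 0 ≤ C) (hm : 0 < ∫ x, W x ∂θ)
    (hL : ∀ u : ℝ, u ^ 2 *
      ‖∫ x, (W x : ℂ) * Complex.exp (Complex.I * (u * Y x : ℝ)) ∂θ‖ ≤ C) :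
    ∃ B, ∀ z : ℝ, 1 ≤ z →
      Integrable (fun t : ℝ => Complex.exp (z * ((∫ x, (W x : ℂ) *
          Complex.exp (Complex.I * ((t / √z) * Y x : ℝ)) ∂θ) - (∫ x, W x ∂θ : ℝ))) -
        Real.exp (-(z * ∫ x, W x ∂θ))) ∧
      ∫ t : ℝ, ‖Complex.exp (z * ((∫ x, (W x : ℂ) *
          Complex.exp (Complex.I * ((t / √z) * Y x : ℝ)) ∂θ) - (∫ x, W x ∂θ : ℝ))) -
        Real.exp (-(z * ∫ x, W x ∂θ))‖ ≤ B := by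
  set m := ∫ x, W x ∂θ
  set L : ℝ → ℂ := fun u => ∫ x, (W x : ℂ) * Complex.exp (Complex.I * (u * Y x : ℝ)) ∂θ
  have hLc : Continuous L := continuous_weighted_char hW hY
  set D : ℝ → ℝ := fun u => ∫ x, W x * (1 - Real.cos (u * Y x)) ∂θ
  have hDL : ∀ u, m - (L u).re = D u := integral_sub_re_char hW hY
  have hD0 : ∀ u, 0 ≤ D u := fun u => integral_nonneg fun x =>
    mul_nonneg (hW0 x) (by linarith [Real.cos_le_one (u * Y x)])
  set R := √(2 * C / m + 1)
  have hR2 : R ^ 2 = 2 * C / m + 1 := Real.sq_sqrt (by positivity)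
  have hR1 : 1 ≤ R := by
    rw [← Real.sqrt_one]
    exact Real.sqrt_le_sqrt (by have : 0 ≤ 2 * C / m := by positivity
                                linarith)
  have hR0 : 0 < R := by linarith
  -- beyond `R` the quadratic decay gives `|L| ≤ m/2`
  have hfarL : ∀ u, R ≤ |u| → ‖L u‖ ≤ m / 2 := fun u hu => by
    have h1 : R ^ 2 ≤ u ^ 2 := by rw [← sq_abs u]; gcongr
    have h2 : 0 < u ^ 2 := by nlinarith
    have h3 : 2 * C ≤ m * u ^ 2 := by
      have : 2 * C / m ≤ u ^ 2 := by linarith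
      rw [div_le_iff₀ hm] at this
      linarith
    have h4 := hL u
    by_contra hcon
    push Not at hcon
    nlinarith
  have hfar : ∀ u, R ≤ |u| → m / 2 ≤ D u := fun u hu => by
    have := Complex.re_le_norm (L u)
    linarith [hfarL u hu, hDL u]
  have hnear := quadratic_lower_bound_of_doubling hD0
    (fun u => gap_two_mul_le hW hY hW0 u) hR0 (half_pos hm).le hfar
  set k := m / 2 / (4 * R ^ 2)
  have hk : 0 < k := by positivity
  set bound : ℝ → ℝ := fun t => Real.exp (-k * t ^ 2) + Real.exp (-(m / R ^ 2) * t ^ 2) +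
    16 * C / m ^ 2 * (1 + t ^ 2)⁻¹
  have hbi : Integrable bound :=
    ((integrable_exp_neg_mul_sq hk).add (integrable_exp_neg_mul_sq (by positivity))).add
      (integrable_inv_one_add_sq.const_mul _)
  have hbd : ∀ z : ℝ, 1 ≤ z → ∀ t : ℝ,
      ‖Complex.exp (z * (L (t / √z) - (m : ℝ))) - Real.exp (-(z * m))‖ ≤ bound t := by
    intro z hz t
    have hz0 : 0 < z := by linarith
    set u := t / √z with hu
    have hut : z * u ^ 2 = t ^ 2 := by
      rw [hu, div_pow, Real.sq_sqrt hz0.le]; field_simp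
    -- near the origin both exponentials are Gaussian; far away their difference is of order `L`
    rcases le_or_gt |u| R with h | h
    · have h1 : ‖Complex.exp (z * (L u - (m : ℝ)))‖ ≤ Real.exp (-k * t ^ 2) := by
        rw [Complex.norm_exp]
        refine Real.exp_le_exp.2 ?_
        rw [Complex.re_ofReal_mul, Complex.sub_re, Complex.ofReal_re]
        have h2 := hnear u h
        have h3 := hDL u
        have h4 : z * (k * u ^ 2) ≤ z * (m - (L u).re) := by rw [h3]; gcongr
        have h5 : z * (k * u ^ 2) = k * t ^ 2 := by rw [← hut]; ring
        linarith
      have h2 : ‖((Real.exp (-(z * m)) : ℝ) : ℂ)‖ ≤ Real.exp (-(m / R ^ 2) * t ^ 2) := by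
        rw [Complex.norm_real, Real.norm_eq_abs, Real.abs_exp]
        refine Real.exp_le_exp.2 ?_
        have h3 : t ^ 2 ≤ z * R ^ 2 := by
          rw [← hut, ← sq_abs u]; gcongr
        have h4 : m / R ^ 2 * t ^ 2 ≤ m / R ^ 2 * (z * R ^ 2) := by gcongr
        have h5 : m / R ^ 2 * (z * R ^ 2) = z * m := by field_simp
        linarith
      have h3 : 0 ≤ 16 * C / m ^ 2 * (1 + t ^ 2)⁻¹ := by positivity
      refine (norm_sub_le _ _).trans ?_
      simp only [bound]
      linarith
    · have hLu := hfarL u h.le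
      have e : Complex.exp (z * (L u - (m : ℝ))) - Real.exp (-(z * m)) =
          Real.exp (-(z * m)) * (Complex.exp (z * L u) - 1) := by
        rw [mul_sub, Complex.ofReal_exp, mul_sub, ← Complex.exp_add, mul_one]
        congr 2
        push_cast; ring
      have h1 : ‖Complex.exp (z * L u) - 1‖ ≤ (z * ‖L u‖) * Real.exp (z * m / 2) := by
        have h := Complex.norm_exp_sub_sum_le_norm_mul_exp (z * L u) 1
        have hn : ‖(z : ℂ) * L u‖ = z * ‖L u‖ := by
          rw [norm_mul, Complex.norm_real, Real.norm_eq_abs, abs_of_pos hz0]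
        rw [hn] at h
        simp only [Finset.sum_range_one, pow_zero, Nat.factorial_zero, Nat.cast_one, div_one,
          pow_one] at h
        refine h.trans ?_
        gcongr
        rw [mul_div_assoc]
        gcongr
      have ht1 : 1 ≤ t ^ 2 := by
        rw [← hut, ← sq_abs u]
        have : 1 ≤ |u| ^ 2 := one_le_pow₀ (by linarith)
        nlinarith
      have h2 : z * ‖L u‖ ≤ z ^ 2 * C / t ^ 2 := by
        rw [le_div_iff₀ (by linarith), ← hut]
        have := hL u
        have h5 : z * ‖L u‖ * (z * u ^ 2) = z ^ 2 * (u ^ 2 * ‖L u‖) := by ring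
        rw [h5]
        gcongr
      have h3 := sq_mul_exp_neg_le (half_pos hm) hz0.le
      have h4 : (t ^ 2)⁻¹ ≤ 2 * (1 + t ^ 2)⁻¹ := by
        rw [← div_eq_mul_inv, inv_eq_one_div, div_le_div_iff₀ (by linarith) (by linarith)]
        linarith
      have h6 : ‖Complex.exp (z * (L u - (m : ℝ))) - Real.exp (-(z * m))‖ ≤
          16 * C / m ^ 2 * (1 + t ^ 2)⁻¹ := by
        rw [e, norm_mul, Complex.norm_real, Real.norm_eq_abs, Real.abs_exp]
        calc Real.exp (-(z * m)) * ‖Complex.exp (z * L u) - 1‖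
            ≤ Real.exp (-(z * m)) * ((z ^ 2 * C / t ^ 2) * Real.exp (z * m / 2)) := by
              gcongr
              exact h1.trans (by gcongr)
          _ = (z ^ 2 * (Real.exp (-(z * m)) * Real.exp (z * m / 2))) * C * (t ^ 2)⁻¹ := by
              ring
          _ = (z ^ 2 * Real.exp (-(m / 2 * z))) * C * (t ^ 2)⁻¹ := by
              rw [← Real.exp_add]
              congr 4
              ring
          _ ≤ (2 / (m / 2) ^ 2) * C * (2 * (1 + t ^ 2)⁻¹) := by gcongr
          _ = _ := by field_simp; ring
      have h7 := Real.exp_pos (-k * t ^ 2)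
      have h8 := Real.exp_pos (-(m / R ^ 2) * t ^ 2)
      simp only [bound]
      linarith
  refine ⟨∫ t, bound t, fun z hz => ?_⟩
  have hmeas : Continuous fun t : ℝ =>
      Complex.exp (z * (L (t / √z) - (m : ℝ))) - Real.exp (-(z * m)) := by fun_prop
  have hi := hbi.mono' hmeas.aestronglyMeasurable (Eventually.of_forall (hbd z hz))
  exact ⟨hi, integral_mono hi.norm hbi (hbd z hz)⟩

end Gap

/-! ### One-dimensional laws of the smeared Poisson noise -/

/-- A nonzero Schwartz function in positive dimension is not constant. -/
theorem exists_fderiv_ne_zero (hd : 1 ≤ d) {g : TestFun d} (hg : g ≠ 0) :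
    ∃ v y, fderiv ℝ g y v ≠ 0 := by
  by_contra! h
  have hz : ∀ y, fderiv ℝ g y = 0 := fun y => ContinuousLinearMap.ext fun v => h v y
  have hc : ∀ y, g y = g 0 := fun y => is_const_of_fderiv_eq_zero g.differentiable hz y 0
  have : Nonempty (Fin d) := ⟨⟨0, hd⟩⟩
  have : NoncompactSpace (Space d) := NormedSpace.noncompactSpace ℝ _
  have hi : Integrable (fun _ : Space d => g 0) :=
    (g.integrable (μ := volume)).congr (Eventually.of_forall hc)
  rw [integrable_const_iff] at hi
  rcases hi with h0 | h0
  · exact hg (SchwartzMap.ext fun y => by rw [hc, h0]; rfl)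
  · exact (measure_ne_top (volume : Measure (Space d)) univ)
      (measure_univ_of_isAddLeftInvariant _)

theorem integral_reflTranslate {E : Type*} [NormedAddCommGroup E] [NormedSpace ℝ E]
    (F : ℝ → E) (g : TestFun d) (x : Space d) :
    ∫ y, F (reflTranslate x g y) = ∫ y, F (g y) := by
  simp only [reflTranslate_apply]
  exact integral_sub_left_eq_self (fun y => F (g y)) volume x

/-- The one-point laws of `g * ω` do not depend on the point, by translation invariance. -/
theorem charFun_map_convFun {ψ : ℝ → ℂ} {P : Measure (Distr d)} (hP : IsNoiseLaw ψ P)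
    (g : TestFun d) (x : Space d) (t : ℝ) :
    charFun (P.map fun ω => convFun g ω x) t = Complex.exp (∫ y, ψ (t * g y)) := by
  have hm : Measurable fun ω : Distr d => convFun g ω x := (continuous_eval_distr _).measurable
  rw [charFun_apply_real, integral_map hm.aemeasurable (by fun_prop), ← integral_reflTranslate (fun a => ψ (t * a)) g x,
    ← integral_noise_exp_smul hP]
  refine integral_congr_ae (Eventually.of_forall fun ω => ?_)
  simp only [convFun]
  rw [mul_comm Complex.I]
  push_cast
  rfl

/-- The weight `κ min(s², 1) (∂_v g)^4(y)`, which selects a part of finite total mass of the jumps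
`s g(y)` of the smeared field. The factor `(∂_v g)^4` makes its characteristic function decay, and
`min(s², 1)` makes this decay uniform in the charge `s`. -/
def jumpWeight (g : TestFun d) (v : Space d) (κ : ℝ) (p : ℝ × Space d) : ℝ :=
  (κ * min (p.1 ^ 2) 1) * (fderiv ℝ g p.2 v) ^ 4

section

variable (g : TestFun d) (v : Space d)

open scoped LineDeriv in
theorem integrable_fderiv_pow_four : Integrable fun y => (fderiv ℝ g y v) ^ 4 := by
  have e : ∀ y, fderiv ℝ g y v = (∂_{v} g : TestFun d) y :=
    fun y => (lineDerivOp_apply_eq_fderiv v g y).symm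
  set h : TestFun d := ∂_{v} g
  refine (integrable_mul_testFun (integrable_mul_testFun (integrable_mul_testFun
    h.integrable h) h) h).congr (Eventually.of_forall fun y => ?_)
  simp only [e]
  ring

theorem continuous_fderiv_apply : Continuous fun y => fderiv ℝ g y v :=
  ((g.smooth 1).continuous_fderiv (by simp)).clm_apply continuous_const

theorem measurable_jumpWeight (κ : ℝ) : Measurable (jumpWeight g v κ) := by
  have := (continuous_fderiv_apply g v).measurable
  unfold jumpWeight
  fun_prop

theorem jumpWeight_nonneg {κ : ℝ} (hκ : 0 ≤ κ) (p : ℝ × Space d) : 0 ≤ jumpWeight g v κ p := by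
  unfold jumpWeight
  have : 0 ≤ min (p.1 ^ 2) 1 := le_min (sq_nonneg _) zero_le_one
  positivity

theorem norm_min_sq_le (κ s : ℝ) (hκ : 0 ≤ κ) : ‖κ * min (s ^ 2) 1‖ ≤ κ := by
  have : 0 ≤ min (s ^ 2) 1 := le_min (sq_nonneg _) zero_le_one
  rw [Real.norm_eq_abs, abs_of_nonneg (mul_nonneg hκ this)]
  exact mul_le_of_le_one_right hκ (min_le_right _ _)

variable (r : Measure ℝ) [IsProbabilityMeasure r]

theorem integrable_min_sq {κ : ℝ} (hκ : 0 ≤ κ) :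
    Integrable (fun s : ℝ => κ * min (s ^ 2) 1) r :=
  Integrable.of_bound (by fun_prop) κ (Eventually.of_forall fun s => norm_min_sq_le κ s hκ)

theorem integrable_jumpWeight {κ : ℝ} (hκ : 0 ≤ κ) :
    Integrable (jumpWeight g v κ) (r.prod volume) :=
  (integrable_min_sq r hκ).mul_prod (integrable_fderiv_pow_four g v)

theorem integral_jumpWeight_pos {κ : ℝ} (hκ : 0 < κ) (hr_zero : r {0} = 0) {y : Space d}
    (hy : fderiv ℝ g y v ≠ 0) : 0 < ∫ p, jumpWeight g v κ p ∂(r.prod volume) := by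
  unfold jumpWeight
  rw [integral_prod_mul (fun s : ℝ => κ * min (s ^ 2) 1) fun y => (fderiv ℝ g y v) ^ 4]
  refine mul_pos ?_ ?_
  · rw [integral_pos_iff_support_of_nonneg (fun s => ?_) (integrable_min_sq r hκ.le)]
    · have : (Function.support fun s : ℝ => κ * min (s ^ 2) 1) = {0}ᶜ := by
        ext s
        simp only [Function.mem_support, mem_compl_iff, mem_singleton_iff, ne_eq, not_iff_not]
        constructor
        · intro h
          by_contra hs
          have : 0 < min (s ^ 2) 1 := lt_min (by positivity) one_pos
          exact (mul_pos hκ this).ne' h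
        · rintro rfl; simp
      rw [this, (prob_compl_eq_one_iff (measurableSet_singleton 0)).2 hr_zero]
      exact one_pos
    · have : 0 ≤ min (s ^ 2) 1 := le_min (sq_nonneg _) zero_le_one
      simp only [Pi.zero_apply]
      positivity
  · rw [integral_pos_iff_support_of_nonneg (fun y => by simp only [Pi.zero_apply]; positivity)
      (integrable_fderiv_pow_four g v)]
    have hc : Continuous fun y => (fderiv ℝ g y v) ^ 4 := (continuous_fderiv_apply g v).pow 4
    exact hc.isOpen_support.measure_pos _ ⟨y, by simpa using hy⟩

/-- Quadratic decay of the characteristic function of the selected jumps: for a fixed charge `s` the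
oscillatory integral has frequency `us`, and the weight `s²` compensates its bound `C/(us)²`. -/
theorem exists_jumpWeight_char_bound {κ : ℝ} (hκ : 0 ≤ κ) :
    ∃ C, 0 ≤ C ∧ ∀ u : ℝ, u ^ 2 * ‖∫ p, (jumpWeight g v κ p : ℂ) *
      Complex.exp (Complex.I * (u * (p.1 * g p.2) : ℝ)) ∂(r.prod volume)‖ ≤ C := by
  obtain ⟨C, hC, hbd⟩ := exists_oscillatory_bound g v
  refine ⟨κ * C, by positivity, fun u => ?_⟩
  have hgm : Measurable fun p : ℝ × Space d => p.1 * g p.2 :=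
    measurable_fst.mul (g.continuous.measurable.comp measurable_snd)
  rw [integral_prod _ (integrable_weight_mul_exp (integrable_jumpWeight g v r hκ) hgm u)]
  have e : ∀ s : ℝ, ∫ y, (jumpWeight g v κ (s, y) : ℂ) *
      Complex.exp (Complex.I * (u * (s * g y) : ℝ)) = ((κ * min (s ^ 2) 1 : ℝ) : ℂ) *
        ∫ y, (((fderiv ℝ g y v) ^ 4 : ℝ) : ℂ) * Complex.exp (Complex.I * ((u * s) * g y : ℝ)) := by
    intro s
    rw [← integral_const_mul]
    refine integral_congr_ae (Eventually.of_forall fun y => ?_)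
    simp only [jumpWeight]
    rw [← mul_assoc u]
    push_cast
    ring
  simp only [e]
  have hu : u ^ 2 = ‖((u ^ 2 : ℝ) : ℂ)‖ := by
    rw [Complex.norm_real, Real.norm_eq_abs, abs_of_nonneg (sq_nonneg u)]
  rw [hu, ← norm_mul, ← integral_const_mul]
  refine (norm_integral_le_of_norm_le_const (C := κ * C) (Eventually.of_forall fun s => ?_)).trans
    (by simp)
  have h0 : 0 ≤ min (s ^ 2) 1 := le_min (sq_nonneg _) zero_le_one
  rw [norm_mul, norm_mul, ← hu, Complex.norm_real, Real.norm_eq_abs,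
    abs_of_nonneg (mul_nonneg hκ h0)]
  set J := ‖∫ y, (((fderiv ℝ g y v) ^ 4 : ℝ) : ℂ) *
    Complex.exp (Complex.I * ((u * s) * g y : ℝ))‖
  have hJ : (u * s) ^ 2 * J ≤ C := hbd (u * s)
  calc u ^ 2 * (κ * min (s ^ 2) 1 * J) ≤ u ^ 2 * (κ * s ^ 2 * J) := by
        gcongr
        exact min_le_left _ _
    _ = κ * ((u * s) ^ 2 * J) := by ring
    _ ≤ κ * C := by gcongr

end

theorem integrable_exp_sub_one_prod {c : ℝ} {r : Measure ℝ} [IsProbabilityMeasure r]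
    (hr : r (Icc (-c) c)ᶜ = 0) (g : TestFun d) (u : ℝ) :
    Integrable (fun p : ℝ × Space d => Complex.exp (Complex.I * (u * (p.1 * g p.2) : ℝ)) - 1)
      (r.prod volume) := by
  have hgm : Measurable fun p : ℝ × Space d => p.1 * g p.2 :=
    measurable_fst.mul (g.continuous.measurable.comp measurable_snd)
  have hs : Integrable (fun s : ℝ => s) r := by simpa using integrable_pow_charge hr 1
  have hi : Integrable (fun p : ℝ × Space d => p.1 * g p.2) (r.prod volume) :=
    hs.mul_prod g.integrable
  refine (hi.const_mul u).norm.mono' (by fun_prop) (Eventually.of_forall fun p => ?_)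
  exact Real.norm_exp_I_mul_ofReal_sub_one_le

/-- The exponent of the smeared Poisson noise as an integral over charges and positions jointly. -/
theorem integral_poissonChar_eq {c : ℝ} {r : Measure ℝ} [IsProbabilityMeasure r]
    (hr : r (Icc (-c) c)ᶜ = 0) (g : TestFun d) (z t : ℝ) :
    ∫ y, poissonChar z (scaledCharges r z) (t * g y) =
      z * ∫ p : ℝ × Space d, (Complex.exp (Complex.I * ((t / √z) * (p.1 * g p.2) : ℝ)) - 1)
        ∂(r.prod volume) := by
  rw [integral_prod_symm _ (integrable_exp_sub_one_prod hr g _), ← integral_const_mul]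
  refine integral_congr_ae (Eventually.of_forall fun y => ?_)
  simp only [poissonChar_scaledCharges]
  congr 2
  ext s
  congr 4
  ring

/-- The law of the smeared Poisson noise at a point is the sum of a part with bounded density,
uniformly in the activity `z ≥ 1`, and of a part of exponentially small mass. -/
theorem exists_density_bound (hd : 1 ≤ d) {c : ℝ} {r : Measure ℝ} [IsProbabilityMeasure r]
    (hr : r (Icc (-c) c)ᶜ = 0) (hr_zero : r {0} = 0) {g : TestFun d} (hg : g ≠ 0) :
    ∃ B m : ℝ, 0 < m ∧ ∀ z : ℝ, 1 ≤ z → ∀ P : Measure (Distr d),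
      IsNoiseLaw (poissonChar z (scaledCharges r z)) P → ∀ (x : Space d) (A : Set ℝ),
      MeasurableSet A → P {ω | convFun g ω x ∈ A} ≤
        ENNReal.ofReal B * volume A + ENNReal.ofReal (Real.exp (-(z * m))) := by
  obtain ⟨v, y₀, hy₀⟩ := exists_fderiv_ne_zero hd hg
  set H := SchwartzMap.seminorm ℝ 0 1 g * ‖v‖
  have hH0 : 0 ≤ H := by positivity
  have hH : ∀ y, |fderiv ℝ g y v| ≤ H := fun y => by
    refine ((fderiv ℝ g y).le_opNorm v).trans ?_
    refine mul_le_mul_of_nonneg_right ?_ (norm_nonneg v)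
    have := g.norm_iteratedFDeriv_le_seminorm ℝ 1 y
    rwa [norm_iteratedFDeriv_one] at this
  -- this normalization gives `W ≤ 1`, so that the remaining intensity `1 - W` is nonnegative
  set κ : ℝ := 1 / (H ^ 4 + 1)
  have hκ : 0 < κ := by positivity
  set W := jumpWeight g v κ
  set θ : Measure (ℝ × Space d) := r.prod volume
  have hW0 : ∀ p, 0 ≤ W p := jumpWeight_nonneg g v hκ.le
  have hW1 : ∀ p, W p ≤ 1 := fun p => by
    have h1 : (fderiv ℝ g p.2 v) ^ 4 ≤ H ^ 4 := by
      rw [← Even.pow_abs (by decide : Even 4)]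
      exact pow_le_pow_left₀ (abs_nonneg _) (hH _) 4
    calc W p ≤ (κ * 1) * H ^ 4 := by
          simp only [W, jumpWeight]
          gcongr
          exact min_le_right _ _
      _ ≤ 1 := by
          rw [mul_one, show κ * H ^ 4 = H ^ 4 / (H ^ 4 + 1) from one_div_mul_eq_div _ _,
            div_le_one (by positivity)]
          linarith
  have hWi : Integrable W θ := integrable_jumpWeight g v r hκ.le
  have hgm : Measurable fun p : ℝ × Space d => p.1 * g p.2 :=
    measurable_fst.mul (g.continuous.measurable.comp measurable_snd)
  have hm : 0 < ∫ p, W p ∂θ := integral_jumpWeight_pos g v r hκ hr_zero hy₀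
  obtain ⟨C, hC, hL⟩ := exists_jumpWeight_char_bound g v r hκ.le
  obtain ⟨B, hB⟩ := exists_integral_exp_char_le hWi hgm hW0 hC hm hL
  set m := ∫ p, W p ∂θ
  refine ⟨B, m, hm, fun z hz P hP x A hA => ?_⟩
  have hz0 : 0 < z := by linarith
  have := hP.isProbabilityMeasure
  obtain ⟨hgood, hgoodB⟩ := hB z hz
  have hXm : Measurable fun ω : Distr d => convFun g ω x := (continuous_eval_distr _).measurable
  set w : ℝ × Space d → ℝ := fun p => z * (1 - W p)
  have hw0 : ∀ p, 0 ≤ w p := fun p => mul_nonneg hz0.le (by linarith [hW1 p])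
  have hWm : Measurable W := measurable_jumpWeight g v κ
  have hwm : Measurable w := by fun_prop
  have harg : ∀ (t : ℝ) (p : ℝ × Space d), t * (p.1 * g p.2 / √z) = t / √z * (p.1 * g p.2) :=
    fun t p => by ring
  have hwi : ∀ t : ℝ, Integrable (fun p => (w p : ℂ) *
      (Complex.exp (Complex.I * (t * (p.1 * g p.2 / √z) : ℝ)) - 1)) θ := fun t => by
    simp only [harg]
    refine (integrable_exp_sub_one_prod hr g (t / √z)).bdd_mul (c := z)
      (by fun_prop) (Eventually.of_forall fun p => ?_)
    rw [Complex.norm_real, Real.norm_eq_abs, abs_of_nonneg (hw0 p)]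
    exact mul_le_of_le_one_right hz0.le (by linarith [hW0 p])
  -- the jumps that are not selected contribute a limit of characteristic functions
  obtain ⟨p, hp, hpR⟩ := exists_tendsto_charFun_exp (θ := θ)
    (Y := fun p : ℝ × Space d => p.1 * g p.2 / √z) (by fun_prop) hwm hw0 hwi
  have hprob : IsProbabilityMeasure (P.map fun ω => convFun g ω x) :=
    Measure.isProbabilityMeasure_map hXm.aemeasurable
  have key := measure_le_of_charFun_eq (μ := P.map fun ω => convFun g ω x)
    (a := Real.exp (-(z * m))) (Real.exp_pos _).le hp hpR hgood hgoodB (fun t => ?_) hA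
  · rwa [Measure.map_apply hXm hA] at key
  rw [charFun_map_convFun hP, integral_poissonChar_eq hr]
  simp only [harg]
  rw [sub_add_cancel, ← Complex.exp_add]
  congr 1
  set E : ℝ × Space d → ℂ := fun p => Complex.exp (Complex.I * ((t / √z) * (p.1 * g p.2) : ℝ))
  have i1 : Integrable (fun p => E p - 1) θ := integrable_exp_sub_one_prod hr g _
  have i2 : Integrable (fun p => (W p : ℂ) * E p) θ := integrable_weight_mul_exp hWi hgm _
  have i3 : Integrable (fun p => (W p : ℂ)) θ := hWi.ofReal
  have hmC : ((m : ℝ) : ℂ) = ∫ p, (W p : ℂ) ∂θ := integral_complex_ofReal.symm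
  rw [hmC, ← integral_sub i2 i3, ← integral_const_mul, ← integral_const_mul, ← integral_add]
  · refine integral_congr_ae (Eventually.of_forall fun p => ?_)
    simp only [w, E]
    push_cast
    ring
  · exact (i2.sub i3).const_mul _
  · have := hwi t
    simpa only [harg] using this

/-! ### Approximation of the potential by cylinder functionals -/

/-- The law `P` of a random distribution is a probability measure whose second moments are dominated
by those of a white noise of variance `K`. -/
structure HasWhiteNoiseBound (K : ℝ) (P : Measure (Distr d)) : Prop where
  isProbabilityMeasure : IsProbabilityMeasure P
  lintegral_sq_le : ∀ f : TestFun d,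
    ∫⁻ ω, ENNReal.ofReal ((ω f) ^ 2) ∂P ≤ ENNReal.ofReal (K * ∫ x, f x ^ 2)

section

variable {K : ℝ} {P : Measure (Distr d)}

theorem HasWhiteNoiseBound.integrable_sq (h : HasWhiteNoiseBound K P) (f : TestFun d) :
    Integrable (fun ω => (ω f) ^ 2) P := by
  refine ⟨((continuous_eval_distr f).pow 2).aestronglyMeasurable, ?_⟩
  rw [hasFiniteIntegral_iff_ofReal (Eventually.of_forall fun ω => sq_nonneg _)]
  exact (h.lintegral_sq_le f).trans_lt ENNReal.ofReal_lt_top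

theorem integral_sq_testFun_nonneg (f : TestFun d) : 0 ≤ ∫ x, f x ^ 2 :=
  integral_nonneg fun _ => sq_nonneg _

theorem HasWhiteNoiseBound.integral_sq_le (h : HasWhiteNoiseBound K P) (hK : 0 ≤ K)
    (f : TestFun d) : ∫ ω, (ω f) ^ 2 ∂P ≤ K * ∫ x, f x ^ 2 := by
  rw [← ENNReal.ofReal_le_ofReal_iff (mul_nonneg hK (integral_sq_testFun_nonneg f)),
    ofReal_integral_eq_lintegral_ofReal (h.integrable_sq f)
      (Eventually.of_forall fun ω => sq_nonneg _)]
  exact h.lintegral_sq_le f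

theorem integral_sq_reflTranslate (g : TestFun d) (x : Space d) :
    ∫ y, (reflTranslate x g y) ^ 2 = ∫ y, g y ^ 2 :=
  integral_reflTranslate (fun a => a ^ 2) g x

theorem HasWhiteNoiseBound.integral_sq_convFun_le (h : HasWhiteNoiseBound K P) (hK : 0 ≤ K)
    (g : TestFun d) (x : Space d) : ∫ ω, (convFun g ω x) ^ 2 ∂P ≤ K * ∫ y, g y ^ 2 := by
  rw [← integral_sq_reflTranslate g x]
  exact h.integral_sq_le hK _

theorem HasWhiteNoiseBound.lintegral_enorm_convFun_le (h : HasWhiteNoiseBound K P) (hK : 0 ≤ K)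
    (g : TestFun d) (x : Space d) :
    ∫⁻ ω, ‖convFun g ω x‖ₑ ∂P ≤ ENNReal.ofReal (1 + K * ∫ y, g y ^ 2) := by
  have := h.isProbabilityMeasure
  have hle : ∀ ω : Distr d, ‖convFun g ω x‖ₑ ≤ 1 + ENNReal.ofReal ((convFun g ω x) ^ 2) := by
    intro ω
    rw [← ENNReal.ofReal_one, ← ENNReal.ofReal_add zero_le_one (sq_nonneg _), ← ofReal_norm]
    refine ENNReal.ofReal_le_ofReal ?_
    rw [Real.norm_eq_abs, ← sq_abs]
    nlinarith [sq_nonneg (|convFun g ω x| - 1), abs_nonneg (convFun g ω x)]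
  refine (lintegral_mono hle).trans ?_
  rw [lintegral_add_left measurable_const, lintegral_const, measure_univ, mul_one,
    ENNReal.ofReal_add zero_le_one (mul_nonneg hK (integral_sq_testFun_nonneg g)),
    ENNReal.ofReal_one]
  gcongr
  rw [← integral_sq_reflTranslate g x]
  exact h.lintegral_sq_le _

/-- Chebyshev's inequality for the smeared field at a point. -/
theorem HasWhiteNoiseBound.measureReal_lt_abs_le (h : HasWhiteNoiseBound K P) (hK : 0 ≤ K)
    (g : TestFun d) (x : Space d) {L : ℝ} (hL : 0 < L) :
    P.real {ω | L < |convFun g ω x|} ≤ K * (∫ y, g y ^ 2) / L ^ 2 := by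
  have := h.isProbabilityMeasure
  rw [le_div_iff₀ (by positivity), mul_comm]
  have hM := mul_meas_ge_le_integral_of_nonneg (μ := P)
    (Eventually.of_forall fun ω => sq_nonneg (convFun g ω x)) (h.integrable_sq _) (L ^ 2)
  refine le_trans ?_ (hM.trans (h.integral_sq_convFun_le hK g x))
  refine mul_le_mul_of_nonneg_left (measureReal_mono fun ω hω => ?_) (by positivity)
  simp only [mem_ofPred_eq] at hω ⊢
  rw [← sq_abs (convFun g ω x)]
  exact pow_le_pow_left₀ hL.le (le_of_lt hω) 2

theorem measurable_convFun_apply (g : TestFun d) (x : Space d) :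
    Measurable fun ω : Distr d => convFun g ω x := (continuous_eval_distr _).measurable

/-- Translation is Hölder continuous of order `1/2` in `L²`: one factor of the square is bounded by
the Lipschitz estimate, the other one in `L¹`. -/
theorem integral_sq_sub_reflTranslate_le (g : TestFun d) :
    ∃ C, 0 ≤ C ∧ ∀ x y : Space d,
      ∫ u, ((reflTranslate x g - reflTranslate y g) u) ^ 2 ≤ C * dist x y := by
  obtain ⟨D, hD⟩ : ∃ D : NNReal, LipschitzWith D g := by
    refine ⟨⟨SchwartzMap.seminorm ℝ 0 1 g, apply_nonneg _ _⟩,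
      lipschitzWith_of_nnnorm_fderiv_le g.differentiable fun y => ?_⟩
    have := g.norm_iteratedFDeriv_le_seminorm ℝ 1 y
    rwa [norm_iteratedFDeriv_one] at this
  have hn : 0 ≤ ∫ y, |g y| := integral_nonneg fun y => abs_nonneg _
  refine ⟨D * (2 * ∫ y, |g y|), by positivity, fun x y => ?_⟩
  have hi : ∀ z : Space d, Integrable fun u => |reflTranslate z g u| :=
    fun z => (reflTranslate z g).integrable.abs
  calc ∫ u, ((reflTranslate x g - reflTranslate y g) u) ^ 2
      ≤ ∫ u, (D * dist x y) * (|reflTranslate x g u| + |reflTranslate y g u|) := by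
        refine integral_mono (integrable_sq_testFun _)
          (((hi x).add (hi y)).const_mul _) fun u => ?_
        simp only [sub_apply]
        have h1 : |reflTranslate x g u - reflTranslate y g u| ≤ D * dist x y := by
          simp only [reflTranslate_apply]
          simpa [Real.dist_eq] using hD.dist_le_mul (x - u) (y - u)
        rw [← sq_abs, sq]
        exact mul_le_mul h1 (abs_sub _ _) (abs_nonneg _) (by positivity)
    _ = D * (2 * ∫ y, |g y|) * dist x y := by
        rw [integral_const_mul, integral_add (hi x) (hi y),
          integral_reflTranslate (fun a => |a|), integral_reflTranslate (fun a => |a|)]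
        ring

end

section

variable {Λ : Set (Space d)}

theorem integral_abs_setIntegral_le {P : Measure (Distr d)} [IsProbabilityMeasure P]
    (hΛ : IsCompact Λ) {u : Distr d → Space d → ℝ}
    (hu : Measurable fun p : Distr d × Space d => u p.1 p.2) {b M : ℝ}
    (hub : ∀ ω x, |u ω x| ≤ b) (hM : ∀ x ∈ Λ, ∫ ω, |u ω x| ∂P ≤ M) :
    ∫ ω, |∫ x in Λ, u ω x| ∂P ≤ M * volume.real Λ := by
  have hfin : volume Λ < ⊤ := hΛ.measure_lt_top
  have : IsFiniteMeasure (volume.restrict Λ) := ⟨by simpa using hfin⟩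
  have hi : Integrable (Function.uncurry fun ω x => |u ω x|) (P.prod (volume.restrict Λ)) :=
    Integrable.of_bound hu.abs.aestronglyMeasurable b
      (Eventually.of_forall fun p => by simpa [Function.uncurry] using hub p.1 p.2)
  have hi2 : Integrable (Function.uncurry fun ω x => u ω x) (P.prod (volume.restrict Λ)) :=
    Integrable.of_bound hu.aestronglyMeasurable b
      (Eventually.of_forall fun p => by simpa [Function.uncurry] using hub p.1 p.2)
  calc ∫ ω, |∫ x in Λ, u ω x| ∂P ≤ ∫ ω, (∫ x in Λ, |u ω x|) ∂P :=
        integral_mono hi2.integral_prod_left.abs hi.integral_prod_left fun ω =>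
          abs_integral_le_integral_abs
    _ = ∫ x in Λ, (∫ ω, |u ω x| ∂P) := integral_integral_swap hi
    _ ≤ ∫ x in Λ, M := by
        refine setIntegral_mono_on hi.integral_prod_right (integrable_const M)
          hΛ.measurableSet hM
    _ = M * volume.real Λ := by simp [mul_comm]

theorem abs_setIntegral_le {u : Space d → ℝ} {a : ℝ} (hΛ : IsCompact Λ) (hu : ∀ x, |u x| ≤ a) :
    |∫ x in Λ, u x| ≤ a * volume.real Λ := by
  rw [← Real.norm_eq_abs]
  exact norm_setIntegral_le_of_norm_le_const hΛ.measure_lt_top fun x _ => hu x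

/-- Discretization of a compact set: nearest points in a finite `ρ`-net. -/
theorem exists_simpleFunc_dist_le (hΛ : IsCompact Λ) {ρ : ℝ} (hρ : 0 < ρ) :
    ∃ π : SimpleFunc (Space d) (Space d), ∀ x ∈ Λ, dist (π x) x ≤ ρ := by
  obtain ⟨t, ht⟩ := hΛ.elim_finite_subcover
    (fun k : ℕ => Metric.ball (TopologicalSpace.denseSeq (Space d) k) ρ)
    (fun k => Metric.isOpen_ball) fun x _ => by
      obtain ⟨k, hk⟩ := (TopologicalSpace.denseRange_denseSeq (Space d)).exists_dist_lt x hρ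
      exact mem_iUnion.2 ⟨k, hk⟩
  refine ⟨SimpleFunc.nearestPt (TopologicalSpace.denseSeq (Space d)) (t.sup id), fun x hx => ?_⟩
  obtain ⟨k, hk, hxk⟩ := mem_iUnion₂.1 (ht hx)
  have h1 := SimpleFunc.edist_nearestPt_le (TopologicalSpace.denseSeq (Space d)) x
    (Finset.le_sup (f := id) hk)
  rw [edist_dist, edist_dist, id, ENNReal.ofReal_le_ofReal_iff dist_nonneg] at h1
  rw [Metric.mem_ball, dist_comm] at hxk
  exact h1.trans hxk.le

/-- A bounded uniformly continuous function has a quadratic modulus of continuity up to `η`, so that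
its increments along the field are controlled by second moments. -/
theorem exists_abs_sub_le_of_uniformContinuous {v : ℝ → ℝ} (hv : UniformContinuous v) {a : ℝ}
    (ha : 0 ≤ a) (hva : ∀ t, |v t| ≤ a) {η : ℝ} (hη : 0 < η) :
    ∃ D, 0 ≤ D ∧ ∀ t s, |v t - v s| ≤ η + D * (t - s) ^ 2 := by
  obtain ⟨δ, hδ, h⟩ := Metric.uniformContinuous_iff.1 hv η hη
  refine ⟨2 * a / δ ^ 2, by positivity, fun t s => ?_⟩
  rcases lt_or_ge |t - s| δ with hts | hts
  · have h1 : |v t - v s| < η := h (by rwa [Real.dist_eq])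
    have : 0 ≤ 2 * a / δ ^ 2 * (t - s) ^ 2 := by positivity
    linarith
  · have h1 : |v t - v s| ≤ 2 * a := (abs_sub _ _).trans (by linarith [hva t, hva s])
    have h2 : δ ^ 2 ≤ (t - s) ^ 2 := by
      rw [← sq_abs (t - s)]
      exact pow_le_pow_left₀ hδ.le hts 2
    have h3 : 2 * a ≤ 2 * a / δ ^ 2 * (t - s) ^ 2 := by
      rw [div_mul_eq_mul_div, le_div_iff₀ (by positivity)]
      gcongr
    linarith

/-- For a uniformly continuous energy density, the potential is approximated in mean by Riemann
sums, uniformly over all noises with bounded variance. -/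
theorem exists_isCylinder_potential_of_uniformContinuous (g : TestFun d) (hΛ : IsCompact Λ)
    {v : ℝ → ℝ} (hv : UniformContinuous v) {a : ℝ} (ha : 0 ≤ a) (hva : ∀ t, |v t| ≤ a)
    {K : ℝ} (hK : 0 ≤ K) {η : ℝ} (hη : 0 < η) :
    ∃ F : Distr d → ℝ, IsCylinder F ∧ (∀ ω, |F ω| ≤ a * volume.real Λ) ∧
      ∀ P, HasWhiteNoiseBound K P → ∫ ω, |potential v Λ (convFun g ω) - F ω| ∂P ≤ η := by
  set vol := volume.real Λ
  have hvol : 0 ≤ vol := measureReal_nonneg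
  obtain ⟨D, hD, hvD⟩ := exists_abs_sub_le_of_uniformContinuous hv ha hva
    (η := η / (2 * (vol + 1))) (by positivity)
  obtain ⟨C, hC, hgC⟩ := integral_sq_sub_reflTranslate_le g
  -- mesh size for which the quadratic term is at most `η / (2 (vol + 1))`
  set ρ := η / (2 * (vol + 1)) / (D * K * C + 1)
  have hρ : 0 < ρ := by positivity
  obtain ⟨π, hπ⟩ := exists_simpleFunc_dist_le hΛ hρ
  have hvm : Measurable v := hv.continuous.measurable
  refine ⟨fun ω => ∫ x in Λ, v (convFun g ω (π x)), ?_, fun ω => abs_setIntegral_le hΛ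
    fun x => hva _, fun P hP => ?_⟩
  -- only the finitely many values of the field at the points of `π.range` enter the Riemann sum
  · let k : Space d → π.range := fun x => ⟨π x, π.mem_range_self x⟩
    have hk : Measurable k := π.measurable.subtype_mk
    refine ⟨π.range, inferInstance, fun i => reflTranslate i g,
      fun b => ∫ x in Λ, v (b (k x)), ?_, fun ω => rfl⟩
    have : IsFiniteMeasure (volume.restrict Λ) := ⟨by simpa using hΛ.measure_lt_top⟩
    refine continuous_of_dominated (bound := fun _ => a) (fun b => ?_)
      (fun b => Eventually.of_forall fun x => hva _) (integrable_const a)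
      (Eventually.of_forall fun x => ?_)
    · exact (hvm.comp ((measurable_of_finite b).comp hk)).aestronglyMeasurable
    · exact hv.continuous.comp (continuous_apply _)
  · have := hP.isProbabilityMeasure
    have : IsFiniteMeasure (volume.restrict Λ) := ⟨by simpa using hΛ.measure_lt_top⟩
    have hu1 : Measurable fun p : Distr d × Space d => v (convFun g p.1 p.2) :=
      hvm.comp (measurable_uncurry_convFun g)
    have hu2 : Measurable fun p : Distr d × Space d => v (convFun g p.1 (π p.2)) :=
      hvm.comp ((measurable_uncurry_convFun g).comp
        (measurable_fst.prodMk (π.measurable.comp measurable_snd)))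
    have hi : ∀ w : Space d → ℝ, Measurable w → (∀ x, |w x| ≤ a) →
        Integrable w (volume.restrict Λ) := fun w hw hwa =>
      Integrable.of_bound hw.aestronglyMeasurable a (Eventually.of_forall hwa)
    have e : ∀ ω, potential v Λ (convFun g ω) - ∫ x in Λ, v (convFun g ω (π x)) =
        ∫ x in Λ, (v (convFun g ω x) - v (convFun g ω (π x))) := fun ω =>
      (integral_sub (hi _ (hu1.comp measurable_prodMk_left) fun x => hva _)
        (hi _ (hu2.comp measurable_prodMk_left) fun x => hva _)).symm
    simp only [e]
    have hbound := integral_abs_setIntegral_le (P := P) hΛ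
      (u := fun ω x => v (convFun g ω x) - v (convFun g ω (π x))) (hu1.sub hu2) (b := 2 * a)
      (M := η / (vol + 1)) (fun ω x => (abs_sub _ _).trans (by
        linarith [hva (convFun g ω x), hva (convFun g ω (π x))])) fun x hx => ?_
    · refine hbound.trans ?_
      rw [div_mul_eq_mul_div, div_le_iff₀ (by positivity)]
      gcongr
      exact le_add_of_nonneg_right zero_le_one
    · set f : TestFun d := reflTranslate x g - reflTranslate (π x) g
      have hf : ∀ ω : Distr d, convFun g ω x - convFun g ω (π x) = ω f := fun ω =>
        (map_sub ω _ _).symm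
      have hfi : ∫ y, f y ^ 2 ≤ C * ρ :=
        (hgC _ _).trans (mul_le_mul_of_nonneg_left (by rw [dist_comm]; exact hπ x hx) hC)
      calc ∫ ω, |v (convFun g ω x) - v (convFun g ω (π x))| ∂P
          ≤ ∫ ω, (η / (2 * (vol + 1)) + D * (ω f) ^ 2) ∂P := by
            refine integral_mono_of_nonneg (Eventually.of_forall fun ω => abs_nonneg _)
              ((integrable_const _).add ((hP.integrable_sq f).const_mul D))
              (Eventually.of_forall fun ω => ?_)
            simp only [← hf]
            exact hvD _ _
        _ = η / (2 * (vol + 1)) + D * ∫ ω, (ω f) ^ 2 ∂P := by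
            rw [integral_add (integrable_const _) ((hP.integrable_sq f).const_mul D),
              integral_const_mul]
            simp
        _ ≤ η / (2 * (vol + 1)) + D * (K * (C * ρ)) := by
            have := (hP.integral_sq_le hK f).trans (mul_le_mul_of_nonneg_left hfi hK)
            gcongr
        _ ≤ η / (2 * (vol + 1)) + η / (2 * (vol + 1)) := by
            gcongr
            have h1 : (D * K * C + 1) * ρ = η / (2 * (vol + 1)) := by
              simp only [ρ]; field_simp
            nlinarith
        _ = η / (vol + 1) := by field_simp; ring

/-- A bounded measurable function is within `η` of a uniformly continuous one with the same bound, on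
`[-L, L]` up to a set of small Lebesgue measure. -/
theorem exists_uniformContinuous_approx {v : ℝ → ℝ} (hv : Measurable v) {a : ℝ} (ha : 0 ≤ a)
    (hva : ∀ t, |v t| ≤ a) (L : ℝ) {η κ : ℝ} (hη : 0 < η) (hκ : 0 < κ) :
    ∃ w : ℝ → ℝ, UniformContinuous w ∧ (∀ t, |w t| ≤ a) ∧
      volume {t | |t| ≤ L ∧ η ≤ |v t - w t|} ≤ ENNReal.ofReal κ := by
  have hi : Integrable ((Icc (-L) L).indicator v) := by
    rw [integrable_indicator_iff measurableSet_Icc]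
    exact IntegrableOn.of_bound (by simp) hv.aestronglyMeasurable a
      (Eventually.of_forall hva)
  obtain ⟨w, hws, hw, hwc, hwi⟩ := hi.exists_hasCompactSupport_integral_sub_le
    (ε := η * κ) (by positivity)
  refine ⟨fun t => clamp a (w t), ?_, fun t => abs_clamp_le ha _, ?_⟩
  · have hu : UniformContinuous w := hwc.uniformContinuous_of_tendsto_cocompact hws.is_zero_at_infty
    rw [Metric.uniformContinuous_iff] at hu ⊢
    intro e he
    obtain ⟨δ, hδ, h⟩ := hu e he
    exact ⟨δ, hδ, fun _ _ hts => (abs_clamp_sub_le _ _).trans_lt (h hts)⟩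
  · set q : ℝ → ℝ := fun t => ‖(Icc (-L) L).indicator v t - w t‖
    have hqi : Integrable q := (hi.sub hwi).norm
    have hM := mul_meas_ge_le_integral_of_nonneg (Eventually.of_forall fun t => norm_nonneg _)
      hqi η
    have hfin : volume {t | η ≤ q t} ≠ ⊤ := (hqi.measure_ge_lt_top hη).ne
    refine (measure_mono (t := {t | η ≤ q t}) fun t ht => ?_).trans ?_
    · simp only [mem_ofPred_eq, q] at ht ⊢
      rw [indicator_of_mem (mem_Icc.2 (abs_le.1 ht.1)), Real.norm_eq_abs]
      have := abs_clamp_sub_le (a := a) (v t) (w t)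
      rw [clamp_eq (hva t)] at this
      exact ht.2.trans this
    · rw [← ENNReal.ofReal_toReal hfin]
      exact ENNReal.ofReal_le_ofReal (le_of_mul_le_mul_left (hM.trans hw) hη)

end

section Interaction

variable {Λ : Set (Space d)}

theorem measurable_potential (g : TestFun d) {v : ℝ → ℝ} (hv : Measurable v) :
    Measurable fun ω : Distr d => potential v Λ (convFun g ω) := by
  have h : StronglyMeasurable (Function.uncurry fun (ω : Distr d) x => v (convFun g ω x)) :=
    (hv.comp (measurable_uncurry_convFun g)).stronglyMeasurable
  exact (h.integral_prod_right (ν := volume.restrict Λ)).measurable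

/-- For a measurable energy density, the potential is approximated in mean by cylinder functionals,
uniformly over all noises with bounded variance for which the one-point laws of the smeared field
have bounded density up to a sufficiently small mass `e`. -/
theorem exists_isCylinder_potential_of_density (g : TestFun d) (hΛ : IsCompact Λ)
    {v : ℝ → ℝ} (hv : Measurable v) {a : ℝ} (ha : 0 ≤ a) (hva : ∀ t, |v t| ≤ a)
    {K : ℝ} (hK : 0 ≤ K) {B : ℝ} (hB : 0 ≤ B) {η : ℝ} (hη : 0 < η) :
    ∃ (F : Distr d → ℝ) (e : ℝ), IsCylinder F ∧ (∀ ω, |F ω| ≤ a * volume.real Λ) ∧ 0 < e ∧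
      ∀ P, HasWhiteNoiseBound K P → (∀ x A, MeasurableSet A → P {ω | convFun g ω x ∈ A} ≤
        ENNReal.ofReal B * volume A + ENNReal.ofReal e) →
        ∫ ω, |potential v Λ (convFun g ω) - F ω| ∂P ≤ η := by
  set vol := volume.real Λ
  have hvol : 0 ≤ vol := measureReal_nonneg
  have hvol1 : 0 < vol + 1 := by linarith
  set θ := η / (4 * (vol + 1))
  have hθ : 0 < θ := by positivity
  set q := θ / (3 * (2 * a + 1))
  have hq : 0 < q := by positivity
  set I := K * ∫ y, g y ^ 2
  have hI : 0 ≤ I := mul_nonneg hK (integral_sq_testFun_nonneg g)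
  set L := I / q + 1
  have hL1 : 1 ≤ L := le_add_of_nonneg_left (by positivity)
  have hIL : I / L ^ 2 ≤ q := by
    rw [div_le_iff₀ (by positivity)]
    have h1 : I ≤ q * L := by
      have : q * (I / q) = I := by field_simp
      simp only [L]
      nlinarith
    nlinarith
  -- the field leaves `[-L, L]` with probability at most `q`, and hits the exceptional set of the
  -- approximation in `[-L, L]` with probability at most `2q`
  obtain ⟨w, hw, hwa, hvw⟩ := exists_uniformContinuous_approx hv ha hva L hθ
    (κ := q / (B + 1)) (by positivity)
  obtain ⟨F, hF, hFa, hFP⟩ := exists_isCylinder_potential_of_uniformContinuous g hΛ hw ha hwa hK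
    (η := η / 2) (by positivity)
  refine ⟨F, q, hF, hFa, hq, fun P hP hd => ?_⟩
  have := hP.isProbabilityMeasure
  have : IsFiniteMeasure (volume.restrict Λ) := ⟨by simpa using hΛ.measure_lt_top⟩
  have hwm : Measurable w := hw.continuous.measurable
  have hu1 : Measurable fun p : Distr d × Space d => v (convFun g p.1 p.2) :=
    hv.comp (measurable_uncurry_convFun g)
  have hu2 : Measurable fun p : Distr d × Space d => w (convFun g p.1 p.2) :=
    hwm.comp (measurable_uncurry_convFun g)
  have hi : ∀ k : Space d → ℝ, Measurable k → (∀ x, |k x| ≤ a) →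
      Integrable k (volume.restrict Λ) := fun k hk hka =>
    Integrable.of_bound hk.aestronglyMeasurable a (Eventually.of_forall hka)
  have e : ∀ ω, potential v Λ (convFun g ω) - potential w Λ (convFun g ω) =
      ∫ x in Λ, (v (convFun g ω x) - w (convFun g ω x)) := fun ω =>
    (integral_sub (hi _ (hu1.comp measurable_prodMk_left) fun x => hva _)
      (hi _ (hu2.comp measurable_prodMk_left) fun x => hwa _)).symm
  have hub : ∀ t, |v t - w t| ≤ 2 * a := fun t =>
    (abs_sub _ _).trans (by linarith [hva t, hwa t])
  have hpot : ∀ k : ℝ → ℝ, Measurable k → (∀ t, |k t| ≤ a) →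
      Integrable (fun ω => potential k Λ (convFun g ω)) P := fun k hk hka => by
    exact Integrable.of_bound (measurable_potential g hk).aestronglyMeasurable (a * vol)
      (Eventually.of_forall fun ω => abs_setIntegral_le hΛ fun x => hka _)
  have hFi : Integrable F P := Integrable.of_bound hF.continuous.aestronglyMeasurable (a * vol)
    (Eventually.of_forall hFa)
  have hb := integral_abs_setIntegral_le (P := P) hΛ
    (u := fun ω x => v (convFun g ω x) - w (convFun g ω x)) (hu1.sub hu2) (b := 2 * a)
    (M := 2 * θ) (fun ω x => hub _) fun x _ => ?_
  · calc ∫ ω, |potential v Λ (convFun g ω) - F ω| ∂P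
        ≤ ∫ ω, (|potential v Λ (convFun g ω) - potential w Λ (convFun g ω)| +
            |potential w Λ (convFun g ω) - F ω|) ∂P :=
          integral_mono ((hpot v hv hva).sub hFi).abs
            (((hpot v hv hva).sub (hpot w hwm hwa)).abs.add ((hpot w hwm hwa).sub hFi).abs)
            fun ω => abs_sub_le _ _ _
      _ = ∫ ω, |potential v Λ (convFun g ω) - potential w Λ (convFun g ω)| ∂P +
            ∫ ω, |potential w Λ (convFun g ω) - F ω| ∂P :=
          integral_add ((hpot v hv hva).sub (hpot w hwm hwa)).abs ((hpot w hwm hwa).sub hFi).abs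
      _ ≤ η / 2 + η / 2 := by
          refine add_le_add ?_ (hFP P hP)
          simp only [e]
          refine hb.trans ?_
          have : 2 * θ * (vol + 1) = η / 2 := by simp only [θ]; field_simp; ring
          nlinarith
      _ = η := by ring
  · set X : Distr d → ℝ := fun ω => convFun g ω x
    have hX : Measurable X := measurable_convFun_apply g x
    set A : Set ℝ := {t | |t| ≤ L ∧ θ ≤ |v t - w t|}
    have hA : MeasurableSet A :=
      (measurableSet_le measurable_id.abs measurable_const).inter
        (measurableSet_le measurable_const (hv.sub hwm).abs)
    set bad : Set (Distr d) := {ω | θ ≤ |v (X ω) - w (X ω)|}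
    have hbadm : MeasurableSet bad := measurableSet_le (by fun_prop) (by fun_prop)
    have hPA : P.real {ω | X ω ∈ A} ≤ q + q := by
      refine ENNReal.toReal_le_of_le_ofReal (by positivity) ((hd x A hA).trans ?_)
      rw [ENNReal.ofReal_add hq.le hq.le]
      gcongr
      calc ENNReal.ofReal B * volume A ≤ ENNReal.ofReal B * ENNReal.ofReal (q / (B + 1)) := by
            gcongr
        _ = ENNReal.ofReal (B * (q / (B + 1))) := (ENNReal.ofReal_mul hB).symm
        _ ≤ ENNReal.ofReal q := by
            refine ENNReal.ofReal_le_ofReal ?_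
            rw [mul_div_assoc', div_le_iff₀ (by positivity)]
            nlinarith
    have hbad : P.real bad ≤ 3 * q := by
      calc P.real bad ≤ P.real ({ω | X ω ∈ A} ∪ {ω | L < |X ω|}) := by
            refine measureReal_mono fun ω hω => ?_
            rcases le_or_gt |X ω| L with h | h
            · exact Or.inl ⟨h, hω⟩
            · exact Or.inr h
        _ ≤ P.real {ω | X ω ∈ A} + P.real {ω | L < |X ω|} := measureReal_union_le _ _
        _ ≤ (q + q) + q := add_le_add hPA
            ((hP.measureReal_lt_abs_le hK g x (by linarith)).trans hIL)
        _ = 3 * q := by ring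
    calc ∫ ω, |v (X ω) - w (X ω)| ∂P
        ≤ ∫ ω, (θ + bad.indicator (fun _ => 2 * a) ω) ∂P := by
          refine integral_mono_of_nonneg (Eventually.of_forall fun ω => abs_nonneg _)
            ((integrable_const _).add ((integrable_const _).indicator hbadm))
            (Eventually.of_forall fun ω => ?_)
          by_cases hω : ω ∈ bad
          · simp only [indicator_of_mem hω]
            linarith [hub (X ω)]
          · simp only [indicator_of_notMem hω, add_zero]
            exact (not_le.1 hω).le
      _ = θ + P.real bad * (2 * a) := by
          rw [integral_add (integrable_const _) ((integrable_const _).indicator hbadm),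
            integral_indicator_const _ hbadm]
          simp
      _ ≤ θ + 3 * q * (2 * a) := by gcongr
      _ ≤ 2 * θ := by
          have : 3 * q * (2 * a + 1) = θ := by simp only [q]; field_simp
          nlinarith

/-! ### Convergence of the interacting fields -/

theorem abs_exp_sub_exp_le {x y M : ℝ} (hx : x ≤ M) (hy : y ≤ M) :
    |Real.exp x - Real.exp y| ≤ Real.exp M * |x - y| := by
  wlog h : y ≤ x generalizing x y
  · rw [abs_sub_comm, abs_sub_comm x]
    exact this hy hx (le_of_not_ge h)
  rw [abs_of_nonneg (sub_nonneg.2 (Real.exp_le_exp.2 h)), abs_of_nonneg (sub_nonneg.2 h)]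
  have h1 : Real.exp y = Real.exp x * Real.exp (y - x) := by rw [← Real.exp_add]; congr 1; ring
  have h2 := Real.add_one_le_exp (y - x)
  have h3 := Real.exp_pos x
  calc Real.exp x - Real.exp y ≤ Real.exp x * (x - y) := by rw [h1]; nlinarith
    _ ≤ Real.exp M * (x - y) :=
        mul_le_mul_of_nonneg_right (Real.exp_le_exp.2 hx) (sub_nonneg.2 h)

theorem abs_mul_exp_sub_le {A A' V V' a β M : ℝ} (hβ : 0 ≤ β) (hA' : |A'| ≤ a)
    (hV : |V| ≤ M) (hV' : |V'| ≤ M) :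
    |A * Real.exp (-β * V) - A' * Real.exp (-β * V')| ≤
      Real.exp (β * M) * (|A - A'| + a * β * |V - V'|) := by
  rw [abs_le] at hV hV'
  have e1 : -β * V ≤ β * M := by nlinarith
  have e2 : -β * V' ≤ β * M := by nlinarith
  have h1 := abs_exp_sub_exp_le e1 e2
  have h2 : |-β * V - -β * V'| = β * |V - V'| := by
    rw [← mul_sub, abs_mul, abs_neg, abs_of_nonneg hβ]
  rw [h2] at h1
  calc |A * Real.exp (-β * V) - A' * Real.exp (-β * V')|
      = |(A - A') * Real.exp (-β * V) + A' * (Real.exp (-β * V) - Real.exp (-β * V'))| := by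
        congr 1; ring
    _ ≤ |A - A'| * Real.exp (-β * V) + |A'| * |Real.exp (-β * V) - Real.exp (-β * V')| := by
        refine (abs_add_le _ _).trans ?_
        rw [abs_mul, abs_mul, Real.abs_exp]
    _ ≤ |A - A'| * Real.exp (β * M) + a * (Real.exp (β * M) * (β * |V - V'|)) := by
        gcongr
        exact (abs_nonneg _).trans hA'
    _ = _ := by ring

theorem abs_integral_mul_exp_sub_le {Ω : Type*} [MeasurableSpace Ω] {P : Measure Ω}
    [IsProbabilityMeasure P] {A A' V V' : Ω → ℝ} {a β M : ℝ} (hβ : 0 ≤ β)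
    (hAm : Measurable A) (hAm' : Measurable A') (hVm : Measurable V) (hVm' : Measurable V')
    (hA : ∀ ω, |A ω| ≤ a) (hA' : ∀ ω, |A' ω| ≤ a) (hV : ∀ ω, |V ω| ≤ M) (hV' : ∀ ω, |V' ω| ≤ M) :
    |∫ ω, A ω * Real.exp (-β * V ω) ∂P - ∫ ω, A' ω * Real.exp (-β * V' ω) ∂P| ≤
      Real.exp (β * M) * (∫ ω, |A ω - A' ω| ∂P + a * β * ∫ ω, |V ω - V' ω| ∂P) := by
  have hi : ∀ A V : Ω → ℝ, Measurable A → Measurable V → (∀ ω, |A ω| ≤ a) → (∀ ω, |V ω| ≤ M) →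
      Integrable (fun ω => A ω * Real.exp (-β * V ω)) P := fun A V hAm hVm hA hV => by
    refine Integrable.of_bound (by fun_prop) (a * Real.exp (β * M))
      (Eventually.of_forall fun ω => ?_)
    have := abs_le.1 (hV ω)
    rw [Real.norm_eq_abs, abs_mul, Real.abs_exp]
    refine mul_le_mul (hA ω) (Real.exp_le_exp.2 ?_) (Real.exp_pos _).le
      ((abs_nonneg _).trans (hA ω))
    nlinarith
  have hb : ∀ (V : Ω → ℝ) {b : ℝ}, Measurable V → (∀ ω, |V ω| ≤ b) → Integrable V P :=
    fun V b hm h => Integrable.of_bound hm.aestronglyMeasurable b (Eventually.of_forall h)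
  have iA := ((hb A hAm hA).sub (hb A' hAm' hA')).abs
  have iV := ((hb V hVm hV).sub (hb V' hVm' hV')).abs
  rw [← integral_sub (hi A V hAm hVm hA hV) (hi A' V' hAm' hVm' hA' hV')]
  calc |∫ ω, (A ω * Real.exp (-β * V ω) - A' ω * Real.exp (-β * V' ω)) ∂P|
      ≤ ∫ ω, |A ω * Real.exp (-β * V ω) - A' ω * Real.exp (-β * V' ω)| ∂P :=
        abs_integral_le_integral_abs
    _ ≤ ∫ ω, Real.exp (β * M) * (|A ω - A' ω| + a * β * |V ω - V' ω|) ∂P :=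
        integral_mono ((hi A V hAm hVm hA hV).sub (hi A' V' hAm' hVm' hA' hV')).abs
          ((iA.add (iV.const_mul _)).const_mul _)
          fun ω => abs_mul_exp_sub_le hβ (hA' ω) (hV ω) (hV' ω)
    _ = _ := by
        rw [integral_const_mul]
        congr 1
        rw [← integral_const_mul]
        exact integral_add iA (iV.const_mul _)

theorem measurable_convDistr (g : TestFun d) : Measurable (convDistr g) :=
  (convDistr g).continuous.measurable

theorem abs_potential_sub_le (g : TestFun d) (hΛ : IsCompact Λ) {v w : ℝ → ℝ} (hv : Measurable v)
    (hw : Measurable w) {a η : ℝ} (hva : ∀ t, |v t| ≤ a) (hwa : ∀ t, |w t| ≤ a)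
    (h : ∀ t, |v t - w t| ≤ η) (ω : Distr d) :
    |potential v Λ (convFun g ω) - potential w Λ (convFun g ω)| ≤ η * volume.real Λ := by
  have : IsFiniteMeasure (volume.restrict Λ) := ⟨by simpa using hΛ.measure_lt_top⟩
  have hX : Measurable (convFun g ω) := (continuous_convFun g ω).measurable
  have hi : ∀ k : ℝ → ℝ, Measurable k → (∀ t, |k t| ≤ a) →
      Integrable (fun x => k (convFun g ω x)) (volume.restrict Λ) := fun k hk hka =>
    Integrable.of_bound (hk.comp hX).aestronglyMeasurable a (Eventually.of_forall fun x => hka _)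
  rw [potential, potential, ← integral_sub (hi v hv hva) (hi w hw hwa)]
  exact abs_setIntegral_le hΛ fun x => h _

/-- Expectations of bounded continuous functionals, weighted by the Gibbs factor, converge when the
characteristic functionals of the noises do and the potential can be approximated in mean by
cylinder functionals. -/
theorem tendsto_integral_mul_exp_potential (g : TestFun d) (hΛ : IsCompact Λ) {β : ℝ} (hβ : 0 ≤ β)
    {K : ℝ} (hK : 0 ≤ K) {P : ℕ → Measure (Distr d)} {P' : Measure (Distr d)}
    (hP : ∀ n, HasWhiteNoiseBound K (P n)) (hP' : HasWhiteNoiseBound K P')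
    (hlim : ∀ f : TestFun d, Tendsto (fun n => ∫ ω, Complex.exp (Complex.I * (ω f : ℝ)) ∂(P n))
      atTop (𝓝 (∫ ω, Complex.exp (Complex.I * (ω f : ℝ)) ∂P')))
    {v : ℝ → ℝ} (hv : Measurable v) {a : ℝ} (ha : 0 ≤ a) (hva : ∀ t, |v t| ≤ a)
    (happrox : ∀ η > 0, ∃ F : Distr d → ℝ, IsCylinder F ∧ (∀ ω, |F ω| ≤ a * volume.real Λ) ∧
      (∀ᶠ n in atTop, ∫ ω, |potential v Λ (convFun g ω) - F ω| ∂(P n) ≤ η) ∧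
      ∫ ω, |potential v Λ (convFun g ω) - F ω| ∂P' ≤ η)
    {w : ℕ → ℝ → ℝ} (hw : ∀ᶠ n in atTop, Measurable (w n) ∧ ∀ t, |w n t| ≤ a)
    (hwv : ∀ η > 0, ∀ᶠ n in atTop, ∀ t, |w n t - v t| ≤ η) (φ : Distr d →ᵇ ℝ) :
    Tendsto (fun n => ∫ ω, φ (convDistr g ω) *
        Real.exp (-β * potential (w n) Λ (convFun g ω)) ∂(P n)) atTop
      (𝓝 (∫ ω, φ (convDistr g ω) * Real.exp (-β * potential v Λ (convFun g ω)) ∂P')) := by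
  set vol := volume.real Λ
  have hvol : 0 ≤ vol := measureReal_nonneg
  set M := a * vol
  have hM : 0 ≤ M := mul_nonneg ha hvol
  have hφ0 : 0 ≤ ‖φ‖ := norm_nonneg φ
  rw [Metric.tendsto_nhds]
  intro η hη
  set T := Real.exp (β * M) * (1 + ‖φ‖ * β * (1 + vol))
  have hT : 0 < T := by positivity
  set θ := η / (4 * T)
  have hθ : 0 < θ := by positivity
  have hTθ : T * θ = η / 4 := by simp only [θ]; field_simp
  obtain ⟨F₁, hF₁, hF₁b, hF₁P⟩ := exists_isCylinder_approx g
    (C := 1 + K * ∫ y, g y ^ 2)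
    (by have := mul_nonneg hK (integral_sq_testFun_nonneg g); linarith) φ hθ
  obtain ⟨F₂, hF₂, hF₂b, hF₂P, hF₂P'⟩ := happrox θ hθ
  have hFcyl : IsCylinder fun ω => F₁ ω * Real.exp (-β * F₂ ω) :=
    IsCylinder.comp₂ hF₁ hF₂ (H := fun s t => s * Real.exp (-β * t)) (by fun_prop)
  have hFb : ∀ ω, |F₁ ω * Real.exp (-β * F₂ ω)| ≤ ‖φ‖ * Real.exp (β * M) := fun ω => by
    have := abs_le.1 (hF₂b ω)
    rw [abs_mul, Real.abs_exp]
    refine mul_le_mul (hF₁b ω) (Real.exp_le_exp.2 ?_) (Real.exp_pos _).le hφ0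
    nlinarith
  have hFlim := tendsto_integral_of_isCylinder (fun n => (hP n).isProbabilityMeasure)
    hP'.isProbabilityMeasure hlim hFcyl (by positivity) hFb
  have hFi : ∀ {Q : Measure (Distr d)}, HasWhiteNoiseBound K Q → Integrable F₂ Q :=
    fun hQ => by
      have := hQ.isProbabilityMeasure
      exact Integrable.of_bound hF₂.continuous.aestronglyMeasurable M
        (Eventually.of_forall hF₂b)
  have hpi : ∀ {Q : Measure (Distr d)} {u : ℝ → ℝ}, HasWhiteNoiseBound K Q → Measurable u →
      (∀ t, |u t| ≤ a) → Integrable (fun ω => potential u Λ (convFun g ω)) Q :=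
    fun hQ hu hua => by
      have := hQ.isProbabilityMeasure
      exact Integrable.of_bound (measurable_potential g hu).aestronglyMeasurable M
        (Eventually.of_forall fun ω => abs_setIntegral_le hΛ fun x => hua _)
  have key : ∀ (Q : Measure (Distr d)) (u : ℝ → ℝ), HasWhiteNoiseBound K Q → Measurable u →
      (∀ t, |u t| ≤ a) → (∀ t, |u t - v t| ≤ θ) →
      ∫ ω, |potential v Λ (convFun g ω) - F₂ ω| ∂Q ≤ θ →
      |∫ ω, φ (convDistr g ω) * Real.exp (-β * potential u Λ (convFun g ω)) ∂Q -
        ∫ ω, F₁ ω * Real.exp (-β * F₂ ω) ∂Q| ≤ η / 4 := by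
    intro Q u hQ hu hua huv hvF
    have := hQ.isProbabilityMeasure
    have h1 : ∫ ω, |φ (convDistr g ω) - F₁ ω| ∂Q ≤ θ :=
      hF₁P Q inferInstance fun x => hQ.lintegral_enorm_convFun_le hK g x
    have h2 : ∫ ω, |potential u Λ (convFun g ω) - F₂ ω| ∂Q ≤ θ * vol + θ := by
      calc ∫ ω, |potential u Λ (convFun g ω) - F₂ ω| ∂Q
          ≤ ∫ ω, (θ * vol + |potential v Λ (convFun g ω) - F₂ ω|) ∂Q := by
            refine integral_mono ((hpi hQ hu hua).sub (hFi hQ)).abs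
              ((integrable_const _).add ((hpi hQ hv hva).sub (hFi hQ)).abs) fun ω => ?_
            exact (abs_sub_le _ (potential v Λ (convFun g ω)) _).trans
              (add_le_add (abs_potential_sub_le g hΛ hu hv hua hva huv ω) le_rfl)
        _ = θ * vol + ∫ ω, |potential v Λ (convFun g ω) - F₂ ω| ∂Q := by
            refine (integral_add (integrable_const _)
              ((hpi hQ hv hva).sub (hFi hQ)).abs).trans ?_
            simp
        _ ≤ θ * vol + θ := by gcongr
    refine (abs_integral_mul_exp_sub_le (a := ‖φ‖) (M := M) hβ
      (φ.continuous.measurable.comp (measurable_convDistr g)) hF₁.continuous.measurable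
      (measurable_potential g hu) hF₂.continuous.measurable (fun ω => φ.norm_coe_le_norm _) hF₁b
      (fun ω => abs_setIntegral_le hΛ fun x => hua _) hF₂b).trans ?_
    calc Real.exp (β * M) * (∫ ω, |φ (convDistr g ω) - F₁ ω| ∂Q +
          ‖φ‖ * β * ∫ ω, |potential u Λ (convFun g ω) - F₂ ω| ∂Q)
        ≤ Real.exp (β * M) * (θ + ‖φ‖ * β * (θ * vol + θ)) := by gcongr
      _ = T * θ := by simp only [T]; ring
      _ = η / 4 := hTθ
  filter_upwards [hw, hwv θ hθ, hF₂P, Metric.tendsto_nhds.1 hFlim (η / 4) (by positivity)]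
    with n hn hn2 hn3 hn4
  have k1 := key (P n) (w n) (hP n) hn.1 hn.2 hn2 hn3
  have k2 := key P' v hP' hv hva (fun t => by simpa using hθ.le) hF₂P'
  rw [← Real.dist_eq] at k1 k2
  rw [dist_comm] at k2
  refine (dist_triangle4 _ _ _ _).trans_lt (lt_of_le_of_lt (add_le_add (add_le_add k1 hn4.le) k2) ?_)
  linarith

theorem integrable_exp_potential {P : Measure (Distr d)} [IsFiniteMeasure P]
    (g : TestFun d) (hΛ : IsCompact Λ) {v : ℝ → ℝ} (hv : Measurable v) {a : ℝ}
    (hva : ∀ t, |v t| ≤ a) (β : ℝ) :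
    Integrable (fun ω => Real.exp (-β * potential v Λ (convFun g ω))) P := by
  refine Integrable.of_bound
    (((measurable_potential g hv).const_mul (-β)).exp.aestronglyMeasurable)
    (Real.exp (|β| * (a * volume.real Λ))) (Eventually.of_forall fun ω => ?_)
  rw [Real.norm_eq_abs, Real.abs_exp]
  refine Real.exp_le_exp.2 ((le_abs_self _).trans ?_)
  rw [abs_mul, abs_neg]
  exact mul_le_mul_of_nonneg_left (abs_setIntegral_le hΛ fun x => hva _) (abs_nonneg _)

theorem isProbabilityMeasure_interactingLaw {P : Measure (Distr d)} [IsProbabilityMeasure P]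
    (g : TestFun d) (hΛ : IsCompact Λ) {v : ℝ → ℝ} (hv : Measurable v) {a : ℝ}
    (hva : ∀ t, |v t| ≤ a) (β : ℝ) : IsProbabilityMeasure (interactingLaw P g v β Λ) := by
  have := isProbabilityMeasure_tilted (integrable_exp_potential (P := P) g hΛ hv hva β)
  exact Measure.isProbabilityMeasure_map (measurable_convDistr g).aemeasurable

theorem integral_interactingLaw (P : Measure (Distr d)) (g : TestFun d) (v : ℝ → ℝ) (β : ℝ)
    (φ : Distr d →ᵇ ℝ) : ∫ ω, φ ω ∂(interactingLaw P g v β Λ) =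
      (∫ ω, φ (convDistr g ω) * Real.exp (-β * potential v Λ (convFun g ω)) ∂P) /
        ∫ ω, Real.exp (-β * potential v Λ (convFun g ω)) ∂P := by
  rw [interactingLaw, integral_map (measurable_convDistr g).aemeasurable
    φ.continuous.measurable.aestronglyMeasurable, integral_tilted, ← integral_div]
  refine integral_congr_ae (Eventually.of_forall fun ω => ?_)
  simp only [smul_eq_mul]
  ring

theorem hasWhiteNoiseBound_gaussian {r : Measure ℝ} {P : Measure (Distr d)}
    (hP : IsNoiseLaw (gaussianChar (∫ s, s ^ 2 ∂r)) P) :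
    HasWhiteNoiseBound (4 * (2 * ∫ s, s ^ 2 ∂r)) P :=
  ⟨hP.isProbabilityMeasure, lintegral_sq_noise_le hP (norm_gaussianChar_le r)⟩

section Noise

variable {c : ℝ} {r : Measure ℝ} [IsProbabilityMeasure r]

theorem hasWhiteNoiseBound_poisson (hr : r (Icc (-c) c)ᶜ = 0) (hr_mean : ∫ s, s ∂r = 0) {z : ℝ}
    (hz : 1 ≤ z) {P : Measure (Distr d)} (hP : IsNoiseLaw (poissonChar z (scaledCharges r z)) P) :
    HasWhiteNoiseBound (4 * (2 * ∫ s, s ^ 2 ∂r)) P :=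
  ⟨hP.isProbabilityMeasure, lintegral_sq_noise_le hP (norm_poissonChar_le hr hr_mean hz)⟩

/-- The characteristic functionals of the scaled Poisson noises converge to the one of the Gaussian
noise. -/
theorem tendsto_charFunctional (hr : r (Icc (-c) c)ᶜ = 0) (hr_mean : ∫ s, s ∂r = 0)
    {PF : ℝ → Measure (Distr d)}
    (hPF : ∀ z, 1 ≤ z → IsNoiseLaw (poissonChar z (scaledCharges r z)) (PF z))
    {P' : Measure (Distr d)} (hP' : IsNoiseLaw (gaussianChar (∫ s, s ^ 2 ∂r)) P')
    (f : TestFun d) :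
    Tendsto (fun z => ∫ ω, Complex.exp (Complex.I * (ω f : ℝ)) ∂(PF z)) atTop
      (𝓝 (∫ ω, Complex.exp (Complex.I * (ω f : ℝ)) ∂P')) := by
  rw [hP'.charFunctional]
  have h := tendsto_integral_char (l := atTop) (ψ := fun z => poissonChar z (scaledCharges r z))
    (K := 2 * ∫ s, s ^ 2 ∂r) (Eventually.of_forall fun z => continuous_poissonChar z)
    ((eventually_ge_atTop 1).mono fun z hz => norm_poissonChar_le hr hr_mean hz)
    (tendsto_poissonChar hr hr_mean) f
  refine ((Complex.continuous_exp.tendsto _).comp h).congr' ?_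
  filter_upwards [eventually_ge_atTop 1] with z hz
  exact ((hPF z hz).charFunctional f).symm

theorem integral_sq_charge_pos (hr : r (Icc (-c) c)ᶜ = 0) (hr_zero : r {0} = 0) :
    0 < ∫ s, s ^ 2 ∂r := by
  rw [integral_pos_iff_support_of_nonneg (fun s => sq_nonneg s) (integrable_pow_charge hr 2)]
  have : (Function.support fun s : ℝ => s ^ 2) = {0}ᶜ := by ext s; simp
  rw [this, (prob_compl_eq_one_iff (measurableSet_singleton 0)).2 hr_zero]
  exact one_pos

theorem integral_sq_testFun_pos {g : TestFun d} (hg : g ≠ 0) : 0 < ∫ y, g y ^ 2 := by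
  obtain ⟨y, hy⟩ := DFunLike.ne_iff.1 hg
  rw [integral_pos_iff_support_of_nonneg (fun y => sq_nonneg (g y)) (integrable_sq_testFun g)]
  exact (g.continuous.pow 2).isOpen_support.measure_pos _ ⟨y, by simpa using hy⟩

theorem charFun_gaussian {σsq : ℝ} {P : Measure (Distr d)} (hP : IsNoiseLaw (gaussianChar σsq) P)
    (g : TestFun d) (x : Space d) (t : ℝ) :
    charFun (P.map fun ω => convFun g ω x) t =
      (Real.exp (-(σsq / 2 * ∫ y, g y ^ 2) * t ^ 2) : ℝ) := by
  rw [charFun_map_convFun hP]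
  simp only [gaussianChar]
  rw [integral_complex_ofReal, Complex.ofReal_exp]
  congr 2
  rw [← integral_const_mul, ← integral_neg, ← integral_mul_const]
  congr 1
  ext y
  ring

/-- The one-point laws of a nondegenerate Gaussian field have bounded density. -/
theorem gaussian_density_bound {σsq : ℝ} (hσ : 0 < σsq) {P : Measure (Distr d)}
    (hP : IsNoiseLaw (gaussianChar σsq) P) {g : TestFun d} (hg : g ≠ 0) :
    ∃ B : ℝ, ∀ (x : Space d) (A : Set ℝ), MeasurableSet A →
      P {ω | convFun g ω x ∈ A} ≤ ENNReal.ofReal B * volume A := by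
  have hk : 0 < σsq / 2 * ∫ y, g y ^ 2 := mul_pos (by positivity) (integral_sq_testFun_pos hg)
  set k := σsq / 2 * ∫ y, g y ^ 2
  have := hP.isProbabilityMeasure
  have hi := integrable_exp_neg_mul_sq hk
  refine ⟨∫ t, ‖((Real.exp (-k * t ^ 2) : ℝ) : ℂ)‖, fun x A hA => ?_⟩
  have hX := measurable_convFun_apply g x
  have : IsProbabilityMeasure (P.map fun ω => convFun g ω x) :=
    Measure.isProbabilityMeasure_map hX.aemeasurable
  have h := measure_le_of_charFun_eq (μ := P.map fun ω => convFun g ω x)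
    (h := fun t => ((Real.exp (-k * t ^ 2) : ℝ) : ℂ)) (R := fun _ => 1) (a := 0) le_rfl
    (p := fun _ => Measure.dirac 0) (fun _ => inferInstance) (fun t => by simp [charFun_dirac])
    hi.ofReal le_rfl (fun t => by rw [charFun_gaussian hP]; simp [k]) hA
  rw [Measure.map_apply hX hA, ENNReal.ofReal_zero, add_zero] at h
  exact h

/-- For a measurable energy density, the potential of the field is approximated in mean by cylinder
functionals, uniformly over the scaled Poisson noises of large activity and their Gaussian limit. -/
theorem exists_isCylinder_potential (hd : 1 ≤ d) (hr : r (Icc (-c) c)ᶜ = 0) (hr_zero : r {0} = 0)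
    (hr_mean : ∫ s, s ∂r = 0) {PF : ℝ → Measure (Distr d)}
    (hPF : ∀ z, 1 ≤ z → IsNoiseLaw (poissonChar z (scaledCharges r z)) (PF z))
    {P' : Measure (Distr d)} (hP' : IsNoiseLaw (gaussianChar (∫ s, s ^ 2 ∂r)) P')
    (g : TestFun d) (hΛ : IsCompact Λ) {v : ℝ → ℝ} (hv : Measurable v) {a : ℝ} (ha : 0 ≤ a)
    (hva : ∀ t, |v t| ≤ a) {η : ℝ} (hη : 0 < η) :
    ∃ F : Distr d → ℝ, IsCylinder F ∧ (∀ ω, |F ω| ≤ a * volume.real Λ) ∧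
      (∀ᶠ z in atTop, ∫ ω, |potential v Λ (convFun g ω) - F ω| ∂(PF z) ≤ η) ∧
      ∫ ω, |potential v Λ (convFun g ω) - F ω| ∂P' ≤ η := by
  have hS := integral_sq_charge_pos hr hr_zero
  -- for `g = 0` the field has no density, but its potential is constant
  by_cases hg : g = 0
  · have h0 : ∀ (ω : Distr d) x, convFun g ω x = 0 := fun ω x => by
      have : reflTranslate x g = 0 := SchwartzMap.ext fun y => by rw [reflTranslate_apply, hg]; rfl
      rw [convFun, this, map_zero]
    refine ⟨fun _ => ∫ x in Λ, v 0, isCylinder_const _, fun ω => abs_setIntegral_le hΛ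
      fun x => hva 0, Eventually.of_forall fun z => ?_, ?_⟩ <;>
    simpa [potential, h0] using hη.le
  · obtain ⟨B, m, hm, hB⟩ := exists_density_bound hd hr hr_zero hg
    obtain ⟨B', hB'⟩ := gaussian_density_bound hS hP' hg
    obtain ⟨F, e, hF, hFa, he, hFP⟩ := exists_isCylinder_potential_of_density g hΛ hv ha hva
      (K := 4 * (2 * ∫ s, s ^ 2 ∂r)) (by positivity) (B := max 0 (max B B')) (le_max_left _ _) hη
    refine ⟨F, hF, hFa, ?_, hFP P' (hasWhiteNoiseBound_gaussian hP') fun x A hA => ?_⟩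
    · have hlim : Tendsto (fun z : ℝ => Real.exp (-(z * m))) atTop (𝓝 0) :=
        Real.tendsto_exp_neg_atTop_nhds_zero.comp (tendsto_id.atTop_mul_const hm)
      filter_upwards [eventually_ge_atTop 1, hlim.eventually_le_const he] with z hz hze
      refine hFP _ (hasWhiteNoiseBound_poisson hr hr_mean hz (hPF z hz)) fun x A hA => ?_
      refine (hB z hz _ (hPF z hz) x A hA).trans ?_
      gcongr
      exact (le_max_left _ _).trans (le_max_right _ _)
    · refine (hB' x A hA).trans (le_add_right ?_)
      gcongr
      exact (le_max_right _ _).trans (le_max_right _ _)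

/-- The interacting fields converge in law when their energy densities are eventually uniformly
bounded and converge uniformly. -/
theorem convergesInLaw_interactingLaw (hd : 1 ≤ d) (hr : r (Icc (-c) c)ᶜ = 0) (hr_zero : r {0} = 0)
    (hr_mean : ∫ s, s ∂r = 0) {PF : ℝ → Measure (Distr d)}
    (hPF : ∀ z, 1 ≤ z → IsNoiseLaw (poissonChar z (scaledCharges r z)) (PF z))
    {P' : Measure (Distr d)} (hP' : IsNoiseLaw (gaussianChar (∫ s, s ^ 2 ∂r)) P')
    (g : TestFun d) (hΛ : IsCompact Λ) {β : ℝ} (hβ : 0 ≤ β) {v : ℝ → ℝ} (hv : Measurable v)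
    {a : ℝ} (hva : ∀ t, |v t| ≤ a) {w : ℝ → ℝ → ℝ}
    (hw : ∀ᶠ z in atTop, Measurable (w z) ∧ ∀ t, |w z t| ≤ a)
    (hwv : ∀ η > 0, ∀ᶠ z in atTop, ∀ t, |w z t - v t| ≤ η) :
    ConvergesInLaw (fun z => interactingLaw (PF z) g (w z) β Λ) (interactingLaw P' g v β Λ) := by
  have hprob' := hP'.isProbabilityMeasure
  have ha : 0 ≤ a := (abs_nonneg _).trans (hva 0)
  refine ⟨?_, isProbabilityMeasure_interactingLaw g hΛ hv hva β, fun φ => ?_⟩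
  · filter_upwards [hw, eventually_ge_atTop 1] with z hz hz1
    have := (hPF z hz1).isProbabilityMeasure
    exact isProbabilityMeasure_interactingLaw g hΛ hz.1 hz.2 β
  have main : ∀ φ : Distr d →ᵇ ℝ, Tendsto (fun z => ∫ ω, φ (convDistr g ω) *
        Real.exp (-β * potential (w z) Λ (convFun g ω)) ∂(PF z)) atTop
      (𝓝 (∫ ω, φ (convDistr g ω) * Real.exp (-β * potential v Λ (convFun g ω)) ∂P')) := by
    intro φ
    refine tendsto_of_seq_tendsto fun u hu => ?_
    -- the activities are raised to at least one, which changes finitely many terms only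
    have hu1 : ∀ᶠ n in atTop, max 1 (u n) = u n :=
      (hu.eventually_ge_atTop 1).mono fun n hn => max_eq_right hn
    have hu' : Tendsto (fun n => max 1 (u n)) atTop atTop :=
      hu.congr' (hu1.mono fun n hn => hn.symm)
    have hS : 0 ≤ ∫ s, s ^ 2 ∂r := integral_nonneg fun s => sq_nonneg s
    refine (tendsto_integral_mul_exp_potential g hΛ hβ (K := 4 * (2 * ∫ s, s ^ 2 ∂r))
      (by positivity) (P := fun n => PF (max 1 (u n))) (P' := P')
      (fun n => hasWhiteNoiseBound_poisson hr hr_mean (le_max_left _ _) (hPF _ (le_max_left _ _)))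
      (hasWhiteNoiseBound_gaussian hP')
      (fun f => (tendsto_charFunctional hr hr_mean hPF hP' f).comp hu') hv ha hva
      (fun η hη => ?_) (w := fun n => w (max 1 (u n))) (hu'.eventually hw)
      (fun η hη => hu'.eventually (hwv η hη)) φ).congr' ?_
    · obtain ⟨F, hF, hFa, hFz, hFσ⟩ := exists_isCylinder_potential hd hr hr_zero hr_mean hPF hP' g hΛ
        hv ha hva hη
      exact ⟨F, hF, hFa, hu'.eventually hFz, hFσ⟩
    · filter_upwards [hu1] with n hn
      simp only [hn, Function.comp_apply]
  simp only [integral_interactingLaw]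
  refine (main φ).div ?_ ?_
  · simpa using main (BoundedContinuousFunction.const _ 1)
  · exact (integral_exp_pos (integrable_exp_potential g hΛ hv hva β)).ne'

end Noise

end Interaction

/-! ### Normal ordering -/

/-- Complex measures have finite total variation, since their real and imaginary parts do. -/
theorem isFiniteMeasure_variation (ν : ComplexMeasure ℝ) : IsFiniteMeasure ν.variation := by
  refine isFiniteMeasure_of_le
    ((ComplexMeasure.re ν).totalVariation + (ComplexMeasure.im ν).totalVariation)
    (VectorMeasure.variation_le_of_forall_enorm_le fun A _ => ?_)
  rw [Measure.add_apply]
  refine le_trans ?_ (add_le_add ((ComplexMeasure.re ν).enorm_le_totalVariation A)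
    ((ComplexMeasure.im ν).enorm_le_totalVariation A))
  rw [← ofReal_norm, ← ofReal_norm, ← ofReal_norm,
    ← ENNReal.ofReal_add (norm_nonneg _) (norm_nonneg _)]
  exact ENNReal.ofReal_le_ofReal (Complex.norm_le_abs_re_add_abs_im _)

theorem ae_variation_mem {ν : ComplexMeasure ℝ} {S : Set ℝ} (hS : MeasurableSet S)
    (h : ∀ A, MeasurableSet A → Disjoint A S → ν A = 0) : ∀ᵐ α ∂ν.variation, α ∈ S :=
  (VectorMeasure.variation_apply_eq_zero hS.compl).2 fun A hA hAm =>
    h A hAm (disjoint_left.2 fun _ hx => hA hx)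

/-- Trigonometric integrals with weights `1 / m`, where `m ≥ δ > 0` on a set `S` carrying `ν`, are
measurable, bounded, and Lipschitz in `m` for the supremum norm on `S`, all with a constant that
depends on `ν` and `δ` only. -/
theorem exists_trigIntegral_bounds (ν : ComplexMeasure ℝ) {S : Set ℝ} (hS : MeasurableSet S)
    (hν : ∀ A, MeasurableSet A → Disjoint A S → ν A = 0) {δ : ℝ} (hδ : 0 < δ) :
    ∃ D, 0 ≤ D ∧ (∀ m : ℝ → ℝ, Continuous m → (∀ α ∈ S, δ ≤ m α) →
        Measurable (fun t => (∫ᵛ α, Real.cos (α * t) / m α ∂•ν).re) ∧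
        ∀ t, |(∫ᵛ α, Real.cos (α * t) / m α ∂•ν).re| ≤ D) ∧
      ∀ (m m' : ℝ → ℝ) (η : ℝ), Continuous m → Continuous m' → (∀ α ∈ S, δ ≤ m α) →
        (∀ α ∈ S, δ ≤ m' α) → (∀ α ∈ S, |m α - m' α| ≤ η) → ∀ t,
        |(∫ᵛ α, Real.cos (α * t) / m α ∂•ν).re - (∫ᵛ α, Real.cos (α * t) / m' α ∂•ν).re| ≤
          D * η := by
  have := isFiniteMeasure_variation ν
  have hae := ae_variation_mem hS hν
  set V := ‖ContinuousLinearMap.lsmul ℝ ℝ (E := ℂ)‖ * ν.variation.real univ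
  have hV : 0 ≤ V := by positivity
  have hbd : ∀ (m : ℝ → ℝ) (t : ℝ), (∀ α ∈ S, δ ≤ m α) →
      ∀ᵐ α ∂ν.variation, ‖Real.cos (α * t) / m α‖ ≤ 1 / δ := fun m t hm => by
    filter_upwards [hae] with α hα
    have := hm α hα
    rw [norm_div, Real.norm_eq_abs, Real.norm_eq_abs, abs_of_pos (hδ.trans_le this)]
    gcongr
    exact Real.abs_cos_le_one _
  have hmeas : ∀ (m : ℝ → ℝ) (t : ℝ), Continuous m →
      AEStronglyMeasurable (fun α => Real.cos (α * t) / m α) ν.variation := fun m t hm => by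
    have := hm.measurable
    exact (by fun_prop : Measurable fun α => Real.cos (α * t) / m α).aestronglyMeasurable
  refine ⟨1 / δ * V + 1 / δ ^ 2 * V, by positivity, fun m hm hmδ => ⟨?_, fun t => ?_⟩,
    fun m m' η hm hm' hmδ hmδ' hη t => ?_⟩
  · refine (Complex.continuous_re.comp (VectorMeasure.continuous_of_dominated
      (bound := fun _ => 1 / δ) (fun t => hmeas m t hm) (fun t => hbd m t hmδ)
      (integrable_const _) (Eventually.of_forall fun α => by fun_prop))).measurable
  · have h := VectorMeasure.norm_integral_le_of_norm_le_const
      (B := ContinuousLinearMap.lsmul ℝ ℝ (E := ℂ)) (hbd m t hmδ)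
    refine (Complex.abs_re_le_norm _).trans (h.trans ?_)
    rw [mul_assoc]
    exact le_add_of_nonneg_right (by positivity)
  · have hi : ∀ m : ℝ → ℝ, Continuous m → (∀ α ∈ S, δ ≤ m α) →
        ν.Integrable fun α => Real.cos (α * t) / m α := fun m hm hmδ =>
      Integrable.of_bound (hmeas m t hm) (1 / δ) (hbd m t hmδ)
    rw [← Complex.sub_re, ← VectorMeasure.integral_fun_sub (hi m hm hmδ) (hi m' hm' hmδ')]
    have h := VectorMeasure.norm_integral_le_of_norm_le_const
      (B := ContinuousLinearMap.lsmul ℝ ℝ (E := ℂ)) (μ := ν) (C := η / δ ^ 2)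
      (f := fun α => Real.cos (α * t) / m α - Real.cos (α * t) / m' α) (by
        filter_upwards [hae] with α hα
        have h1 := hmδ α hα
        have h2 := hmδ' α hα
        have p1 := hδ.trans_le h1
        have p2 := hδ.trans_le h2
        have e : Real.cos (α * t) / m α - Real.cos (α * t) / m' α =
            Real.cos (α * t) * (m' α - m α) / (m α * m' α) := by field_simp
        rw [e, norm_div, norm_mul, Real.norm_eq_abs, Real.norm_eq_abs, Real.norm_eq_abs,
          abs_of_pos (mul_pos p1 p2), abs_sub_comm]
        refine div_le_div₀ ((abs_nonneg _).trans (hη α hα)) ?_ (by positivity) ?_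
        · exact (mul_le_of_le_one_left (abs_nonneg _) (Real.abs_cos_le_one _)).trans (hη α hα)
        · rw [sq]
          exact mul_le_mul h1 h2 hδ.le p1.le)
    refine (Complex.abs_re_le_norm _).trans (h.trans ?_)
    -- for empty `S` the bound `η` may be negative, but then `ν = 0`
    rcases S.eq_empty_or_nonempty with hSe | ⟨α, hα⟩
    · have h0 : ν.variation = 0 := by
        rw [← ae_eq_bot, ← Filter.eventually_false_iff_eq_bot]
        simpa [hSe] using hae
      simp [V, h0]
    · have hη0 : 0 ≤ η := (abs_nonneg _).trans (hη α hα)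
      have : η / δ ^ 2 * ‖ContinuousLinearMap.lsmul ℝ ℝ (E := ℂ)‖ * ν.variation.real univ =
          1 / δ ^ 2 * V * η := by simp only [V]; ring
      rw [this]
      gcongr
      exact le_add_of_nonneg_left (by positivity)

section CosMean

variable {K : ℝ} {P : Measure (Distr d)}

theorem HasWhiteNoiseBound.abs_cosMean_sub_le (h : HasWhiteNoiseBound K P) (hK : 0 ≤ K)
    (g : TestFun d) (x : Space d) (α α' : ℝ) :
    |cosMean P g x α - cosMean P g x α'| ≤ (1 + K * ∫ y, g y ^ 2) * |α - α'| := by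
  have := h.isProbabilityMeasure
  have hX := measurable_convFun_apply g x
  have hi : ∀ α : ℝ, Integrable (fun ω => Real.cos (α * convFun g ω x)) P := fun α =>
    Integrable.of_bound (by fun_prop) 1 (Eventually.of_forall fun ω => Real.abs_cos_le_one _)
  have hsq : Integrable (fun ω => convFun g ω x ^ 2) P := h.integrable_sq _
  rw [cosMean, cosMean, ← integral_sub (hi α) (hi α')]
  calc |∫ ω, (Real.cos (α * convFun g ω x) - Real.cos (α' * convFun g ω x)) ∂P|
      ≤ ∫ ω, |Real.cos (α * convFun g ω x) - Real.cos (α' * convFun g ω x)| ∂P :=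
        abs_integral_le_integral_abs
    _ ≤ ∫ ω, (1 + convFun g ω x ^ 2) * |α - α'| ∂P := by
        refine integral_mono ((hi α).sub (hi α')).abs
          (((integrable_const _).add hsq).mul_const _) fun ω => ?_
        set X := convFun g ω x
        have h1 : |Real.cos (α * X) - Real.cos (α' * X)| ≤ |α * X - α' * X| := by
          simpa [Real.dist_eq] using Real.lipschitzWith_cos.dist_le_mul (α * X) (α' * X)
        refine h1.trans ?_
        rw [← sub_mul, abs_mul, mul_comm]
        refine mul_le_mul_of_nonneg_right ?_ (abs_nonneg _)
        rw [← sq_abs X]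
        nlinarith [sq_nonneg (|X| - 1), abs_nonneg X]
    _ = (1 + ∫ ω, convFun g ω x ^ 2 ∂P) * |α - α'| := by
        rw [integral_mul_const, integral_add (integrable_const _) hsq]
        simp
    _ ≤ (1 + K * ∫ y, g y ^ 2) * |α - α'| := by
        have := h.integral_sq_convFun_le hK g x
        gcongr

theorem HasWhiteNoiseBound.continuous_cosMean (h : HasWhiteNoiseBound K P) (hK : 0 ≤ K)
    (g : TestFun d) (x : Space d) : Continuous (cosMean P g x) := by
  have hC : 0 ≤ 1 + K * ∫ y, g y ^ 2 := by
    have := mul_nonneg hK (integral_sq_testFun_nonneg g)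
    linarith
  exact (LipschitzWith.of_dist_le_mul (K := ⟨_, hC⟩) fun α α' => by
    rw [Real.dist_eq, Real.dist_eq]
    exact h.abs_cosMean_sub_le hK g x α α').continuous

end CosMean

theorem cosMean_eq_re {ψ : ℝ → ℂ} {P : Measure (Distr d)} (hP : IsNoiseLaw ψ P) (g : TestFun d)
    (x : Space d) (α : ℝ) :
    cosMean P g x α = (∫ ω, Complex.exp (Complex.I * (ω (α • g) : ℝ)) ∂P).re := by
  have := hP.isProbabilityMeasure
  have h1 : ∫ ω, Complex.exp (Complex.I * (ω (α • g) : ℝ)) ∂P =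
      ∫ ω, Complex.exp (Complex.I * (α * convFun g ω x : ℝ)) ∂P := by
    rw [hP.charFunctional]
    refine Eq.trans ?_ (integral_noise_exp_smul hP (reflTranslate x g) α).symm
    rw [integral_reflTranslate (fun a => ψ (α * a))]
    rfl
  rw [h1, ← Complex.reCLM_apply, ← ContinuousLinearMap.integral_comp_comm]
  · refine integral_congr_ae (Eventually.of_forall fun ω => ?_)
    simp only [Complex.reCLM_apply]
    rw [mul_comm Complex.I, Complex.exp_ofReal_mul_I_re]
  · exact integrable_exp_I_mul ((measurable_convFun_apply g x).const_mul α)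

section Noise

variable {c : ℝ} {r : Measure ℝ} [IsProbabilityMeasure r]

theorem cosMean_gaussian {σsq : ℝ} {P : Measure (Distr d)} (hP : IsNoiseLaw (gaussianChar σsq) P)
    (g : TestFun d) (x : Space d) (α : ℝ) :
    cosMean P g x α = Real.exp (-(σsq / 2 * ∫ y, g y ^ 2) * α ^ 2) := by
  rw [cosMean_eq_re hP, hP.charFunctional]
  have e : ∫ y, gaussianChar σsq ((α • g) y) =
      ((-(σsq / 2 * ∫ y, g y ^ 2) * α ^ 2 : ℝ) : ℂ) := by
    simp only [gaussianChar]
    rw [integral_complex_ofReal, ← integral_const_mul, ← integral_neg, ← integral_mul_const]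
    congr 2
    ext y
    simp only [smul_apply, smul_eq_mul]
    ring
  rw [e, ← Complex.ofReal_exp, Complex.ofReal_re]

/-- The means `E[cos(α X(x))]` of the Poisson fields converge to the Gaussian one, uniformly for `α`
in a compact set: they converge pointwise and are uniformly Lipschitz in `α`. -/
theorem eventually_abs_cosMean_sub_le (hr : r (Icc (-c) c)ᶜ = 0) (hr_mean : ∫ s, s ∂r = 0)
    {PF : ℝ → Measure (Distr d)}
    (hPF : ∀ z, 1 ≤ z → IsNoiseLaw (poissonChar z (scaledCharges r z)) (PF z))
    {P' : Measure (Distr d)} (hP' : IsNoiseLaw (gaussianChar (∫ s, s ^ 2 ∂r)) P')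
    (g : TestFun d) (x : Space d) {S : Set ℝ} (hS : IsCompact S) {η : ℝ} (hη : 0 < η) :
    ∀ᶠ z in atTop, ∀ α ∈ S, |cosMean (PF z) g x α - cosMean P' g x α| ≤ η := by
  have hS2 : 0 ≤ ∫ s, s ^ 2 ∂r := integral_nonneg fun s => sq_nonneg s
  have hK : 0 ≤ 4 * (2 * ∫ s, s ^ 2 ∂r) := by positivity
  set C := 1 + 4 * (2 * ∫ s, s ^ 2 ∂r) * ∫ y, g y ^ 2
  have hC : 0 < C := by
    have := mul_nonneg hK (integral_sq_testFun_nonneg g)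
    simp only [C]
    linarith
  refine hS.induction_on (p := fun S => ∀ᶠ z in atTop, ∀ α ∈ S,
    |cosMean (PF z) g x α - cosMean P' g x α| ≤ η) (by simp)
    (fun s t hst h => h.mono fun z hz α hα => hz α (hst hα))
    (fun s t hs ht => by
      filter_upwards [hs, ht] with z h1 h2 α hα
      exact hα.elim (h1 α) (h2 α)) fun α₀ _ => ?_
  refine ⟨Metric.ball α₀ (η / (3 * C)), mem_nhdsWithin_of_mem_nhds
    (Metric.ball_mem_nhds _ (by positivity)), ?_⟩
  have hlim : Tendsto (fun z => cosMean (PF z) g x α₀) atTop (𝓝 (cosMean P' g x α₀)) := by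
    rw [cosMean_eq_re hP']
    refine ((Complex.continuous_re.tendsto _).comp
      (tendsto_charFunctional hr hr_mean hPF hP' (α₀ • g))).congr' ?_
    filter_upwards [eventually_ge_atTop 1] with z hz
    exact (cosMean_eq_re (hPF z hz) g x α₀).symm
  filter_upwards [eventually_ge_atTop 1, Metric.tendsto_nhds.1 hlim (η / 3) (by positivity)]
    with z hz hz0 α hα
  have h1 := (hasWhiteNoiseBound_poisson hr hr_mean hz (hPF z hz)).abs_cosMean_sub_le hK g x α α₀
  have h2 := (hasWhiteNoiseBound_gaussian hP').abs_cosMean_sub_le hK g x α₀ α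
  have h3 : C * |α - α₀| ≤ η / 3 := by
    have h4 : |α - α₀| ≤ η / (3 * C) := by
      rw [Metric.mem_ball, Real.dist_eq] at hα
      exact hα.le
    calc C * |α - α₀| ≤ C * (η / (3 * C)) := by gcongr
      _ = η / 3 := by field_simp
  rw [abs_sub_comm α₀ α] at h2
  rw [← Real.dist_eq] at h1 h2 ⊢
  refine (dist_triangle4 _ (cosMean (PF z) g x α₀) (cosMean P' g x α₀) _).trans ?_
  linarith [h1.trans h3, h2.trans h3]

/-- The Gaussian means `e^{-kα²}` are bounded below by `e^{-kb²}` on `[-b, b]`, and the Poisson means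
are uniformly close to them. -/
theorem exists_pos_le_cosMean (hr : r (Icc (-c) c)ᶜ = 0) (hr_mean : ∫ s, s ∂r = 0)
    {PF : ℝ → Measure (Distr d)}
    (hPF : ∀ z, 1 ≤ z → IsNoiseLaw (poissonChar z (scaledCharges r z)) (PF z))
    {P' : Measure (Distr d)} (hP' : IsNoiseLaw (gaussianChar (∫ s, s ^ 2 ∂r)) P')
    (g : TestFun d) (x : Space d) (b : ℝ) :
    ∃ δ > 0, (∀ᶠ z in atTop, ∀ α ∈ Icc (-b) b, δ ≤ cosMean (PF z) g x α) ∧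
      ∀ α ∈ Icc (-b) b, δ ≤ cosMean P' g x α := by
  have hS2 : 0 ≤ ∫ s, s ^ 2 ∂r := integral_nonneg fun s => sq_nonneg s
  have hk : 0 ≤ (∫ s, s ^ 2 ∂r) / 2 * ∫ y, g y ^ 2 :=
    mul_nonneg (by positivity) (integral_sq_testFun_nonneg g)
  set k := (∫ s, s ^ 2 ∂r) / 2 * ∫ y, g y ^ 2
  set δ := Real.exp (-k * b ^ 2)
  have hδ : 0 < δ := Real.exp_pos _
  have hG : ∀ α ∈ Icc (-b) b, δ ≤ cosMean P' g x α := fun α hα => by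
    rw [cosMean_gaussian hP']
    refine Real.exp_le_exp.2 ?_
    have : α ^ 2 ≤ b ^ 2 := sq_le_sq' hα.1 hα.2
    simp only [neg_mul, neg_le_neg_iff]
    exact mul_le_mul_of_nonneg_left this hk
  refine ⟨δ / 2, by positivity, ?_, fun α hα => (half_le_self hδ.le).trans (hG α hα)⟩
  filter_upwards [eventually_abs_cosMean_sub_le hr hr_mean hPF hP' g x isCompact_Icc
    (half_pos hδ)] with z hz α hα
  have := abs_le.1 (hz α hα)
  linarith [hG α hα]

theorem convergesInLaw_normalOrdered (hd : 1 ≤ d) (hr : r (Icc (-c) c)ᶜ = 0) (hr_zero : r {0} = 0)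
    (hr_mean : ∫ s, s ∂r = 0) {PF : ℝ → Measure (Distr d)}
    (hPF : ∀ z, 1 ≤ z → IsNoiseLaw (poissonChar z (scaledCharges r z)) (PF z))
    {P' : Measure (Distr d)} (hP' : IsNoiseLaw (gaussianChar (∫ s, s ^ 2 ∂r)) P')
    (g : TestFun d) {Λ : Set (Space d)} (hΛ : IsCompact Λ) {β : ℝ} (hβ : 0 ≤ β) (b : ℝ)
    (ν : ComplexMeasure ℝ) (x : Space d)
    (hν : ∀ A, MeasurableSet A → Disjoint A (Icc (-b) b) → ν A = 0) :
    ConvergesInLaw (fun z => interactingLaw (PF z) g (normalOrdered (PF z) g x ν) β Λ)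
      (interactingLaw P' g (normalOrdered P' g x ν) β Λ) := by
  have hS2 : 0 ≤ ∫ s, s ^ 2 ∂r := integral_nonneg fun s => sq_nonneg s
  have hK : 0 ≤ 4 * (2 * ∫ s, s ^ 2 ∂r) := by positivity
  obtain ⟨δ, hδ, hδz, hδσ⟩ := exists_pos_le_cosMean hr hr_mean hPF hP' g x b
  obtain ⟨D, hD, hD1, hD2⟩ := exists_trigIntegral_bounds ν measurableSet_Icc hν hδ
  have hcσ := (hasWhiteNoiseBound_gaussian hP').continuous_cosMean hK g x
  have hcz : ∀ z, 1 ≤ z → Continuous (cosMean (PF z) g x) := fun z hz =>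
    (hasWhiteNoiseBound_poisson hr hr_mean hz (hPF z hz)).continuous_cosMean hK g x
  obtain ⟨hmσ, hbσ⟩ := hD1 _ hcσ hδσ
  refine convergesInLaw_interactingLaw hd hr hr_zero hr_mean hPF hP' g hΛ hβ (a := D) hmσ hbσ ?_ ?_
  · filter_upwards [hδz, eventually_ge_atTop 1] with z hz hz1
    exact hD1 _ (hcz z hz1) hz
  · intro η hη
    filter_upwards [hδz, eventually_ge_atTop 1, eventually_abs_cosMean_sub_le hr hr_mean hPF hP' g x
      (isCompact_Icc (a := -b) (b := b)) (η := η / (D + 1)) (by positivity)] with z hz hz1 hzη t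
    refine (hD2 _ _ _ (hcz z hz1) hcσ hz hδσ hzη t).trans ?_
    rw [mul_div_assoc', div_le_iff₀ (by positivity)]
    nlinarith

end Noise

end CPN

end

theorem theorem7p1 (d : ℕ) (hd : 1 ≤ d)
    (c : ℝ) (r : Measure ℝ) [IsProbabilityMeasure r] (hr : r (Icc (-c) c)ᶜ = 0)
    (hr_zero : r {0} = 0) (hr_mean : ∫ s, s ∂r = 0)
    (G : CPN.Distr d) (hG : CPN.IsConvolutor G)
    (χ : CPN.Cutoff d) (ε : ℝ) (hε : 0 < ε)
    (Λ : Set (CPN.Space d)) (hΛ : IsCompact Λ) (β : ℝ) (hβ : 0 < β)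
    (PF : ℝ → Measure (CPN.Distr d))
    (hPF : ∀ z, 1 ≤ z → CPN.IsNoiseLaw (CPN.poissonChar z (CPN.scaledCharges r z)) (PF z))
    (PFσ : Measure (CPN.Distr d))
    (hPFσ : CPN.IsNoiseLaw (CPN.gaussianChar (∫ s, s ^ 2 ∂r)) PFσ) :
    -- bounded energy densities
    (∀ (v : ℝ → ℝ) (a : ℝ), Measurable v → (∀ t, |v t| ≤ a) →
      (∀ z, 1 ≤ z → IsProbabilityMeasure
        (CPN.interactingLaw (PF z) (CPN.regKernel hG χ ε hε) v β Λ)) ∧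
      CPN.ConvergesInLaw
        (fun z => CPN.interactingLaw (PF z) (CPN.regKernel hG χ ε hε) v β Λ)
        (CPN.interactingLaw PFσ (CPN.regKernel hG χ ε hε) v β Λ)) ∧
    -- normal ordered trigonometric energy densities
    (∀ (b : ℝ) (ν : ComplexMeasure ℝ) (x : CPN.Space d),
      (∀ A, MeasurableSet A → Disjoint A (Icc (-b) b) → ν A = 0) →
      (∀ A, MeasurableSet A → ν A = (starRingEnd ℂ) (ν (Neg.neg ⁻¹' A))) →
      (∃ δ > 0, (∀ᶠ z in atTop, ∀ α ∈ Icc (-b) b,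
          δ ≤ CPN.cosMean (PF z) (CPN.regKernel hG χ ε hε) x α) ∧
        ∀ α ∈ Icc (-b) b, δ ≤ CPN.cosMean PFσ (CPN.regKernel hG χ ε hε) x α) ∧
      CPN.ConvergesInLaw
        (fun z => CPN.interactingLaw (PF z) (CPN.regKernel hG χ ε hε)
          (CPN.normalOrdered (PF z) (CPN.regKernel hG χ ε hε) x ν) β Λ)
        (CPN.interactingLaw PFσ (CPN.regKernel hG χ ε hε)
          (CPN.normalOrdered PFσ (CPN.regKernel hG χ ε hε) x ν) β Λ)) := by
  refine ⟨fun v a hv hva => ⟨fun z hz => ?_, ?_⟩, fun b ν x hν _ => ⟨?_, ?_⟩⟩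
  · have := (hPF z hz).isProbabilityMeasure
    exact CPN.isProbabilityMeasure_interactingLaw _ hΛ hv hva β
  · exact CPN.convergesInLaw_interactingLaw hd hr hr_zero hr_mean hPF hPFσ _ hΛ hβ.le hv hva
      (Eventually.of_forall fun z => ⟨hv, hva⟩)
      fun η hη => Eventually.of_forall fun z t => by simpa using hη.le
  · exact CPN.exists_pos_le_cosMean hr hr_mean hPF hPFσ _ x b
  · exact CPN.convergesInLaw_normalOrdered hd hr hr_zero hr_mean hPF hPFσ _ hΛ hβ.le b ν x hν
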